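/- Let $d\ge 1$, let $M\cong\mathbb Z^{d+1}$ be a lattice with dual lattice $N$, and let $\langle\cdot,\cdot\rangle$ be the pairing of $M_{\mathbb R}$ and $N_{\mathbb R}$. Let $\Delta\subset M_{\mathbb R}$ be a reflexive polytope, i.e. a lattice polytope with $0$ in its interior such that $\{n:\langle m,n\rangle\le 1\ \forall m\in\Delta\}$ is also a lattice polytope. Let $h:\Delta\cap M\to\mathbb Z$ be a height function: $h(0)=0<h(m)$ for $0\ne m\in\Delta\cap M$. Put $$\Delta^\vee_h=\{n\in N_{\mathbb R}:\langle m,n\rangle\le h(m)\ \forall m\in\Delta\cap M\},\qquad A=\partial\Delta,\qquad B=\partial\Delta^\vee_h,$$ and let $B^\circ$ be the union of the relative interiors $\tau^\circ$ of the facets $\tau$ of $\Delta^\vee_h$. For $m\in A\cap M$ let $\mathrm{St}(m)$ be the union of the closed faces of $A$ containing $m$, and $\tau_m=\{n\in\Delta^\vee_h:\langle m,n\rangle=h(m)\}$. On a facet (of $\Delta$ or of $\Delta^\vee_h$), an integral coordinate system is an affine identification of its affine span with $\mathbb R^d$ that maps the lattice of integral vectors in its tangent space onto $\mathbb Z^d$.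 Let $\mu_M$ be the measure on $A$ that is, on each facet of $\Delta$, Lebesgue measure in integral coordinates. Let $\mathcal P(\Delta)$ be the set of convex functions $\Psi$ on $N_{\mathbb R}$ with $\sup_{n}|\Psi(n)-\sup_{m\in\Delta\cap M}\langle m,n\rangle|<\infty$. For a measure $\nu$ on $B^\circ$ we write $\mathrm{MA}(\Psi|_{B^\circ})=\nu$ if for every facet $\tau$ of $\Delta^\vee_h$, every integral coordinate system $\beta$ on $\tau$ and every Borel set $E\subset\tau^\circ$ the image $\partial(\Psi\circ\beta^{-1})(\beta(E))\subset\mathbb R^d$ of $\beta(E)$ under the multivalued gradient of the convex function $\Psi\circ\beta^{-1}$ on $\beta(\tau^\circ)$ has Lebesgue measure $\nu(E)$. Let $\nu$ be a positive Borel measure on $B^\circ$ of total mass $\mu_M(A)$. A transport plan is a positive measure $\gamma$ on $A\times B$ with marginals $\mu_M$ and $\nu$; it is optimal if it minimizes $-\int\langle m,n\rangle\,d\gamma$ among all transport plans. Call $(\Delta,h,\nu)$ stable if some optimal transport plan is supported on $\bigcup_{m\in A\cap M}\mathrm{St}(m)\times\tau_m$. Theorem. There is $\Psi\in\mathcal P(\Delta)$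 with $\mathrm{MA}(\Psi|_{B^\circ})=\nu$ if and only if $(\Delta,h,\nu)$ is stable. Moreover, if $\Psi,\Psi'\in\mathcal P(\Delta)$ both satisfy $\mathrm{MA}(\Psi|_{B^\circ})=\mathrm{MA}(\Psi'|_{B^\circ})=\nu$, then $\Psi-\Psi'$ is constant on $B$. -/

import Mathlib

open MeasureTheory

noncomputable section

namespace TropicalMA

/-- The real vector space spanned by a lattice of rank `d + 1`, in a basis of the lattice. It is used
both for `M_ℝ` and, in the dual basis, for `N_ℝ`; the pairing `⟨m, n⟩` is then the dot product
`m ⬝ᵥ n`. -/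
abbrev RVec (d : ℕ) := Fin (d + 1) → ℝ

/-- The lattice of rank `d + 1` (either `M` or its dual lattice `N`). -/
abbrev ZVec (d : ℕ) := Fin (d + 1) → ℤ

variable {d : ℕ}

/-- The inclusion of the lattice in the real vector space. -/
def latt (m : ZVec d) : RVec d := fun i => (m i : ℝ)

/-! ### Polytopes and their faces -/

/-- A lattice polytope: the convex hull of finitely many lattice points. -/
def IsLatticePolytope (P : Set (RVec d)) : Prop :=
  ∃ S : Finset (ZVec d), P = convexHull ℝ (latt '' (S : Set (ZVec d)))

/-- The dual polytope `{n | ⟨m, n⟩ ≤ 1 for all m ∈ P}`. -/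
def dualPolytope (P : Set (RVec d)) : Set (RVec d) := {n | ∀ m ∈ P, m ⬝ᵥ n ≤ 1}

/-- A reflexive polytope: a lattice polytope with the origin in its interior, whose dual is a
lattice polytope as well. -/
structure IsReflexive (P : Set (RVec d)) : Prop where
  lattice : IsLatticePolytope P
  zero_mem : (0 : RVec d) ∈ interior P
  dual_lattice : IsLatticePolytope (dualPolytope P)

/-- The nonempty proper closed faces of a polytope, i.e. the closed faces of its boundary. -/
structure IsProperFace (P F : Set (RVec d)) : Prop where
  nonempty : F.Nonempty
  exposed : IsExposed ℝ P F
  ne : F ≠ P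

/-- The facets of a polytope of dimension `d + 1`: its faces of dimension `d`. -/
structure IsFacet (P F : Set (RVec d)) : Prop where
  nonempty : F.Nonempty
  exposed : IsExposed ℝ P F
  finrank_eq : Module.finrank ℝ (vectorSpan ℝ F) = d

/-- The union of the relative interiors of the facets of `P`. -/
def openFacets (P : Set (RVec d)) : Set (RVec d) :=
  ⋃ F ∈ {F : Set (RVec d) | IsFacet P F}, intrinsicInterior ℝ F

/-- The closed star of `m`: the union of all closed faces of the boundary of `P` that contain `m`. -/
def closedStar (P : Set (RVec d)) (m : RVec d) : Set (RVec d) :=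
  ⋃ F ∈ {F : Set (RVec d) | IsProperFace P F ∧ m ∈ F}, F

/-! ### Height functions -/

/-- `h` is a height function on the lattice points of `Δ`: `h 0 = 0 < h m` for every lattice point
`m ≠ 0` of `Δ`. Values of `h` outside `Δ` are never used. -/
structure IsHeight (Δ : Set (RVec d)) (h : ZVec d → ℤ) : Prop where
  zero : h 0 = 0
  pos : ∀ m : ZVec d, latt m ∈ Δ → m ≠ 0 → 0 < h m

/-- The polytope `Δ^∨_h = {n | ⟨m, n⟩ ≤ h m for all lattice points m of Δ}`. -/
def heightDual (Δ : Set (RVec d)) (h : ZVec d → ℤ) : Set (RVec d) :=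
  {n | ∀ m : ZVec d, latt m ∈ Δ → latt m ⬝ᵥ n ≤ h m}

/-- The face `τ_m` of `Δ^∨_h` dual to `m`. -/
def dualFace (Δ : Set (RVec d)) (h : ZVec d → ℤ) (m : ZVec d) : Set (RVec d) :=
  {n ∈ heightDual Δ h | latt m ⬝ᵥ n = h m}

/-! ### Tropical affine structure and Lebesgue measure of a facet -/

/-- An affine coordinate system of the affine span of a `d`-dimensional set `F` that is compatible
with its tropical affine structure: an origin in the affine span together with a basis of the
lattice of integral vectors in the tangent space of `F`. -/
structure IntegralChart (F : Set (RVec d)) where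
  base : RVec d
  base_mem : base ∈ affineSpan ℝ F
  frame : Fin d → ZVec d
  linearIndependent : LinearIndependent ℤ frame
  mem_span_iff : ∀ m : ZVec d,
    m ∈ Submodule.span ℤ (Set.range frame) ↔ latt m ∈ vectorSpan ℝ F

/-- The inverse `β⁻¹ : ℝ^d → affspan F` of the coordinate function `β` of an integral chart. -/
def IntegralChart.param {F : Set (RVec d)} (β : IntegralChart F) (y : Fin d → ℝ) : RVec d :=
  β.base + ∑ i, y i • latt (β.frame i)

open Classical in
/-- The integral Lebesgue measure of a facet `F`: Lebesgue measure in the coordinates of an integral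
chart, restricted to `F`. Two integral charts differ by an affine map with linear part in `GL_d(ℤ)`,
so that the choice of the chart is immaterial. -/
def facetMeasure (F : Set (RVec d)) : Measure (RVec d) :=
  if H : Nonempty (IntegralChart F) then
    ((volume : Measure (Fin d → ℝ)).map H.some.param).restrict F
  else 0

/-- The integral Lebesgue measure `μ_M` on the boundary of the polytope `P`. -/
def boundaryMeasure (P : Set (RVec d)) : Measure (RVec d) :=
  Measure.sum fun F : {F : Set (RVec d) // IsFacet P F} => facetMeasure F.1

/-! ### The space `𝒫(Δ)` and the real Monge–Ampère equation -/

/-- The space `𝒫(Δ)` of convex functions on `N_ℝ` at bounded distance from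
`n ↦ sup {⟨m, n⟩ | m ∈ Δ ∩ M}`. -/
def potentials (Δ : Set (RVec d)) : Set (RVec d → ℝ) :=
  {Ψ | ConvexOn ℝ Set.univ Ψ ∧
    ∃ C : ℝ, ∀ n, |Ψ n - ⨆ m : {m : ZVec d // latt m ∈ Δ}, latt m.1 ⬝ᵥ n| ≤ C}

/-- The multivalued gradient at `y` of a function `u` on the subset `U` of `ℝ^d`. -/
def subgradient (U : Set (Fin d → ℝ)) (u : (Fin d → ℝ) → ℝ) (y : Fin d → ℝ) : Set (Fin d → ℝ) :=
  {p | ∀ y' ∈ U, u y + p ⬝ᵥ (y' - y) ≤ u y'}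

/-- The image `∂(Ψ ∘ β⁻¹)(β(E))` of a subset `E` of the relative interior `τ°` of the facet `τ`
under the multivalued gradient of the function `Ψ ∘ β⁻¹` on `β(τ°)`. -/
def gradientImage {τ : Set (RVec d)} (β : IntegralChart τ) (Ψ : RVec d → ℝ) (E : Set (RVec d)) :
    Set (Fin d → ℝ) :=
  ⋃ y ∈ β.param ⁻¹' E, subgradient (β.param ⁻¹' intrinsicInterior ℝ τ) (Ψ ∘ β.param) y

/-- `MA(Ψ) = ν` on the open facets of `P`, in the sense of Aleksandrov: on each open facet `τ°`, the
measure of a Borel set is the Lebesgue measure of its image under the multivalued gradient in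
coordinates that are compatible with the tropical affine structure. -/
def SolvesMA (P : Set (RVec d)) (ν : Measure (RVec d)) (Ψ : RVec d → ℝ) : Prop :=
  ∀ τ : Set (RVec d), IsFacet P τ → ∀ β : IntegralChart τ,
    ∀ E : Set (RVec d), MeasurableSet E → E ⊆ intrinsicInterior ℝ τ →
      volume (gradientImage β Ψ E) = ν E

/-! ### Optimal transport and stability -/

/-- `γ` is a transport plan from `μ` to `ν`: a measure on the product with marginals `μ` and `ν`.
(If `μ` and `ν` live on `A` and `B`, then `γ` lives on `A × B`.) -/
structure IsTransportPlan (μ ν : Measure (RVec d)) (γ : Measure (RVec d × RVec d)) : Prop where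
  fst : γ.map Prod.fst = μ
  snd : γ.map Prod.snd = ν

/-- The transport cost `-∫ ⟨m, n⟩ dγ`. -/
def transportCost (γ : Measure (RVec d × RVec d)) : ℝ := -∫ p, p.1 ⬝ᵥ p.2 ∂γ

/-- `γ` is an optimal transport plan: it minimizes the cost among all transport plans. -/
def IsOptimalPlan (μ ν : Measure (RVec d)) (γ : Measure (RVec d × RVec d)) : Prop :=
  IsTransportPlan μ ν γ ∧ ∀ γ', IsTransportPlan μ ν γ' → transportCost γ ≤ transportCost γ'

/-- The union over the boundary lattice points `m` of `Δ` of the sets `St(m) × τ_m`. -/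
def stableSet (Δ : Set (RVec d)) (h : ZVec d → ℤ) : Set (RVec d × RVec d) :=
  ⋃ m ∈ {m : ZVec d | latt m ∈ frontier Δ}, closedStar Δ (latt m) ×ˢ dualFace Δ h m

/-- `(Δ, h, ν)` is stable: some optimal transport plan from `μ_M` to `ν` is supported on the (closed)
set `stableSet Δ h`. -/
def IsStable (Δ : Set (RVec d)) (h : ZVec d → ℤ) (ν : Measure (RVec d)) : Prop :=
  ∃ γ, IsOptimalPlan (boundaryMeasure Δ) ν γ ∧ γ (stableSet Δ h)ᶜ = 0

end TropicalMA

end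

open TropicalMA

open TropicalMA

namespace TropicalMA

open Filter Topology Set Module
open scoped ENNReal

/-! ### The dot product as pairing -/

section Dot

variable {k : ℕ}

/-! Write P for the polytope `heightDual Δ h`. The Monge–Ampère equation is turned into a transport
statement through the contact set: the pairs (a, x) of the stable set for which a is a subgradient
of Ψ restricted to P at x.

Let τ be the facet of P dual to m, and take a subgradient along τ at a point x of its relative
interior. By convexity it extends to a subgradient of Ψ on all of N_ℝ (`exists_mul_le_of_convex`),
which lies in Δ because Ψ has the growth of the support function. Adding a nonnegative multiple of m
moves it into the star of m (`ReflexiveData.exists_lift`). This preserves the subgradient inequality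
on P, since m is maximal on P along τ. Reflexivity makes the projection along m injective on the
star and turns μ_M into Lebesgue measure (`ReflexiveData.volume_image`). Hence the Monge–Ampère mass
of E is the μ_M-mass of the points in contact with E (`solvesMA_iff`).

Almost every a has at most one contact point (`ae_contact_unique`): Rademacher's theorem for the
Legendre transform on a facet of Δ determines x up to its normal n, and membership in the stable set
fixes the remaining coordinate. So a solution yields a plan on its contact set, which is optimal
because the Legendre gap vanishes there. Conversely, the support of an optimal plan is cyclically
monotone, so Rockafellar's construction followed by a Legendre transform over ∂Δ gives a potential
whose subdifferential carries the plan. If the plan also lives on the stable set, it lives on the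
contact set, and the potential solves the equation (`solvesMA_of_plan`).

For uniqueness, the plan of one solution is tight for the other as well. Since μ_M has full support,
the two Legendre transforms share a subgradient at every point of ∂Δ. Their difference is therefore
constant on faces, and on ∂Δ by connectedness. Every point of ∂P has a contact point in ∂Δ for each
potential, which transfers the conclusion to Ψ - Ψ'. -/

lemma continuous_dot_left (c : Fin k → ℝ) : Continuous fun x : Fin k → ℝ => c ⬝ᵥ x := by
  unfold dotProduct; fun_prop

lemma continuous_dot_right (c : Fin k → ℝ) : Continuous fun x : Fin k → ℝ => x ⬝ᵥ c := by
  unfold dotProduct; fun_prop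

lemma continuous_dot : Continuous fun p : (Fin k → ℝ) × (Fin k → ℝ) => p.1 ⬝ᵥ p.2 := by
  unfold dotProduct; fun_prop

/-- The linear form given by the dot product with `c`. -/
def dotLin (c : Fin k → ℝ) : (Fin k → ℝ) →ₗ[ℝ] ℝ := dotProductBilin ℝ ℝ c

@[simp] lemma dotLin_apply (c x : Fin k → ℝ) : dotLin c x = c ⬝ᵥ x := rfl

lemma exists_eq_dot (l : StrongDual ℝ (Fin k → ℝ)) : ∃ c : Fin k → ℝ, ∀ x, l x = c ⬝ᵥ x := by
  refine ⟨fun i => l (Pi.single i 1), fun x => ?_⟩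
  have := LinearMap.pi_apply_eq_sum_univ l.toLinearMap x
  simp only [ContinuousLinearMap.coe_coe] at this
  rw [this]
  simp only [dotProduct, smul_eq_mul]
  refine Finset.sum_congr rfl fun i _ => ?_
  rw [mul_comm]
  congr 2
  ext j
  simp [Pi.single_apply, eq_comm]

lemma dot_self_pos {c : Fin k → ℝ} (hc : c ≠ 0) : 0 < c ⬝ᵥ c := by
  simpa using Matrix.dotProduct_star_self_pos_iff.2 hc

lemma finrank_ker_dotLin {c : RVec d} (hc : c ≠ 0) :
    finrank ℝ (LinearMap.ker (dotLin c)) = d := by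
  have h1 := LinearMap.finrank_range_add_finrank_ker (dotLin c)
  have h2 : LinearMap.range (dotLin c) = ⊤ := by
    rw [LinearMap.range_eq_top]
    apply LinearMap.surjective
    intro h
    have := dot_self_pos hc
    rw [← dotLin_apply, h] at this
    simp at this
  rw [h2] at h1
  simp at h1
  omega

lemma exists_smul_of_ker_eq {a c : RVec d} (hc : c ≠ 0)
    (h : ∀ v, c ⬝ᵥ v = 0 → a ⬝ᵥ v = 0) : ∃ t : ℝ, a = t • c := by
  have hcc := dot_self_pos hc
  -- The coefficient of the orthogonal projection: the remainder is killed by `c`, hence by `a`,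
  -- hence is orthogonal to itself.
  refine ⟨(a ⬝ᵥ c) / (c ⬝ᵥ c), ?_⟩
  have h1 : c ⬝ᵥ (a - ((a ⬝ᵥ c) / (c ⬝ᵥ c)) • c) = 0 := by
    rw [dotProduct_sub, dotProduct_smul, dotProduct_comm c a, smul_eq_mul]
    field_simp; ring
  have h2 := h _ h1
  have h3 : (a - ((a ⬝ᵥ c) / (c ⬝ᵥ c)) • c) ⬝ᵥ (a - ((a ⬝ᵥ c) / (c ⬝ᵥ c)) • c) = 0 := by
    rw [sub_dotProduct, h2, smul_dotProduct, h1]; simp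
  rw [dotProduct_self_eq_zero] at h3
  exact sub_eq_zero.1 h3

end Dot

variable {d : ℕ}

/-! ### Relative interiors and affine spans -/

section Interior

lemma isClosed_affineSpan (F : Set (RVec d)) : IsClosed (affineSpan ℝ F : Set (RVec d)) :=
  AffineSubspace.closed_of_finiteDimensional _

lemma measurableSet_intrinsicInterior (F : Set (RVec d)) :
    MeasurableSet (intrinsicInterior ℝ F) := by
  have h := intrinsicClosure_sdiff_intrinsicFrontier (𝕜 := ℝ) F
  rw [← h]
  exact ((isClosed_intrinsicClosure (isClosed_affineSpan F)).measurableSet).diff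
    (isClosed_intrinsicFrontier (isClosed_affineSpan F)).measurableSet

lemma isOpen_preimage_intrinsicInterior {X : Type*} [TopologicalSpace X] {F : Set (RVec d)}
    {f : X → RVec d} (hf : Continuous f) (hfF : ∀ x, f x ∈ affineSpan ℝ F) :
    IsOpen (f ⁻¹' intrinsicInterior ℝ F) := by
  let g : X → affineSpan ℝ F := fun x => ⟨f x, hfF x⟩
  have hg : Continuous g := by fun_prop
  have : f ⁻¹' intrinsicInterior ℝ F = g ⁻¹' interior ((↑) ⁻¹' F : Set (affineSpan ℝ F)) := by
    ext x
    simp only [mem_preimage, mem_intrinsicInterior]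
    constructor
    · rintro ⟨y, hy, hyx⟩
      have : g x = y := Subtype.ext hyx.symm
      rwa [this]
    · intro h
      exact ⟨g x, h, rfl⟩
  rw [this]
  exact isOpen_interior.preimage hg

lemma add_smul_mem_affineSpan {F : Set (RVec d)} {x v : RVec d} (hx : x ∈ affineSpan ℝ F)
    (hv : v ∈ vectorSpan ℝ F) (s : ℝ) : x + s • v ∈ affineSpan ℝ F := by
  have := AffineSubspace.vadd_mem_of_mem_direction (v := s • v)
    (by rw [direction_affineSpan]; exact Submodule.smul_mem _ _ hv) hx
  rwa [vadd_eq_add, add_comm (s • v) x] at this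

lemma exists_add_smul_mem_intrinsicInterior {F : Set (RVec d)} {x v : RVec d}
    (hx : x ∈ intrinsicInterior ℝ F) (hv : v ∈ vectorSpan ℝ F) :
    ∃ ε : ℝ, 0 < ε ∧ ∀ s : ℝ, |s| < ε → x + s • v ∈ intrinsicInterior ℝ F := by
  have hxF : x ∈ affineSpan ℝ F := subset_affineSpan ℝ F (intrinsicInterior_subset hx)
  have ho : IsOpen ((fun s : ℝ => x + s • v) ⁻¹' intrinsicInterior ℝ F) :=
    isOpen_preimage_intrinsicInterior (by fun_prop) (fun s => add_smul_mem_affineSpan hxF hv s)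
  rw [Metric.isOpen_iff] at ho
  obtain ⟨ε, hε, h⟩ := ho 0 (by simpa using hx)
  exact ⟨ε, hε, fun s hs => h (by simpa using hs)⟩

lemma affineSpan_eq_of_vectorSpan {F : Set (RVec d)} {c : RVec d} {r : ℝ} (hne : F.Nonempty)
    (hF : ∀ x ∈ F, c ⬝ᵥ x = r) (hV : ∀ v, v ∈ vectorSpan ℝ F ↔ c ⬝ᵥ v = 0) (x : RVec d) :
    x ∈ affineSpan ℝ F ↔ c ⬝ᵥ x = r := by
  obtain ⟨y, hy⟩ := hne
  have := AffineSubspace.vsub_right_mem_direction_iff_mem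
    (s := affineSpan ℝ F) (subset_affineSpan ℝ F hy) x
  rw [← this, direction_affineSpan, hV, vsub_eq_sub, dotProduct_sub, hF y hy, sub_eq_zero]

end Interior

/-! ### Polyhedra with the origin inside: faces, facets, boundary -/

/-- The polyhedron defined by the inequalities `c ⬝ᵥ x ≤ 1`. -/
def hpoly (C : Finset (RVec d)) : Set (RVec d) := {x | ∀ c ∈ C, c ⬝ᵥ x ≤ 1}

/-- The face of `hpoly C` on which the inequality given by `c` is an equality. -/
def hface (C : Finset (RVec d)) (c : RVec d) : Set (RVec d) := {x ∈ hpoly C | c ⬝ᵥ x = 1}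

section HPoly

variable {C : Finset (RVec d)}

lemma isClosed_hpoly : IsClosed (hpoly C) := by
  have : hpoly C = ⋂ c ∈ C, {x | c ⬝ᵥ x ≤ 1} := by ext; simp [hpoly]
  rw [this]
  exact isClosed_biInter fun c _ => isClosed_le (continuous_dot_left c) continuous_const

lemma convex_hpoly : Convex ℝ (hpoly C) := by
  intro x hx y hy a b ha hb hab c hc
  rw [dotProduct_add, dotProduct_smul, dotProduct_smul, smul_eq_mul, smul_eq_mul]
  nlinarith [hx c hc, hy c hc]

lemma zero_mem_hpoly : (0 : RVec d) ∈ hpoly C := fun c _ => by simp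

lemma convex_hface (c : RVec d) : Convex ℝ (hface C c) := by
  intro x hx y hy a b ha hb hab
  refine ⟨convex_hpoly hx.1 hy.1 ha hb hab, ?_⟩
  rw [dotProduct_add, dotProduct_smul, dotProduct_smul, hx.2, hy.2]
  simpa using hab

lemma isOpen_strict (C : Finset (RVec d)) : IsOpen {x : RVec d | ∀ c ∈ C, c ⬝ᵥ x < 1} := by
  have : {x : RVec d | ∀ c ∈ C, c ⬝ᵥ x < 1} = ⋂ c ∈ C, {x | c ⬝ᵥ x < 1} := by ext; simp
  rw [this]
  exact isOpen_biInter_finset fun c _ => isOpen_lt (continuous_dot_left c) continuous_const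

lemma mem_interior_hpoly {x : RVec d} (h : ∀ c ∈ C, c ⬝ᵥ x < 1) : x ∈ interior (hpoly C) :=
  mem_interior.2 ⟨_, fun _ hy c hc => (hy c hc).le, isOpen_strict C, h⟩

lemma exists_active_of_notMem_interior {x : RVec d} (hx : x ∈ hpoly C)
    (h : x ∉ interior (hpoly C)) : ∃ c ∈ C, c ⬝ᵥ x = 1 := by
  by_contra! H
  exact h (mem_interior_hpoly fun c hc => lt_of_le_of_ne (hx c hc) (H c hc))

lemma mem_frontier_hpoly {x : RVec d} :
    x ∈ frontier (hpoly C) ↔ x ∈ hpoly C ∧ ∃ c ∈ C, c ⬝ᵥ x = 1 := by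
  rw [isClosed_hpoly.frontier_eq]
  constructor
  · rintro ⟨hx, h⟩
    exact ⟨hx, exists_active_of_notMem_interior hx h⟩
  · rintro ⟨hx, c, hc, h⟩
    refine ⟨hx, fun hi => ?_⟩
    -- Moving radially outward from `x` violates the active inequality at once.
    have ho : IsOpen ((fun s : ℝ => x + s • x) ⁻¹' interior (hpoly C)) :=
      isOpen_interior.preimage (by fun_prop)
    rw [Metric.isOpen_iff] at ho
    obtain ⟨ε, hε, hb⟩ := ho 0 (by simpa using hi)
    have h2 : ε / 2 ∈ Metric.ball (0 : ℝ) ε := by simp [abs_of_pos hε, hε]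
    have h3 := interior_subset (hb h2) c hc
    rw [dotProduct_add, dotProduct_smul, h, smul_eq_mul] at h3
    linarith

/-- A linear form which is maximal on a set at a point of the interior vanishes. -/
lemma eq_zero_of_max_interior {P : Set (RVec d)} {a x : RVec d} (hx : x ∈ interior P)
    (h : ∀ y ∈ P, a ⬝ᵥ y ≤ a ⬝ᵥ x) : a = 0 := by
  have ho : IsOpen ((fun s : ℝ => x + s • a) ⁻¹' interior P) :=
    isOpen_interior.preimage (by fun_prop)
  rw [Metric.isOpen_iff] at ho
  obtain ⟨ε, hε, hb⟩ := ho 0 (by simpa using hx)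
  have h2 : ε / 2 ∈ Metric.ball (0 : ℝ) ε := by simp [abs_of_pos hε, hε]
  have h3 := h _ (interior_subset (hb h2))
  rw [dotProduct_add, dotProduct_smul, smul_eq_mul] at h3
  by_contra hne
  have := dot_self_pos hne
  nlinarith

lemma zero_mem_interior_hpoly : (0 : RVec d) ∈ interior (hpoly C) :=
  mem_interior_hpoly fun c _ => by simp

lemma vectorSpan_eq_top_of_interior {P : Set (RVec d)} (h : (interior P).Nonempty) :
    vectorSpan ℝ P = ⊤ := by
  have h1 : affineSpan ℝ (interior P) = ⊤ := isOpen_interior.affineSpan_eq_top h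
  have h2 : affineSpan ℝ P = ⊤ := top_le_iff.1 (h1 ▸ affineSpan_mono ℝ interior_subset)
  rw [← direction_affineSpan, h2]
  simp

/-- An exposed face of a set, in terms of the dot product. -/
lemma exposed_eq {P F : Set (RVec d)} (hne : F.Nonempty) (hF : IsExposed ℝ P F) :
    ∃ a : RVec d, F = {x ∈ P | ∀ y ∈ P, a ⬝ᵥ y ≤ a ⬝ᵥ x} := by
  obtain ⟨l, hl⟩ := hF hne
  obtain ⟨a, ha⟩ := exists_eq_dot l
  exact ⟨a, by simpa [ha] using hl⟩

lemma isExposed_hface {c : RVec d} (hc : c ∈ C) : IsExposed ℝ (hpoly C) (hface C c) := by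
  rintro ⟨x, hx⟩
  refine ⟨LinearMap.toContinuousLinearMap (dotLin c), ?_⟩
  ext y
  simp only [hface, mem_ofPred_eq, LinearMap.coe_toContinuousLinearMap', dotLin_apply]
  constructor
  · rintro ⟨hy, h⟩
    exact ⟨hy, fun z hz => h ▸ hz c hc⟩
  · rintro ⟨hy, h⟩
    exact ⟨hy, le_antisymm (hy c hc) (hx.2 ▸ h x hx.1)⟩

/-- Any two points of a proper face lie on a common face given by an inequality. -/
lemma exists_active_of_properFace {F : Set (RVec d)} (hF : IsProperFace (hpoly C) F) {x y : RVec d}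
    (hx : x ∈ F) (hy : y ∈ F) : ∃ c ∈ C, c ⬝ᵥ x = 1 ∧ c ⬝ᵥ y = 1 := by
  obtain ⟨a, ha⟩ := exposed_eq hF.nonempty hF.exposed
  have hx' := hx
  have hy' := hy
  rw [ha] at hx' hy'
  -- An inequality active at the midpoint is active at both endpoints.
  set z : RVec d := (1 / 2 : ℝ) • x + (1 / 2 : ℝ) • y with hz
  have hzP : z ∈ hpoly C := convex_hpoly hx'.1 hy'.1 (by norm_num) (by norm_num) (by norm_num)
  have hzi : z ∉ interior (hpoly C) := by
    intro hi
    have : a = 0 := by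
      refine eq_zero_of_max_interior hi fun w hw => ?_
      rw [hz, dotProduct_add, dotProduct_smul, dotProduct_smul, smul_eq_mul, smul_eq_mul]
      linarith [hx'.2 w hw, hy'.2 w hw]
    apply hF.ne
    rw [ha, this]
    ext; simp
  obtain ⟨c, hc, h⟩ := exists_active_of_notMem_interior hzP hzi
  refine ⟨c, hc, ?_⟩
  rw [hz, dotProduct_add, dotProduct_smul, dotProduct_smul, smul_eq_mul, smul_eq_mul] at h
  constructor <;> linarith [hx'.1 c hc, hy'.1 c hc]

lemma isProperFace_hface {c : RVec d} (hc : c ∈ C) (hne : (hface C c).Nonempty) :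
    IsProperFace (hpoly C) (hface C c) := by
  refine ⟨hne, isExposed_hface hc, fun h => ?_⟩
  have : (0 : RVec d) ∈ hface C c := h ▸ zero_mem_hpoly
  simpa using this.2

lemma exists_active_of_facet {F : Set (RVec d)} (hF : IsFacet (hpoly C) F) {x : RVec d}
    (hx : x ∈ F) : ∃ c ∈ C, c ⬝ᵥ x = 1 := by
  have hP : IsProperFace (hpoly C) F := by
    refine ⟨hF.nonempty, hF.exposed, fun h => ?_⟩
    have h1 := hF.finrank_eq
    rw [h, vectorSpan_eq_top_of_interior ⟨0, zero_mem_interior_hpoly⟩] at h1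
    simp at h1
  obtain ⟨c, hc, h, -⟩ := exists_active_of_properFace hP hx hx
  exact ⟨c, hc, h⟩

lemma ne_zero_of_dot {c x : RVec d} (h : c ⬝ᵥ x = 1) : c ≠ 0 := by
  rintro rfl; simp at h

lemma IsFacet.subset {P F : Set (RVec d)} (hF : IsFacet P F) : F ⊆ P := hF.exposed.subset

/-- An inequality which is active at a point of the relative interior of a facet defines the
facet. -/
lemma facet_eq_of_active {F : Set (RVec d)} (hF : IsFacet (hpoly C) F) {x c : RVec d}
    (hx : x ∈ intrinsicInterior ℝ F) (hc : c ∈ C) (hcx : c ⬝ᵥ x = 1) :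
    F = hface C c ∧ ∀ v, v ∈ vectorSpan ℝ F ↔ c ⬝ᵥ v = 0 := by
  have hc0 := ne_zero_of_dot hcx
  have hV : vectorSpan ℝ F = LinearMap.ker (dotLin c) := by
    apply Submodule.eq_of_le_of_finrank_eq
    · intro v hv
      obtain ⟨ε, hε, h⟩ := exists_add_smul_mem_intrinsicInterior hx hv
      have h1 := hF.subset (intrinsicInterior_subset (h (ε / 2) (by rw [abs_of_pos] <;> linarith))) c hc
      have h2 := hF.subset (intrinsicInterior_subset (h (-(ε / 2))
        (by rw [abs_neg, abs_of_pos] <;> linarith))) c hc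
      rw [dotProduct_add, dotProduct_smul, smul_eq_mul, hcx] at h1 h2
      simp only [LinearMap.mem_ker, dotLin_apply]
      nlinarith
    · rw [hF.finrank_eq, finrank_ker_dotLin hc0]
  have hV' : ∀ v, v ∈ vectorSpan ℝ F ↔ c ⬝ᵥ v = 0 := by intro v; rw [hV]; simp
  refine ⟨?_, hV'⟩
  obtain ⟨a, ha⟩ := exposed_eq hF.nonempty hF.exposed
  have hxF := intrinsicInterior_subset hx
  have hcF : ∀ y ∈ F, c ⬝ᵥ y = 1 := by
    intro y hy
    have := (hV' (y - x)).1 (vsub_mem_vectorSpan ℝ hy hxF)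
    rw [dotProduct_sub, sub_eq_zero] at this
    rw [this, hcx]
  apply Subset.antisymm
  · exact fun y hy => ⟨hF.subset hy, hcF y hy⟩
  · intro y hy
    -- The functional `a` exposing `F` is constant on `F`, so it vanishes on the tangent space and
    -- is a multiple of `c`. Points with the same value of `c` are then equally maximal for `a`.
    obtain ⟨t, ht⟩ := exists_smul_of_ker_eq (a := a) hc0 (by
      intro v hv
      have hv' := (hV' v).2 hv
      rw [vectorSpan_def] at hv'
      induction hv' using Submodule.span_induction with
      | mem w hw =>
        obtain ⟨p, hp, q, hq, rfl⟩ := hw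
        rw [ha] at hp hq
        simp only [vsub_eq_sub, dotProduct_sub]
        linarith [hp.2 q hq.1, hq.2 p hp.1]
      | zero => simp
      | add p q _ _ hp hq =>
        by_cases h : c ⬝ᵥ p = 0
        · rw [dotProduct_add, h, zero_add] at hv
          rw [dotProduct_add, hp h, hq hv, zero_add]
        · exfalso
          apply h
          apply (hV' p).1
          rw [vectorSpan_def]; assumption
      | smul r p _ hp =>
        by_cases h : r = 0
        · simp [h]
        · rw [dotProduct_smul, smul_eq_mul, mul_eq_zero] at hv
          rw [dotProduct_smul, hp (hv.resolve_left h), smul_zero])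
    have hxF' := hxF
    rw [ha] at hxF' ⊢
    refine ⟨hy.1, fun z hz => ?_⟩
    have := hxF'.2 z hz
    rw [ht, smul_dotProduct, smul_dotProduct] at this ⊢
    rwa [hy.2, ← hcx]

lemma facet_convex {F : Set (RVec d)} (hF : IsFacet (hpoly C) F) : Convex ℝ F :=
  hF.exposed.convex convex_hpoly

lemma facet_interior_nonempty {F : Set (RVec d)} (hF : IsFacet (hpoly C) F) :
    (intrinsicInterior ℝ F).Nonempty := hF.nonempty.intrinsicInterior (facet_convex hF)

lemma exists_facet_eq {F : Set (RVec d)} (hF : IsFacet (hpoly C) F) :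
    ∃ c ∈ C, F = hface C c ∧ ∀ v, v ∈ vectorSpan ℝ F ↔ c ⬝ᵥ v = 0 := by
  obtain ⟨x, hx⟩ := facet_interior_nonempty hF
  obtain ⟨c, hc, h⟩ := exists_active_of_facet hF (intrinsicInterior_subset hx)
  exact ⟨c, hc, facet_eq_of_active hF hx hc h⟩

/-- The inequality defining a facet is unique. -/
lemma eq_of_ker_eq {c c' x : RVec d} (hx : c ⬝ᵥ x = 1) (hx' : c' ⬝ᵥ x = 1)
    (h : ∀ v, c ⬝ᵥ v = 0 → c' ⬝ᵥ v = 0) : c' = c := by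
  obtain ⟨t, rfl⟩ := exists_smul_of_ker_eq (ne_zero_of_dot hx) h
  rw [smul_dotProduct, hx] at hx'
  simp at hx'
  simp [hx']

/-- Both forms have the tangent space of the facet as kernel and take the value 1 at `x`. -/
lemma facet_active_unique {F : Set (RVec d)} (hF : IsFacet (hpoly C) F) {x c c' : RVec d}
    (hx : x ∈ intrinsicInterior ℝ F) (hc : c ∈ C) (hcx : c ⬝ᵥ x = 1)
    (hc' : c' ∈ C) (hcx' : c' ⬝ᵥ x = 1) : c' = c :=
  eq_of_ker_eq hcx hcx' fun v hv => by
    rw [← (facet_eq_of_active hF hx hc' hcx').2, (facet_eq_of_active hF hx hc hcx).2, hv]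

lemma finite_facets : {F : Set (RVec d) | IsFacet (hpoly C) F}.Finite := by
  refine (C.finite_toSet.image (hface C)).subset ?_
  intro F hF
  obtain ⟨c, hc, h, -⟩ := exists_facet_eq hF
  exact ⟨c, hc, h.symm⟩

lemma openFacets_disjoint {F F' : Set (RVec d)} (hF : IsFacet (hpoly C) F)
    (hF' : IsFacet (hpoly C) F') {x : RVec d} (hx : x ∈ intrinsicInterior ℝ F)
    (hx' : x ∈ intrinsicInterior ℝ F') : F = F' := by
  obtain ⟨c, hc, h⟩ := exists_active_of_facet hF (intrinsicInterior_subset hx)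
  rw [(facet_eq_of_active hF hx hc h).1, (facet_eq_of_active hF' hx' hc h).1]

/-- A point at which exactly one inequality is active lies in the relative interior of a facet. -/
lemma mem_openFacets_of_unique_active {x c : RVec d} (hx : x ∈ hpoly C) (hc : c ∈ C)
    (hcx : c ⬝ᵥ x = 1) (h : ∀ c' ∈ C, c' ⬝ᵥ x = 1 → c' = c) : x ∈ openFacets (hpoly C) := by
  classical
  have hxF : x ∈ hface C c := ⟨hx, hcx⟩
  -- On this neighbourhood of `x` the other inequalities stay strict, so there the face fills the
  -- whole hyperplane of `c`.
  set U : Set (RVec d) := {y | ∀ c' ∈ C.erase c, c' ⬝ᵥ y < 1} with hU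
  have hUo : IsOpen U := isOpen_strict _
  have hxU : x ∈ U := fun c' hc' => lt_of_le_of_ne (hx c' (Finset.mem_of_mem_erase hc'))
    fun h1 => (Finset.ne_of_mem_erase hc') (h c' (Finset.mem_of_mem_erase hc') h1)
  have hUF : ∀ y ∈ U, c ⬝ᵥ y = 1 → y ∈ hface C c := by
    intro y hy hcy
    refine ⟨fun c' hc' => ?_, hcy⟩
    by_cases h : c' = c
    · rw [h, hcy]
    · exact (hy c' (Finset.mem_erase.2 ⟨h, hc'⟩)).le
  have hV : ∀ v, v ∈ vectorSpan ℝ (hface C c) ↔ c ⬝ᵥ v = 0 := by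
    intro v
    constructor
    · intro hv
      have : vectorSpan ℝ (hface C c) ≤ LinearMap.ker (dotLin c) := by
        rw [vectorSpan_def, Submodule.span_le]
        rintro _ ⟨p, hp, q, hq, rfl⟩
        simp [dotProduct_sub, hp.2, hq.2]
      simpa using this hv
    · intro hv
      have ho : IsOpen ((fun s : ℝ => x + s • v) ⁻¹' U) := hUo.preimage (by fun_prop)
      rw [Metric.isOpen_iff] at ho
      obtain ⟨ε, hε, hb⟩ := ho 0 (by simpa using hxU)
      have h2 : ε / 2 ∈ Metric.ball (0 : ℝ) ε := by simp [abs_of_pos hε, hε]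
      have h3 : x + (ε / 2) • v ∈ hface C c :=
        hUF _ (hb h2) (by rw [dotProduct_add, dotProduct_smul, hv, hcx]; simp)
      have h4 := vsub_mem_vectorSpan ℝ h3 hxF
      rw [vsub_eq_sub, add_sub_cancel_left] at h4
      exact (Submodule.smul_mem_iff _ (by positivity)).1 h4
  have hfac : IsFacet (hpoly C) (hface C c) := by
    refine ⟨⟨x, hxF⟩, isExposed_hface hc, ?_⟩
    have : vectorSpan ℝ (hface C c) = LinearMap.ker (dotLin c) := by ext v; rw [hV]; simp
    rw [this, finrank_ker_dotLin (ne_zero_of_dot hcx)]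
  refine mem_biUnion (x := hface C c) hfac ?_
  rw [mem_intrinsicInterior]
  refine ⟨⟨x, subset_affineSpan ℝ _ hxF⟩, ?_, rfl⟩
  rw [mem_interior]
  refine ⟨Subtype.val ⁻¹' U, ?_, hUo.preimage continuous_subtype_val,
    show Subtype.val _ ∈ U from hxU⟩
  intro y hy
  exact hUF _ hy ((affineSpan_eq_of_vectorSpan ⟨x, hxF⟩ (fun _ h => h.2) hV _).1 y.2)

/-- The open facets are dense in the boundary. -/
lemma frontier_subset_closure_openFacets :
    frontier (hpoly C) ⊆ closure (openFacets (hpoly C)) := by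
  classical
  intro x hx
  obtain ⟨hxP, c₀, hc₀, hcx₀⟩ := mem_frontier_hpoly.1 hx
  have hne : C.Nonempty := ⟨c₀, hc₀⟩
  -- Where `M` is positive, `y ↦ (M y)⁻¹ • y` is the radial projection to the boundary; it fixes
  -- `x`.
  set M : RVec d → ℝ := fun y => C.sup' hne (fun c => c ⬝ᵥ y) with hM
  have hMc : Continuous M :=
    Continuous.finset_sup'_apply hne (fun c _ => continuous_dot_left c)
  have hMle : ∀ y, ∀ c ∈ C, c ⬝ᵥ y ≤ M y := fun y c hc => Finset.le_sup' (fun c => c ⬝ᵥ y) hc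
  have hMx : M x = 1 := le_antisymm (Finset.sup'_le _ _ fun c hc => hxP c hc) (hcx₀ ▸ hMle x c₀ hc₀)
  -- The points at which two forms tie. They form a null set, so `x` can be approximated off it, and
  -- the radial projection of such an approximation has exactly one active inequality.
  set Z : Set (RVec d) := ⋃ p ∈ C.offDiag, {y | (p.1 - p.2) ⬝ᵥ y = 0} with hZ
  have hZ0 : volume Z = 0 := by
    rw [hZ]
    refine (measure_biUnion_null_iff C.offDiag.countable_toSet).2 ?_
    rintro ⟨p, q⟩ hpq
    have hpq' : p - q ≠ 0 := sub_ne_zero.2 (Finset.mem_offDiag.1 hpq).2.2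
    have : {y : RVec d | (p - q) ⬝ᵥ y = 0} = (LinearMap.ker (dotLin (p - q)) : Set (RVec d)) := by
      ext; simp
    simp only
    rw [this]
    apply Measure.addHaar_submodule
    intro htop
    have h1 : p - q ∈ LinearMap.ker (dotLin (p - q)) := by rw [htop]; trivial
    have := dot_self_pos hpq'
    simp only [LinearMap.mem_ker, dotLin_apply] at h1
    linarith
  have hd : Dense Zᶜ := by
    rw [← interior_eq_empty_iff_dense_compl]
    by_contra hne
    have := isOpen_interior.measure_pos volume (nonempty_iff_ne_empty.2 hne)
    have h2 : volume (interior Z) ≤ volume Z := measure_mono interior_subset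
    rw [hZ0] at h2
    exact absurd h2 (not_le.2 this)
  have hcont : ContinuousAt (fun y => (M y)⁻¹ • y) x :=
    (hMc.continuousAt.inv₀ (by rw [hMx]; norm_num)).smul continuousAt_id
  rw [mem_closure_iff_nhds]
  intro t ht
  have h1 : ∀ᶠ y in 𝓝 x, (M y)⁻¹ • y ∈ t := hcont (by simpa [hMx] using ht)
  have h2 : ∀ᶠ y in 𝓝 x, 0 < M y := hMc.continuousAt.eventually (lt_mem_nhds (by rw [hMx]; norm_num))
  obtain ⟨y, ⟨hy1, hy2⟩, hyZ⟩ := mem_closure_iff_nhds.1 (hd x) _ (h1.and h2)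
  refine ⟨(M y)⁻¹ • y, hy1, ?_⟩
  obtain ⟨c, hc, hcy⟩ := Finset.exists_mem_eq_sup' hne (fun c => c ⬝ᵥ y)
  have hcy' : c ⬝ᵥ y = M y := hcy.symm
  refine mem_openFacets_of_unique_active (c := c) ?_ hc ?_ ?_
  · intro c' hc'
    rw [dotProduct_smul, smul_eq_mul, inv_mul_le_iff₀ hy2, mul_one]
    exact hMle y c' hc'
  · rw [dotProduct_smul, smul_eq_mul, hcy', inv_mul_cancel₀ hy2.ne']
  · intro c' hc' h
    by_contra hne'
    apply hyZ
    rw [dotProduct_smul, smul_eq_mul, inv_mul_eq_one₀ hy2.ne'] at h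
    refine mem_biUnion (x := (c', c)) (Finset.mem_coe.2 (Finset.mem_offDiag.2 ⟨hc', hc, hne'⟩)) ?_
    simp [sub_dotProduct, hcy', ← h]

/-- Otherwise the whole ray through `x` would lie in the polyhedron. -/
lemma exists_pos_of_bounded (hb : Bornology.IsBounded (hpoly C)) {x : RVec d} (hx : x ≠ 0) :
    ∃ c ∈ C, 0 < c ⬝ᵥ x := by
  by_contra! H
  obtain ⟨R, hR⟩ := hb.exists_norm_le
  have hxn := norm_pos_iff.2 hx
  have h1 : ((|R| + 1) / ‖x‖) • x ∈ hpoly C := by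
    intro c hc
    rw [dotProduct_smul, smul_eq_mul]
    have : 0 ≤ (|R| + 1) / ‖x‖ := by positivity
    nlinarith [H c hc]
  have h2 := hR _ h1
  rw [norm_smul, Real.norm_of_nonneg (by positivity), div_mul_cancel₀ _ hxn.ne'] at h2
  linarith [le_abs_self R]

/-- The boundary of a bounded polyhedron of dimension at least two is connected. -/
lemma isPreconnected_frontier_hpoly (hd : 1 ≤ d) (hb : Bornology.IsBounded (hpoly C)) :
    IsPreconnected (frontier (hpoly C)) := by
  obtain rfl | hne := C.eq_empty_or_nonempty
  · have : frontier (hpoly (∅ : Finset (RVec d))) = ∅ := by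
      ext x; simp [mem_frontier_hpoly]
    rw [this]; exact isPreconnected_empty
  set M : RVec d → ℝ := fun y => C.sup' hne (fun c => c ⬝ᵥ y) with hM
  have hMc : Continuous M :=
    Continuous.finset_sup'_apply hne (fun c _ => continuous_dot_left c)
  have hMle : ∀ y, ∀ c ∈ C, c ⬝ᵥ y ≤ M y := fun y c hc => Finset.le_sup' (fun c => c ⬝ᵥ y) hc
  have hMpos : ∀ y, y ≠ 0 → 0 < M y := fun y hy => by
    obtain ⟨c, hc, h⟩ := exists_pos_of_bounded hb hy
    exact h.trans_le (hMle y c hc)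
  -- This is where the dimension `d + 1 ≥ 2` enters; the boundary is the image of this set under
  -- radial projection.
  have hconn : IsConnected ({0}ᶜ : Set (RVec d)) := by
    apply isConnected_compl_singleton_of_one_lt_rank
    rw [rank_fin_fun]
    exact_mod_cast Nat.lt_succ_of_le hd
  have himg : frontier (hpoly C) = (fun y => (M y)⁻¹ • y) '' {0}ᶜ := by
    ext x
    rw [mem_frontier_hpoly]
    constructor
    · rintro ⟨hx, c, hc, h⟩
      have hMx : M x = 1 := le_antisymm (Finset.sup'_le _ _ fun c hc => hx c hc) (h ▸ hMle x c hc)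
      refine ⟨x, ?_, by simp [hMx]⟩
      rintro rfl
      simp at h
    · rintro ⟨y, hy, rfl⟩
      have hy2 := hMpos y hy
      obtain ⟨c, hc, hcy⟩ := Finset.exists_mem_eq_sup' hne (fun c => c ⬝ᵥ y)
      have hcy' : c ⬝ᵥ y = M y := hcy.symm
      refine ⟨?_, c, hc, ?_⟩
      · intro c' hc'
        rw [dotProduct_smul, smul_eq_mul, inv_mul_le_iff₀ hy2, mul_one]
        exact hMle y c' hc'
      · rw [dotProduct_smul, smul_eq_mul, hcy', inv_mul_cancel₀ hy2.ne']
  rw [himg]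
  refine hconn.isPreconnected.image _ ?_
  exact (hMc.continuousOn.inv₀ fun y hy => (hMpos y hy).ne').smul continuousOn_id

end HPoly

/-! ### Integral bases of the orthogonal lattice of a vector -/

section Frames

lemma latt_dot (m n : ZVec d) : latt m ⬝ᵥ latt n = ((m ⬝ᵥ n : ℤ) : ℝ) := by
  simp [latt, dotProduct]

@[simp] lemma latt_zero : latt (0 : ZVec d) = 0 := by ext; simp [latt]

lemma latt_injective : Function.Injective (latt : ZVec d → RVec d) := by
  intro m n h
  ext i
  have := congrFun h i
  simpa [latt] using this

/-- `e` is a basis of the lattice of integral vectors orthogonal to `u` (stated as a spanning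
property). -/
def IsFrame (u : ZVec d) (e : Fin d → ZVec d) : Prop :=
  ∀ x : ZVec d, x ∈ Submodule.span ℤ (range e) ↔ u ⬝ᵥ x = 0

/-- The matrix with rows `v, e₁, …, e_d`. -/
def frameMatrix (v : ZVec d) (e : Fin d → ZVec d) : Matrix (Fin (d + 1)) (Fin (d + 1)) ℤ :=
  Matrix.of (Fin.cons v e)

@[simp] lemma frameMatrix_zero (v : ZVec d) (e : Fin d → ZVec d) : frameMatrix v e 0 = v := rfl

@[simp] lemma frameMatrix_succ (v : ZVec d) (e : Fin d → ZVec d) (i : Fin d) :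
    frameMatrix v e i.succ = e i := rfl

variable {u v : ZVec d} {e f : Fin d → ZVec d}

lemma IsFrame.dot (he : IsFrame u e) (i : Fin d) : u ⬝ᵥ e i = 0 :=
  (he _).1 (Submodule.subset_span ⟨i, rfl⟩)

lemma IsFrame.latt_dot (he : IsFrame u e) (i : Fin d) : latt u ⬝ᵥ latt (e i) = 0 := by
  rw [TropicalMA.latt_dot, he.dot]; simp

/-- Since `u ⬝ᵥ v = 1`, every lattice vector `x` is `(u ⬝ᵥ x) • v` plus an element of the orthogonal
lattice of `u`. The rows therefore span the lattice, which gives an integral left inverse. -/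
lemma IsFrame.isUnit_det (he : IsFrame u e) (huv : u ⬝ᵥ v = 1) :
    IsUnit (frameMatrix v e).det := by
  have hspan : ∀ x : ZVec d, ∃ w : Fin (d + 1) → ℤ, ∑ i, w i • (frameMatrix v e) i = x := by
    intro x
    have h1 : x - (u ⬝ᵥ x) • v ∈ Submodule.span ℤ (range e) := by
      rw [he, dotProduct_sub, dotProduct_smul, huv]; simp
    obtain ⟨w, hw⟩ := (Submodule.mem_span_range_iff_exists_fun ℤ).1 h1
    refine ⟨Fin.cons (u ⬝ᵥ x) w, ?_⟩
    rw [Fin.sum_univ_succ]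
    simp only [frameMatrix_zero, frameMatrix_succ, Fin.cons_zero, Fin.cons_succ]
    rw [hw]; abel
  choose w hw using hspan
  apply Matrix.isUnit_det_of_left_inverse (B := Matrix.of fun i => w (Pi.single i 1))
  ext i j
  have := congrFun (hw (Pi.single i 1)) j
  rw [Matrix.mul_apply]
  simp only [Finset.sum_apply, Pi.smul_apply, smul_eq_mul] at this
  simp only [Matrix.of_apply, this, Matrix.one_apply, Pi.single_apply, eq_comm]

/-- The product of the unimodular matrices with rows `u, f` and columns `v, e` has first row `(1, 0,
…, 0)`, and the complementary minor is the pairing matrix. -/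
lemma IsFrame.isUnit_det_pairing (he : IsFrame u e) (hf : IsFrame v f) (huv : u ⬝ᵥ v = 1) :
    IsUnit (Matrix.of fun i j => f i ⬝ᵥ e j).det := by
  have h1 := he.isUnit_det huv
  have h2 := hf.isUnit_det (v := u) (by rwa [dotProduct_comm])
  have h3 : (frameMatrix u f * (frameMatrix v e).transpose).det =
      (Matrix.of fun i j => f i ⬝ᵥ e j).det := by
    have hent : ∀ i j, (frameMatrix u f * (frameMatrix v e).transpose) i j =
      frameMatrix u f i ⬝ᵥ frameMatrix v e j := fun i j => rfl
    rw [Matrix.det_succ_row_zero, Fin.sum_univ_succ, Finset.sum_eq_zero]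
    · rw [hent]
      simp only [frameMatrix_zero, huv]
      simp only [Fin.val_zero, pow_zero, one_mul, add_zero]
      congr 1
    · intro j _
      rw [hent]
      simp only [frameMatrix_zero, frameMatrix_succ, he.dot]
      simp
  rw [← h3, Matrix.det_mul, Matrix.det_transpose]
  exact h2.mul h1

lemma IsFrame.real_det_ne_zero (he : IsFrame u e) (huv : u ⬝ᵥ v = 1) :
    ((frameMatrix v e).map (Int.cast : ℤ → ℝ)).det ≠ 0 := by
  have h := he.isUnit_det huv
  have : ((frameMatrix v e).map (Int.cast : ℤ → ℝ)).det = ((frameMatrix v e).det : ℝ) := by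
    rw [Int.cast_det]
  rw [this]
  exact_mod_cast h.ne_zero

lemma vecMul_frameMatrix (w : Fin (d + 1) → ℝ) :
    Matrix.vecMul w ((frameMatrix v e).map (Int.cast : ℤ → ℝ)) =
      w 0 • latt v + ∑ i : Fin d, w i.succ • latt (e i) := by
  ext j
  simp only [Matrix.vecMul, dotProduct, Fin.sum_univ_succ]
  simp [frameMatrix, latt]

lemma IsFrame.eq_zero_of_sum (he : IsFrame u e) (huv : u ⬝ᵥ v = 1) {y : Fin d → ℝ}
    (h : ∑ i, y i • latt (e i) = 0) : y = 0 := by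
  have := Matrix.eq_zero_of_vecMul_eq_zero (he.real_det_ne_zero huv) (v := Fin.cons 0 y)
    (by rw [vecMul_frameMatrix]; simpa using h)
  ext i
  simpa using congrFun this i.succ

lemma IsFrame.exists_sum (he : IsFrame u e) (huv : u ⬝ᵥ v = 1) {x : RVec d}
    (h : latt u ⬝ᵥ x = 0) : ∃ y : Fin d → ℝ, ∑ i, y i • latt (e i) = x := by
  set V := (frameMatrix v e).map (Int.cast : ℤ → ℝ) with hV
  have hdet : IsUnit V.det := isUnit_iff_ne_zero.2 (he.real_det_ne_zero huv)
  have h1 : Matrix.vecMul (Matrix.vecMul x V⁻¹) V = x := by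
    rw [Matrix.vecMul_vecMul, Matrix.nonsing_inv_mul _ hdet, Matrix.vecMul_one]
  set w := Matrix.vecMul x V⁻¹
  rw [hV, vecMul_frameMatrix] at h1
  have h2 : w 0 = 0 := by
    rw [← h1, dotProduct_add, dotProduct_smul, TropicalMA.latt_dot, huv, dotProduct_sum] at h
    simpa [dotProduct_smul, he.latt_dot] using h
  refine ⟨fun i => w i.succ, ?_⟩
  rw [h2, zero_smul, zero_add] at h1
  exact h1

/-- The difference of the two sides pairs to zero with `v` and with every `e i`, which span the
space. -/
lemma IsFrame.exists_smul_of_ortho (he : IsFrame u e) (huv : u ⬝ᵥ v = 1) {x : RVec d}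
    (h : ∀ i, x ⬝ᵥ latt (e i) = 0) : x = (x ⬝ᵥ latt v) • latt u := by
  have := Matrix.eq_zero_of_mulVec_eq_zero (he.real_det_ne_zero huv)
    (v := x - (x ⬝ᵥ latt v) • latt u) (by
      ext i
      have hent : (Matrix.mulVec ((frameMatrix v e).map (Int.cast : ℤ → ℝ))
          (x - (x ⬝ᵥ latt v) • latt u)) i =
          latt (frameMatrix v e i) ⬝ᵥ (x - (x ⬝ᵥ latt v) • latt u) := rfl
      rw [hent, dotProduct_comm]
      refine Fin.cases ?_ (fun j => ?_) i
      · simp only [frameMatrix_zero]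
        rw [sub_dotProduct, smul_dotProduct, TropicalMA.latt_dot, huv]; simp
      · simp only [frameMatrix_succ]
        rw [sub_dotProduct, smul_dotProduct, he.latt_dot, h]; simp)
  exact sub_eq_zero.1 this

/-- The kernel of the nonzero functional `u` is free of rank `d`; any basis of it is a frame. -/
lemma exists_isFrame {u : ZVec d} (hu : u ≠ 0) :
    ∃ e : Fin d → ZVec d, LinearIndependent ℤ e ∧ IsFrame u e := by
  let l : ZVec d →ₗ[ℤ] ℤ := dotProductBilin ℤ ℤ u
  have hl : ∀ x, l x = u ⬝ᵥ x := fun _ => rfl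
  have h1 := Submodule.finrank_quotient_add_finrank (LinearMap.ker l)
  rw [l.quotKerEquivRange.finrank_eq] at h1
  have h2 : finrank ℤ (LinearMap.range l) = 1 := by
    have hle : finrank ℤ (LinearMap.range l) ≤ 1 := by
      simpa using Submodule.finrank_le (LinearMap.range l)
    have hne : finrank ℤ (LinearMap.range l) ≠ 0 := by
      intro h0
      have : LinearMap.range l = ⊥ := Submodule.finrank_eq_zero.1 h0
      rw [LinearMap.range_eq_bot] at this
      have h3 : u ⬝ᵥ u = 0 := by rw [← hl, this]; rfl
      exact hu (dotProduct_self_eq_zero.1 h3)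
    omega
  have h3 : finrank ℤ (LinearMap.ker l) = d := by
    rw [h2] at h1
    simp at h1
    omega
  let b := Module.finBasisOfFinrankEq ℤ (LinearMap.ker l) h3
  refine ⟨fun i => b i, ?_, ?_⟩
  · exact b.linearIndependent.map' (LinearMap.ker l).subtype (Submodule.ker_subtype _)
  · intro x
    have : range (fun i => (b i : ZVec d)) = (LinearMap.ker l).subtype '' range b := by
      rw [← range_comp]; rfl
    rw [this, Submodule.span_image, b.span_eq, Submodule.map_top, Submodule.range_subtype,
      LinearMap.mem_ker, hl]

end Frames

/-! ### Integral charts of a facet and dual frames -/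

section Charts

variable {F : Set (RVec d)} {u v : ZVec d}

lemma nonempty_chart (hne : F.Nonempty) (huv : u ⬝ᵥ v = 1)
    (hV : ∀ x, x ∈ vectorSpan ℝ F ↔ latt u ⬝ᵥ x = 0) : Nonempty (IntegralChart F) := by
  have hu : u ≠ 0 := by rintro rfl; simp at huv
  obtain ⟨e, hli, he⟩ := exists_isFrame hu
  obtain ⟨x, hx⟩ := hne
  exact ⟨⟨x, subset_affineSpan ℝ F hx, e, hli, fun m => by
    rw [he, hV, latt_dot]; norm_cast⟩⟩

lemma IntegralChart.isFrame (β : IntegralChart F)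
    (hV : ∀ x, x ∈ vectorSpan ℝ F ↔ latt u ⬝ᵥ x = 0) : IsFrame u β.frame := by
  intro x
  rw [β.mem_span_iff, hV, latt_dot]; norm_cast

lemma IntegralChart.continuous_param (β : IntegralChart F) : Continuous β.param := by
  unfold IntegralChart.param; fun_prop

lemma IntegralChart.param_sub (β : IntegralChart F) (y z : Fin d → ℝ) :
    β.param y - β.param z = ∑ i, (y - z) i • latt (β.frame i) := by
  simp only [IntegralChart.param, Pi.sub_apply, sub_smul, Finset.sum_sub_distrib]
  abel

lemma IntegralChart.param_mem (β : IntegralChart F) (y : Fin d → ℝ) :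
    β.param y ∈ affineSpan ℝ F := by
  have h : ∑ i, y i • latt (β.frame i) ∈ vectorSpan ℝ F :=
    Submodule.sum_mem _ fun i _ => Submodule.smul_mem _ _
      ((β.mem_span_iff _).1 (Submodule.subset_span ⟨i, rfl⟩))
  simpa [IntegralChart.param] using add_smul_mem_affineSpan β.base_mem h 1

lemma IntegralChart.param_injective (β : IntegralChart F) (huv : u ⬝ᵥ v = 1)
    (hV : ∀ x, x ∈ vectorSpan ℝ F ↔ latt u ⬝ᵥ x = 0) : Function.Injective β.param := by
  intro y z h
  have h1 := β.param_sub y z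
  rw [h, sub_self] at h1
  exact sub_eq_zero.1 ((β.isFrame hV).eq_zero_of_sum huv h1.symm)

lemma IntegralChart.exists_param_eq (β : IntegralChart F) (huv : u ⬝ᵥ v = 1)
    (hV : ∀ x, x ∈ vectorSpan ℝ F ↔ latt u ⬝ᵥ x = 0) {x : RVec d} (hx : x ∈ affineSpan ℝ F) :
    ∃ y, β.param y = x := by
  have h1 : x - β.base ∈ vectorSpan ℝ F := by
    rw [← direction_affineSpan]
    exact AffineSubspace.vsub_mem_direction hx β.base_mem
  obtain ⟨y, hy⟩ := (β.isFrame hV).exists_sum huv ((hV _).1 h1)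
  exact ⟨y, by rw [IntegralChart.param, hy]; abel⟩

lemma IntegralChart.measurableEmbedding (β : IntegralChart F) (huv : u ⬝ᵥ v = 1)
    (hV : ∀ x, x ∈ vectorSpan ℝ F ↔ latt u ⬝ᵥ x = 0) : MeasurableEmbedding β.param :=
  β.continuous_param.measurableEmbedding (β.param_injective huv hV)

/-- The coordinates of `x` obtained by pairing with a frame. -/
def frameCoord (e : Fin d → ZVec d) (x : RVec d) : Fin d → ℝ := fun i => x ⬝ᵥ latt (e i)

lemma continuous_frameCoord (e : Fin d → ZVec d) : Continuous (frameCoord e) :=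
  continuous_pi fun _ => continuous_dot_right _

/-- The passage from the coordinates of a facet to the coordinates given by a dual frame preserves
Lebesgue measure. -/
lemma measurePreserving_frameCoord_param {e : Fin d → ZVec d} (he : IsFrame v e)
    (β : IntegralChart F) (huv : u ⬝ᵥ v = 1)
    (hV : ∀ x, x ∈ vectorSpan ℝ F ↔ latt u ⬝ᵥ x = 0) :
    MeasurePreserving (fun y => frameCoord e (β.param y)) := by
  -- The composite map is affine, and its linear part is the transpose of this pairing matrix, of
  -- determinant ±1.
  set A : Matrix (Fin d) (Fin d) ℤ := Matrix.of fun i j => β.frame i ⬝ᵥ e j with hA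
  have hdet : IsUnit A.det := he.isUnit_det_pairing (β.isFrame hV) (by rwa [dotProduct_comm])
  set B : Matrix (Fin d) (Fin d) ℝ := (A.map (Int.cast : ℤ → ℝ)).transpose with hB
  have hBdet : |B.det| = 1 := by
    have : B.det = (A.det : ℝ) := by rw [hB, Matrix.det_transpose, Int.cast_det]
    rw [this]
    rcases Int.isUnit_iff.1 hdet with h | h <;> simp [h]
  have hB0 : B.det ≠ 0 := by intro h; rw [h] at hBdet; simp at hBdet
  have h1 : MeasurePreserving (Matrix.toLin' B) := by
    refine ⟨(LinearMap.continuous_of_finiteDimensional _).measurable, ?_⟩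
    rw [Real.map_matrix_volume_pi_eq_smul_volume_pi hB0, abs_inv, hBdet]
    simp
  have h2 : (fun y => frameCoord e (β.param y)) =
      fun y => frameCoord e β.base + Matrix.toLin' B y := by
    ext y j
    simp only [frameCoord, IntegralChart.param, add_dotProduct, Pi.add_apply, Matrix.toLin'_apply,
      sum_dotProduct, smul_dotProduct, smul_eq_mul, latt_dot]
    congr 1
    simp only [Matrix.mulVec, dotProduct, hB, hA, Matrix.transpose_apply, Matrix.map_apply,
      Matrix.of_apply]
    exact Finset.sum_congr rfl fun i _ => mul_comm _ _
  rw [h2]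
  exact (measurePreserving_add_left volume _).comp h1

end Charts

/-! ### Reflexive polytopes and closed stars -/

section

/-- A bounded polyhedron `{x | ⟨n, x⟩ ≤ 1 for n ∈ J}` given by lattice vectors, all of whose nonempty
faces `⟨n, x⟩ = 1` contain lattice points. -/
structure ReflexiveData (Δ : Set (RVec d)) (J : Finset (ZVec d)) : Prop where
  mem_iff : ∀ x, x ∈ Δ ↔ ∀ n ∈ J, latt n ⬝ᵥ x ≤ 1
  bounded : Bornology.IsBounded Δ
  exists_latt : ∀ n ∈ J, ∀ x ∈ Δ, latt n ⬝ᵥ x = 1 → ∃ m : ZVec d, latt m ∈ Δ ∧ n ⬝ᵥ m = 1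

lemma IsLatticePolytope.isCompact {P : Set (RVec d)} (h : IsLatticePolytope P) : IsCompact P := by
  obtain ⟨S, rfl⟩ := h
  exact (S.finite_toSet.image latt).isCompact_convexHull ℝ

lemma convex_dot_le (c : RVec d) (r : ℝ) : Convex ℝ {x | c ⬝ᵥ x ≤ r} :=
  convex_halfSpace_le (dotLin c).isLinear r

lemma convex_dot_lt (c : RVec d) (r : ℝ) : Convex ℝ {x | c ⬝ᵥ x < r} :=
  convex_halfSpace_lt (dotLin c).isLinear r

/-- `J` consists of lattice generators of the dual polytope, and the description of `Δ` is the
bipolar theorem, proved by separation. If no lattice generator of `Δ` satisfied `n = 1`, all of them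
would lie in the convex set `n < 1`, and so would `Δ`. -/
lemma IsReflexive.exists_data {Δ : Set (RVec d)} (hΔ : IsReflexive Δ) :
    ∃ J : Finset (ZVec d), ReflexiveData Δ J := by
  obtain ⟨J, hJ⟩ := hΔ.dual_lattice
  have hcomp := hΔ.lattice.isCompact
  have hmemJ : ∀ n ∈ J, ∀ x ∈ Δ, latt n ⬝ᵥ x ≤ 1 := by
    intro n hn x hx
    have : latt n ∈ dualPolytope Δ := hJ ▸ subset_convexHull ℝ _ (mem_image_of_mem _ hn)
    rw [dotProduct_comm]
    exact this x hx
  refine ⟨J, ?_, hcomp.isBounded, ?_⟩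
  · intro x
    refine ⟨fun hx n hn => hmemJ n hn x hx, fun hx => ?_⟩
    by_contra hxΔ
    have hconv : Convex ℝ Δ := by
      obtain ⟨S, rfl⟩ := hΔ.lattice
      exact convex_convexHull ℝ _
    obtain ⟨l, s, h1, h2⟩ := geometric_hahn_banach_closed_point hconv hcomp.isClosed hxΔ
    obtain ⟨a, ha⟩ := exists_eq_dot l
    simp only [ha] at h1 h2
    have hs : 0 < s := by simpa using h1 0 (interior_subset hΔ.zero_mem)
    have h3 : s⁻¹ • a ∈ dualPolytope Δ := by
      intro m hm
      rw [dotProduct_smul, smul_eq_mul, inv_mul_le_iff₀ hs, mul_one, dotProduct_comm]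
      exact (h1 m hm).le
    rw [hJ] at h3
    have h4 : convexHull ℝ (latt '' (J : Set (ZVec d))) ⊆ {y | x ⬝ᵥ y ≤ 1} := by
      apply convexHull_min _ (convex_dot_le x 1)
      rintro _ ⟨n, hn, rfl⟩
      rw [mem_ofPred_eq, dotProduct_comm]
      exact hx n hn
    have h5 := h4 h3
    rw [mem_ofPred_eq, dotProduct_smul, smul_eq_mul, inv_mul_le_iff₀ hs, mul_one,
      dotProduct_comm] at h5
    linarith
  · intro n hn x hx hnx
    obtain ⟨S, hS⟩ := hΔ.lattice
    by_contra! H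
    have hSΔ : ∀ m ∈ S, latt m ∈ Δ := fun m hm =>
      hS ▸ subset_convexHull ℝ _ (mem_image_of_mem _ hm)
    have h4 : convexHull ℝ (latt '' (S : Set (ZVec d))) ⊆ {y | latt n ⬝ᵥ y < 1} := by
      apply convexHull_min _ (convex_dot_lt _ 1)
      rintro _ ⟨m, hm, rfl⟩
      refine lt_of_le_of_ne (hmemJ n hn _ (hSΔ m hm)) fun h => H m (hSΔ m hm) ?_
      rw [latt_dot] at h
      exact_mod_cast h
    rw [← hS] at h4
    exact absurd hnx (h4 hx).ne

variable {Δ : Set (RVec d)} {J : Finset (ZVec d)} {h : ZVec d → ℤ}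

section Reflexive

lemma ReflexiveData.eq_hpoly (D : ReflexiveData Δ J) : Δ = hpoly (J.image latt) := by
  ext x; rw [D.mem_iff]; simp [hpoly]

lemma ReflexiveData.isCompact (D : ReflexiveData Δ J) : IsCompact Δ :=
  Metric.isCompact_of_isClosed_isBounded (D.eq_hpoly ▸ isClosed_hpoly) D.bounded

lemma ReflexiveData.zero_mem (D : ReflexiveData Δ J) : (0 : RVec d) ∈ interior Δ :=
  D.eq_hpoly ▸ zero_mem_interior_hpoly

lemma ReflexiveData.dot_le (D : ReflexiveData Δ J) {n : ZVec d} (hn : n ∈ J) {x : RVec d}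
    (hx : x ∈ Δ) : latt n ⬝ᵥ x ≤ 1 := (D.mem_iff x).1 hx n hn

lemma ReflexiveData.dot_latt_le (D : ReflexiveData Δ J) {n m : ZVec d} (hn : n ∈ J)
    (hm : latt m ∈ Δ) : n ⬝ᵥ m ≤ 1 := by
  have := D.dot_le hn hm
  rw [latt_dot] at this
  exact_mod_cast this

lemma ReflexiveData.mem_frontier (D : ReflexiveData Δ J) {x : RVec d} :
    x ∈ frontier Δ ↔ x ∈ Δ ∧ ∃ n ∈ J, latt n ⬝ᵥ x = 1 := by
  rw [D.eq_hpoly, mem_frontier_hpoly]; simp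

/-- Boundedness provides an `n` in `J` that is positive on `m`; the value is an integer and at most
1. Much of what follows rests on this consequence of reflexivity. -/
lemma ReflexiveData.exists_dot_eq_one (D : ReflexiveData Δ J) {m : ZVec d} (hm : latt m ∈ Δ)
    (hm0 : m ≠ 0) : ∃ n ∈ J, n ⬝ᵥ m = 1 := by
  have hb := D.bounded
  rw [D.eq_hpoly] at hb
  obtain ⟨c, hc, hpos⟩ := exists_pos_of_bounded hb (x := latt m)
    (fun h0 => hm0 (latt_injective (by rw [h0, latt_zero])))
  obtain ⟨n, hn, rfl⟩ := Finset.mem_image.1 hc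
  refine ⟨n, hn, ?_⟩
  have h1 := D.dot_latt_le hn hm
  rw [latt_dot] at hpos
  have h2 : 0 < n ⬝ᵥ m := by exact_mod_cast hpos
  omega

lemma ReflexiveData.latt_mem_frontier (D : ReflexiveData Δ J) {m : ZVec d} :
    latt m ∈ frontier Δ ↔ latt m ∈ Δ ∧ m ≠ 0 := by
  constructor
  · intro hm
    refine ⟨(D.mem_frontier.1 hm).1, ?_⟩
    rintro rfl
    obtain ⟨n, -, hn⟩ := (D.mem_frontier.1 hm).2
    simp at hn
  · rintro ⟨hm, hm0⟩
    obtain ⟨n, hn, h1⟩ := D.exists_dot_eq_one hm hm0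
    exact D.mem_frontier.2 ⟨hm, n, hn, by rw [latt_dot, h1]; simp⟩

/-- Two points share a proper face exactly when some inequality from `J` is active at both. -/
lemma ReflexiveData.mem_closedStar (D : ReflexiveData Δ J) {m : ZVec d} (hm : latt m ∈ Δ)
    {a : RVec d} :
    a ∈ closedStar Δ (latt m) ↔ a ∈ Δ ∧ ∃ n ∈ J, latt n ⬝ᵥ a = 1 ∧ n ⬝ᵥ m = 1 := by
  have hcast : ∀ n : ZVec d, latt n ⬝ᵥ latt m = 1 ↔ n ⬝ᵥ m = 1 := by
    intro n; rw [latt_dot]; norm_cast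
  simp only [closedStar, mem_iUnion, mem_ofPred_eq, exists_prop]
  constructor
  · rintro ⟨F, ⟨hF, hmF⟩, ha⟩
    rw [D.eq_hpoly] at hF
    obtain ⟨c, hc, h1, h2⟩ := exists_active_of_properFace hF ha hmF
    obtain ⟨n, hn, rfl⟩ := Finset.mem_image.1 hc
    exact ⟨D.eq_hpoly ▸ hF.exposed.subset ha, n, hn, h1, (hcast n).1 h2⟩
  · rintro ⟨ha, n, hn, h1, h2⟩
    have hmF : latt m ∈ hface (J.image latt) (latt n) := ⟨D.eq_hpoly ▸ hm, (hcast n).2 h2⟩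
    refine ⟨hface (J.image latt) (latt n), ⟨?_, hmF⟩, D.eq_hpoly ▸ ha, h1⟩
    rw [D.eq_hpoly]
    exact isProperFace_hface (Finset.mem_image_of_mem _ hn) ⟨_, hmF⟩

lemma ReflexiveData.closedStar_subset (D : ReflexiveData Δ J) {m : ZVec d} (hm : latt m ∈ Δ) :
    closedStar Δ (latt m) ⊆ frontier Δ := by
  intro a ha
  obtain ⟨haΔ, n, hn, h1, -⟩ := (D.mem_closedStar hm).1 ha
  exact D.mem_frontier.2 ⟨haΔ, n, hn, h1⟩

lemma ReflexiveData.isCompact_closedStar (D : ReflexiveData Δ J) {m : ZVec d} (hm : latt m ∈ Δ) :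
    IsCompact (closedStar Δ (latt m)) := by
  have : closedStar Δ (latt m) =
      Δ ∩ ⋃ n ∈ J.filter (fun n => n ⬝ᵥ m = 1), {a | latt n ⬝ᵥ a = 1} := by
    ext a
    rw [D.mem_closedStar hm]
    simp only [mem_inter_iff, mem_iUnion, Finset.mem_filter, mem_ofPred_eq, exists_prop]
    grind
  rw [this]
  refine D.isCompact.inter_right ?_
  exact isClosed_biUnion_finset fun n _ => isClosed_eq (continuous_dot_left _) continuous_const

/-- Every point of `Δ` can be moved in the direction of `m` into the closed star of `m`. -/
lemma ReflexiveData.exists_lift (D : ReflexiveData Δ J) {m : ZVec d} (hm : latt m ∈ Δ)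
    (hm0 : m ≠ 0) {x : RVec d} (hx : x ∈ Δ) :
    ∃ t : ℝ, 0 ≤ t ∧ x + t • latt m ∈ closedStar Δ (latt m) := by
  obtain ⟨n₀, hn₀, hnm₀⟩ := D.exists_dot_eq_one hm hm0
  have hdot : ∀ n : ZVec d, ∀ t : ℝ, latt n ⬝ᵥ (x + t • latt m) = latt n ⬝ᵥ x + t * (n ⬝ᵥ m : ℤ) := by
    intro n t
    rw [dotProduct_add, dotProduct_smul, latt_dot, smul_eq_mul]
  set K := J.filter (fun n => n ⬝ᵥ m = 1) with hK
  have hKne : K.Nonempty := ⟨n₀, by simp [hK, hn₀, hnm₀]⟩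
  -- The smallest slack among the forms with value 1 on `m` is the time at which the ray from `x`
  -- reaches the star. The other forms have value at most 0 on `m` and do not increase along the
  -- ray.
  obtain ⟨n, hn, hmin⟩ := K.exists_min_image (fun n => 1 - latt n ⬝ᵥ x) hKne
  rw [hK, Finset.mem_filter] at hn
  refine ⟨1 - latt n ⬝ᵥ x, by linarith [D.dot_le hn.1 hx], ?_⟩
  rw [D.mem_closedStar hm]
  refine ⟨?_, n, hn.1, ?_, hn.2⟩
  · rw [D.mem_iff]
    intro n' hn'
    rw [hdot]
    have h0 := D.dot_le hn.1 hx
    by_cases h1 : n' ⬝ᵥ m = 1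
    · have := hmin n' (by simp [hK, hn', h1])
      rw [h1]; push_cast; linarith
    · have h2 : n' ⬝ᵥ m ≤ 0 := by have := D.dot_latt_le hn' hm; omega
      have h3 : ((n' ⬝ᵥ m : ℤ) : ℝ) ≤ 0 := by exact_mod_cast h2
      nlinarith [D.dot_le hn' hx]
  · rw [hdot, hn.2]; push_cast; ring

/-- An inequality active at `a` with value 1 on `m` gives `t ≤ 0`; one active at the other point
gives `t ≥ 0`. -/
lemma ReflexiveData.closedStar_inj (D : ReflexiveData Δ J) {m : ZVec d} (hm : latt m ∈ Δ)
    {a : RVec d} {t : ℝ} (ha : a ∈ closedStar Δ (latt m))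
    (ha' : a + t • latt m ∈ closedStar Δ (latt m)) : t = 0 := by
  rw [D.mem_closedStar hm] at ha ha'
  obtain ⟨h1, n, hn, hna, hnm⟩ := ha
  obtain ⟨h1', n', hn', hna', hnm'⟩ := ha'
  have h2 := D.dot_le hn h1'
  have h3 := D.dot_le hn' h1
  rw [dotProduct_add, dotProduct_smul, latt_dot, smul_eq_mul] at h2 hna'
  rw [hnm] at h2
  rw [hnm'] at hna'
  push_cast at h2 hna'
  linarith

lemma ReflexiveData.exists_facet (D : ReflexiveData Δ J) {F : Set (RVec d)} (hF : IsFacet Δ F) :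
    ∃ n ∈ J, (∃ m : ZVec d, latt m ∈ Δ ∧ n ⬝ᵥ m = 1) ∧ (∀ x, x ∈ F ↔ x ∈ Δ ∧ latt n ⬝ᵥ x = 1) ∧
      ∀ v, v ∈ vectorSpan ℝ F ↔ latt n ⬝ᵥ v = 0 := by
  have hne := hF.nonempty
  have hsub := hF.subset
  rw [D.eq_hpoly] at hF
  obtain ⟨c, hc, h1, h2⟩ := exists_facet_eq hF
  obtain ⟨n, hn, rfl⟩ := Finset.mem_image.1 hc
  have h3 : ∀ x, x ∈ F ↔ x ∈ Δ ∧ latt n ⬝ᵥ x = 1 := by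
    intro x; rw [h1, D.eq_hpoly]; rfl
  obtain ⟨x, hx⟩ := hne
  exact ⟨n, hn, D.exists_latt n hn x (hsub hx) ((h3 x).1 hx).2, h3, h2⟩

lemma ReflexiveData.finite_latt (D : ReflexiveData Δ J) : {m : ZVec d | latt m ∈ Δ}.Finite := by
  obtain ⟨R, hR⟩ := D.bounded.exists_norm_le
  refine (Set.finite_Icc (fun _ => -⌈R⌉ : ZVec d) (fun _ => ⌈R⌉)).subset ?_
  intro m hm
  have h1 : ∀ i, |(m i : ℝ)| ≤ ⌈R⌉ := fun i =>
    ((norm_le_pi_norm (latt m) i).trans (hR _ hm)).trans (Int.le_ceil R)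
  refine ⟨fun i => ?_, fun i => ?_⟩
  · have := (abs_le.1 (h1 i)).1
    exact_mod_cast this
  · have := (abs_le.1 (h1 i)).2
    exact_mod_cast this

end Reflexive

/-! ### The polytope of a height function and the stable set -/

section HeightDual

/-- Positive heights can be normalised to 1, and `m = 0` only gives `0 ≤ 0`; the results on `hpoly`
thus apply to `heightDual`. -/
lemma exists_heightForms (D : ReflexiveData Δ J) (hh : IsHeight Δ h) :
    ∃ C : Finset (RVec d), heightDual Δ h = hpoly C ∧
      ∀ c, c ∈ C ↔ ∃ m : ZVec d, latt m ∈ Δ ∧ m ≠ 0 ∧ c = (h m : ℝ)⁻¹ • latt m := by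
  classical
  refine ⟨(D.finite_latt.toFinset.filter (· ≠ 0)).image (fun m => (h m : ℝ)⁻¹ • latt m), ?_, ?_⟩
  · ext x
    simp only [heightDual, hpoly, mem_ofPred_eq, Finset.forall_mem_image, Finset.mem_filter,
      Set.Finite.mem_toFinset]
    constructor
    · rintro hx m ⟨hm, hm0⟩
      have hpos : (0 : ℝ) < h m := by exact_mod_cast hh.pos m hm hm0
      rw [smul_dotProduct, smul_eq_mul, inv_mul_le_iff₀ hpos, mul_one]
      exact hx m hm
    · intro hx m hm
      by_cases hm0 : m = 0
      · simp [hm0, hh.zero]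
      · have hpos : (0 : ℝ) < h m := by exact_mod_cast hh.pos m hm hm0
        have := hx ⟨hm, hm0⟩
        rwa [smul_dotProduct, smul_eq_mul, inv_mul_le_iff₀ hpos, mul_one] at this
  · intro c
    simp only [Finset.mem_image, Finset.mem_filter, Set.Finite.mem_toFinset, mem_ofPred_eq]
    grind

/-- The finitely many generators of `Δ` bound `y ⬝ᵥ x` uniformly for all `y` in `Δ`, and `Δ`
contains a ball around 0; testing with `± (δ / 2)` times a coordinate vector bounds each coordinate
of `x`. -/
lemma isCompact_heightDual (hΔ : IsReflexive Δ) : IsCompact (heightDual Δ h) := by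
  obtain ⟨S, hS⟩ := hΔ.lattice
  have hSΔ : ∀ m ∈ S, latt m ∈ Δ := fun m hm =>
    hS ▸ subset_convexHull ℝ _ (mem_image_of_mem _ hm)
  obtain ⟨H, hH⟩ : ∃ H : ℝ, ∀ m ∈ S, (h m : ℝ) ≤ H := by
    obtain ⟨H, hH⟩ := (S.image fun m => (h m : ℝ)).bddAbove
    exact ⟨H, fun m hm => hH (by simpa using ⟨m, hm, rfl⟩)⟩
  have hle : ∀ x ∈ heightDual Δ h, ∀ y ∈ Δ, y ⬝ᵥ x ≤ H := by
    intro x hx y hy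
    have h4 : convexHull ℝ (latt '' (S : Set (ZVec d))) ⊆ {y | x ⬝ᵥ y ≤ H} := by
      apply convexHull_min _ (convex_dot_le x H)
      rintro _ ⟨m, hm, rfl⟩
      rw [mem_ofPred_eq, dotProduct_comm]
      exact (hx m (hSΔ m hm)).trans (hH m hm)
    rw [← hS] at h4
    have := h4 hy
    rwa [mem_ofPred_eq, dotProduct_comm] at this
  obtain ⟨δ, hδ, hball⟩ := Metric.isOpen_iff.1 isOpen_interior 0 hΔ.zero_mem
  have hcl : IsClosed (heightDual Δ h) := by
    have : heightDual Δ h = ⋂ m : ZVec d, ⋂ _ : latt m ∈ Δ, {n | latt m ⬝ᵥ n ≤ h m} := by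
      ext; simp [heightDual]
    rw [this]
    exact isClosed_iInter fun m => isClosed_iInter fun _ =>
      isClosed_le (continuous_dot_left _) continuous_const
  refine Metric.isCompact_of_isClosed_isBounded hcl ?_
  refine (Metric.isBounded_closedBall (x := (0 : RVec d)) (r := |H| / (δ / 2))).subset fun x hx => ?_
  rw [mem_closedBall_zero_iff]
  refine (pi_norm_le_iff_of_nonneg (by positivity)).2 fun i => ?_
  have hs : ∀ s : ℝ, |s| < δ → s * x i ≤ H := by
    intro s hs
    have := hle x hx (Pi.single i s) (interior_subset (hball (by simpa [Pi.norm_single] using hs)))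
    simpa using this
  rw [Real.norm_eq_abs, le_div_iff₀ (by positivity)]
  have h1 := hs (δ / 2) (by rw [abs_of_pos] <;> linarith)
  have h2 := hs (-(δ / 2)) (by rw [abs_neg, abs_of_pos] <;> linarith)
  have h3 : |x i * (δ / 2)| ≤ H := abs_le.2 ⟨by linarith, by linarith⟩
  rw [abs_mul, abs_of_pos (show (0 : ℝ) < δ / 2 by linarith)] at h3
  exact h3.trans (le_abs_self H)

/-- Pairing with an `n` such that `n ⬝ᵥ m = 1` and `n ⬝ᵥ m' ≤ 1` gives `h m' ≤ h m`, and symmetry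
gives equality. Distinct lattice points thus define distinct inequalities, so a facet determines its
lattice point. -/
lemma eq_of_smul_latt_eq (D : ReflexiveData Δ J) (hh : IsHeight Δ h) {m m' : ZVec d}
    (hm : latt m ∈ Δ) (hm0 : m ≠ 0) (hm' : latt m' ∈ Δ) (hm0' : m' ≠ 0)
    (heq : (h m : ℝ)⁻¹ • latt m = (h m' : ℝ)⁻¹ • latt m') : m = m' := by
  have key : ∀ {m m' : ZVec d}, latt m ∈ Δ → m ≠ 0 → latt m' ∈ Δ → m' ≠ 0 →
      (h m : ℝ)⁻¹ • latt m = (h m' : ℝ)⁻¹ • latt m' → (h m' : ℝ) ≤ h m := by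
    intro m m' hm hm0 hm' hm0' heq
    have hp : (0 : ℝ) < h m := by exact_mod_cast hh.pos m hm hm0
    have hp' : (0 : ℝ) < h m' := by exact_mod_cast hh.pos m' hm' hm0'
    obtain ⟨n, hn, h1⟩ := D.exists_dot_eq_one hm hm0
    have h2 := D.dot_le hn hm'
    have h3 := congrArg (fun v => latt n ⬝ᵥ v) heq
    simp only [dotProduct_smul, smul_eq_mul] at h3
    rw [latt_dot n m, h1] at h3
    push_cast at h3
    rw [mul_one] at h3
    have h4 : (h m : ℝ)⁻¹ ≤ (h m' : ℝ)⁻¹ := by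
      rw [h3]
      have : 0 < (h m' : ℝ)⁻¹ := by positivity
      nlinarith
    exact (inv_le_inv₀ hp hp').1 h4
  have h1 := key hm hm0 hm' hm0' heq
  have h2 := key hm' hm0' hm hm0 heq.symm
  have h3 : (h m : ℝ) = h m' := le_antisymm h2 h1
  have hp : (h m : ℝ)⁻¹ ≠ 0 := by
    have : (0 : ℝ) < h m := by exact_mod_cast hh.pos m hm hm0
    positivity
  rw [← h3] at heq
  exact latt_injective (smul_right_injective _ hp heq)

/-- Every facet of `Δ^∨_h` is the face dual to a unique nonzero lattice point, which is detected at
each point of the relative interior. -/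
lemma exists_dualFace (D : ReflexiveData Δ J) (hh : IsHeight Δ h) {τ : Set (RVec d)}
    (hτ : IsFacet (heightDual Δ h) τ) :
    ∃ m : ZVec d, latt m ∈ Δ ∧ m ≠ 0 ∧ τ = dualFace Δ h m ∧
      (∀ v, v ∈ vectorSpan ℝ τ ↔ latt m ⬝ᵥ v = 0) ∧
      ∀ x ∈ intrinsicInterior ℝ τ, ∀ m', latt m' ∈ Δ → m' ≠ 0 → x ∈ dualFace Δ h m' → m' = m := by
  obtain ⟨C, hC, hmem⟩ := exists_heightForms D hh
  have hone : ∀ {m : ZVec d}, latt m ∈ Δ → m ≠ 0 → ∀ x,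
      ((h m : ℝ)⁻¹ • latt m) ⬝ᵥ x = 1 ↔ latt m ⬝ᵥ x = h m := by
    intro m hm hm0 x
    have hp : (0 : ℝ) < h m := by exact_mod_cast hh.pos m hm hm0
    rw [smul_dotProduct, smul_eq_mul, inv_mul_eq_one₀ hp.ne', eq_comm]
  have hτ' := hτ
  rw [hC] at hτ'
  obtain ⟨x, hx⟩ := facet_interior_nonempty hτ'
  obtain ⟨c, hc, hcx⟩ := exists_active_of_facet hτ' (intrinsicInterior_subset hx)
  obtain ⟨m, hm, hm0, rfl⟩ := (hmem c).1 hc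
  have hp : (0 : ℝ) < h m := by exact_mod_cast hh.pos m hm hm0
  obtain ⟨h1, h2⟩ := facet_eq_of_active hτ' hx hc hcx
  refine ⟨m, hm, hm0, ?_, ?_, ?_⟩
  · rw [h1]
    ext y
    simp only [hface, dualFace, hC, mem_ofPred_eq, hone hm hm0]
  · intro v
    rw [h2, smul_dotProduct, smul_eq_mul, mul_eq_zero]
    simp [hp.ne']
  · intro y hy m' hm' hm0' hym'
    refine eq_of_smul_latt_eq D hh hm' hm0' hm hm0 ?_
    have hcy : ((h m : ℝ)⁻¹ • latt m) ⬝ᵥ y = 1 := by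
      have := intrinsicInterior_subset hy
      rw [h1] at this
      exact this.2
    exact facet_active_unique hτ' hy hc hcy ((hmem _).2 ⟨m', hm', hm0', rfl⟩)
      ((hone hm' hm0' y).2 hym'.2)

lemma mem_stableSet (D : ReflexiveData Δ J) {a x : RVec d} :
    (a, x) ∈ stableSet Δ h ↔ ∃ m : ZVec d, latt m ∈ Δ ∧ m ≠ 0 ∧ a ∈ closedStar Δ (latt m) ∧
      x ∈ dualFace Δ h m := by
  simp only [stableSet, mem_iUnion, mem_ofPred_eq, D.latt_mem_frontier, mem_prod, exists_prop,
    and_assoc]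

lemma isCompact_stableSet (hΔ : IsReflexive Δ) (D : ReflexiveData Δ J) :
    IsCompact (stableSet Δ h) := by
  refine Set.Finite.isCompact_biUnion (D.finite_latt.subset fun m hm => ?_) fun m hm => ?_
  · exact (D.latt_mem_frontier.1 hm).1
  · refine (D.isCompact_closedStar (D.latt_mem_frontier.1 hm).1).prod ?_
    exact (isCompact_heightDual hΔ).inter_right
      (isClosed_eq (continuous_dot_left _) continuous_const)

end HeightDual

end

/-! ### Integral Lebesgue measure on ∂Δ and projection along a lattice point -/

section

lemma volume_hyperplane {k : ℕ} {w : Fin k → ℝ} (hw : w ≠ 0) (r : ℝ) :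
    volume {y : Fin k → ℝ | w ⬝ᵥ y = r} = 0 := by
  obtain h | ⟨y₀, hy₀⟩ := {y : Fin k → ℝ | w ⬝ᵥ y = r}.eq_empty_or_nonempty
  · rw [h, measure_empty]
  have : {y : Fin k → ℝ | w ⬝ᵥ y = r} =
      (AffineSubspace.mk' y₀ (LinearMap.ker (dotLin w)) : Set (Fin k → ℝ)) := by
    ext y
    rw [mem_ofPred_eq] at hy₀
    simp [AffineSubspace.mem_mk', dotProduct_sub, sub_eq_zero, hy₀]
  rw [this]
  apply Measure.addHaar_affineSubspace
  intro htop
  have h1 : w ∈ (AffineSubspace.mk' y₀ (LinearMap.ker (dotLin w))).direction := by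
    rw [htop]; simp
  rw [AffineSubspace.direction_mk', LinearMap.mem_ker, dotLin_apply] at h1
  exact (dot_self_pos hw).ne' h1

variable {Δ : Set (RVec d)} {J : Finset (ZVec d)} {h : ZVec d → ℤ} {F : Set (RVec d)}

/-- A chart of a facet that computes its integral Lebesgue measure, with a lattice equation of the
facet and a lattice point on it. -/
structure FacetChart (Δ : Set (RVec d)) (J : Finset (ZVec d)) (F : Set (RVec d))
    (n m : ZVec d) (β : IntegralChart F) : Prop where
  mem : n ∈ J
  latt_mem : latt m ∈ Δ
  dot : n ⬝ᵥ m = 1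
  mem_iff : ∀ x, x ∈ F ↔ x ∈ Δ ∧ latt n ⬝ᵥ x = 1
  mem_vectorSpan : ∀ v, v ∈ vectorSpan ℝ F ↔ latt n ⬝ᵥ v = 0
  measure_eq : facetMeasure F = ((volume : Measure (Fin d → ℝ)).map β.param).restrict F

lemma ReflexiveData.exists_facetChart (D : ReflexiveData Δ J) (hF : IsFacet Δ F) :
    ∃ n m β, FacetChart Δ J F n m β := by
  obtain ⟨n, hn, ⟨m, hm, hnm⟩, h1, h2⟩ := D.exists_facet hF
  have H := nonempty_chart hF.nonempty hnm h2
  exact ⟨n, m, H.some, hn, hm, hnm, h1, h2, by rw [facetMeasure, dif_pos H]⟩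

section Facet

variable {n m : ZVec d} {β : IntegralChart F}

lemma FacetChart.isClosed (H : FacetChart Δ J F n m β) (D : ReflexiveData Δ J) : IsClosed F := by
  have : F = Δ ∩ {x | latt n ⬝ᵥ x = 1} := by ext x; rw [H.mem_iff]; rfl
  rw [this]
  exact D.isCompact.isClosed.inter (isClosed_eq (continuous_dot_left _) continuous_const)

lemma FacetChart.isCompact (H : FacetChart Δ J F n m β) (D : ReflexiveData Δ J) : IsCompact F :=
  D.isCompact.of_isClosed_subset (H.isClosed D) fun _ hx => ((H.mem_iff _).1 hx).1

lemma FacetChart.measurableEmbedding (H : FacetChart Δ J F n m β) : MeasurableEmbedding β.param :=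
  β.measurableEmbedding H.dot H.mem_vectorSpan

lemma FacetChart.mem_affineSpan (H : FacetChart Δ J F n m β) (hne : F.Nonempty) (x : RVec d) :
    x ∈ affineSpan ℝ F ↔ latt n ⬝ᵥ x = 1 :=
  affineSpan_eq_of_vectorSpan hne (fun _ hx => ((H.mem_iff _).1 hx).2) H.mem_vectorSpan x

lemma FacetChart.apply (H : FacetChart Δ J F n m β) (D : ReflexiveData Δ J) (X : Set (RVec d)) :
    facetMeasure F X = volume (β.param ⁻¹' (X ∩ F)) := by
  rw [H.measure_eq, Measure.restrict_apply' (H.isClosed D).measurableSet,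
    H.measurableEmbedding.map_apply]

lemma FacetChart.dot_param (H : FacetChart Δ J F n m β) (hne : F.Nonempty) (y : Fin d → ℝ) :
    latt n ⬝ᵥ β.param y = 1 := (H.mem_affineSpan hne _).1 (β.param_mem y)

/-- A facet meets the hyperplane of another facet in a null set. -/
lemma FacetChart.null_hyperplane (H : FacetChart Δ J F n m β) (D : ReflexiveData Δ J)
    (hne : F.Nonempty) {n' : ZVec d} (hn' : n' ≠ n) : facetMeasure F {x | latt n' ⬝ᵥ x = 1} = 0 := by
  rw [H.apply D]
  have hparam : ∀ y, latt n' ⬝ᵥ β.param y =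
      latt n' ⬝ᵥ β.base + (frameCoord β.frame (latt n')) ⬝ᵥ y := by
    intro y
    rw [IntegralChart.param, dotProduct_add, dotProduct_sum]
    congr 1
    change _ = ∑ i, frameCoord β.frame (latt n') i * y i
    refine Finset.sum_congr rfl fun i _ => ?_
    rw [dotProduct_smul, smul_eq_mul, mul_comm]
    rfl
  refine measure_mono_null (t := {y | (frameCoord β.frame (latt n')) ⬝ᵥ y =
    1 - latt n' ⬝ᵥ β.base}) ?_ ?_
  · rintro y ⟨hy, -⟩
    have hy' : latt n' ⬝ᵥ β.param y = 1 := hy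
    rw [hparam] at hy'
    rw [mem_ofPred_eq]; linarith
  -- If `n'` vanishes on the tangent space it is a multiple of `n`, and the value 1 on the
  -- hyperplane of `n` would force `n' = n`; so the set is empty. Otherwise it lies in a genuine
  -- hyperplane of the chart.
  · by_cases hw : frameCoord β.frame (latt n') = 0
    · convert measure_empty (μ := (volume : Measure (Fin d → ℝ)))
      rw [Set.eq_empty_iff_forall_notMem]
      intro y hy
      rw [mem_ofPred_eq, hw, zero_dotProduct] at hy
      apply hn'
      have h1 := (β.isFrame H.mem_vectorSpan).exists_smul_of_ortho H.dot (x := latt n')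
        (fun i => congrFun hw i)
      have h2 := H.dot_param hne 0
      have h3 : β.param 0 = β.base := by simp [IntegralChart.param]
      rw [h3] at h2
      have h4 : latt n' ⬝ᵥ β.base = latt n' ⬝ᵥ latt m := by
        conv_lhs => rw [h1]
        rw [smul_dotProduct, h2]; simp
      apply latt_injective
      rw [h1, ← h4, show latt n' ⬝ᵥ β.base = 1 by linarith, one_smul]
    · exact volume_hyperplane hw _

lemma frameCoord_add (e : Fin d → ZVec d) (x y : RVec d) :
    frameCoord e (x + y) = frameCoord e x + frameCoord e y := by
  ext i; simp [frameCoord, add_dotProduct]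

lemma frameCoord_smul (e : Fin d → ZVec d) (t : ℝ) (x : RVec d) :
    frameCoord e (t • x) = t • frameCoord e x := by
  ext i; simp [frameCoord, smul_dotProduct]

/-- `frameCoord` as a linear map. -/
def frameCoordLin (e : Fin d → ZVec d) : RVec d →ₗ[ℝ] Fin d → ℝ where
  toFun := frameCoord e
  map_add' := frameCoord_add e
  map_smul' := frameCoord_smul e

lemma IsFrame.frameCoord_self {e : Fin d → ZVec d} (he : IsFrame m e) :
    frameCoord e (latt m) = 0 := by
  ext i; exact he.latt_dot i

/-- The fibres of `frameCoord e` are the lines in direction `m`. -/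
lemma IsFrame.exists_eq_add_smul {e : Fin d → ZVec d} (he : IsFrame m e) (hnm : n ⬝ᵥ m = 1)
    {x y : RVec d} (hxy : frameCoord e x = frameCoord e y) :
    ∃ t : ℝ, y = x + t • latt m := by
  have := he.exists_smul_of_ortho (v := n) (by rwa [dotProduct_comm]) (x := y - x) (by
    intro i
    have h1 := congrFun hxy i
    simp only [frameCoord] at h1
    rw [sub_dotProduct, h1, sub_self])
  exact ⟨_, by rw [← this]; abel⟩

/-- The projection along `m'` is injective on the hyperplane of the facet, because `n ⬝ᵥ m' = 1`. -/
lemma FacetChart.param_preimage (H : FacetChart Δ J F n m β) (hne : F.Nonempty)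
    {m' : ZVec d} (hnm : n ⬝ᵥ m' = 1) {e : Fin d → ZVec d} (he : IsFrame m' e) :
    β.param ⁻¹' F = (fun y => frameCoord e (β.param y)) ⁻¹' (frameCoord e '' F) := by
  ext y
  constructor
  · exact fun hy => ⟨_, hy, rfl⟩
  · rintro ⟨x, hx, hxy⟩
    obtain ⟨t, ht⟩ := he.exists_eq_add_smul hnm hxy
    have h1 := H.dot_param hne y
    rw [ht, dotProduct_add, ((H.mem_iff x).1 hx).2, dotProduct_smul, latt_dot, hnm] at h1
    have ht0 : t = 0 := by simpa using h1
    rw [ht0, zero_smul, add_zero] at ht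
    rwa [mem_preimage, ht]

/-- Any lattice vector on which `n` has value 1 may serve as direction of projection, so all facets
through `m'` can be measured in the same coordinates. -/
lemma FacetChart.measure_preimage_frameCoord (H : FacetChart Δ J F n m β) (D : ReflexiveData Δ J)
    (hne : F.Nonempty) {m' : ZVec d} (hnm : n ⬝ᵥ m' = 1) {e : Fin d → ZVec d} (he : IsFrame m' e)
    {Y : Set (Fin d → ℝ)} (hY : MeasurableSet Y) :
    facetMeasure F (frameCoord e ⁻¹' Y) = volume (Y ∩ frameCoord e '' F) := by
  have hmp := measurePreserving_frameCoord_param he β hnm H.mem_vectorSpan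
  have hm : MeasurableSet (frameCoord e '' F) :=
    ((H.isCompact D).image (continuous_frameCoord e)).measurableSet
  rw [H.apply D, preimage_inter, H.param_preimage hne hnm he, ← preimage_comp,
    ← hmp.measure_preimage (hY.inter hm).nullMeasurableSet]
  rfl

lemma FacetChart.measure_lt_top (H : FacetChart Δ J F n m β) (D : ReflexiveData Δ J)
    (hne : F.Nonempty) : facetMeasure F univ < ⊤ := by
  have hm0 : m ≠ 0 := by rintro rfl; simpa using H.dot
  obtain ⟨e, -, he⟩ := exists_isFrame hm0
  have := H.measure_preimage_frameCoord D hne H.dot he MeasurableSet.univ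
  rw [preimage_univ, univ_inter] at this
  rw [this]
  exact ((H.isCompact D).image (continuous_frameCoord e)).measure_lt_top

end Facet

section Boundary

lemma ReflexiveData.finite_facets (D : ReflexiveData Δ J) :
    Finite {F : Set (RVec d) // IsFacet Δ F} := by
  have := TropicalMA.finite_facets (C := J.image latt)
  rw [← D.eq_hpoly] at this
  exact this.to_subtype

lemma ReflexiveData.isFiniteMeasure (D : ReflexiveData Δ J) :
    IsFiniteMeasure (boundaryMeasure Δ) := by
  have := D.finite_facets
  have := Fintype.ofFinite {F : Set (RVec d) // IsFacet Δ F}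
  refine ⟨?_⟩
  rw [boundaryMeasure, Measure.sum_apply _ MeasurableSet.univ, tsum_fintype]
  refine ENNReal.sum_lt_top.2 fun F _ => ?_
  obtain ⟨n, m, β, H⟩ := D.exists_facetChart F.2
  exact H.measure_lt_top D F.2.nonempty

lemma ReflexiveData.boundaryMeasure_null (D : ReflexiveData Δ J) {X : Set (RVec d)} :
    boundaryMeasure Δ X = 0 ↔ ∀ F, IsFacet Δ F → facetMeasure F X = 0 := by
  have := D.finite_facets
  rw [boundaryMeasure, Measure.sum_apply_eq_zero]
  simp

lemma ReflexiveData.boundaryMeasure_compl (D : ReflexiveData Δ J) :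
    boundaryMeasure Δ (frontier Δ)ᶜ = 0 := by
  rw [D.boundaryMeasure_null]
  intro F hF
  obtain ⟨n, m, β, H⟩ := D.exists_facetChart hF
  rw [H.apply D]
  convert measure_empty (μ := (volume : Measure (Fin d → ℝ)))
  convert preimage_empty
  rw [eq_empty_iff_forall_notMem]
  rintro x ⟨h1, h2⟩
  exact h1 (D.mem_frontier.2 ⟨((H.mem_iff x).1 h2).1, n, H.mem, ((H.mem_iff x).1 h2).2⟩)

/-- The integral Lebesgue measure has full support on the boundary. -/
lemma ReflexiveData.frontier_subset_of_null (D : ReflexiveData Δ J) {K : Set (RVec d)}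
    (hK : IsClosed K) (hnull : boundaryMeasure Δ Kᶜ = 0) : frontier Δ ⊆ K := by
  have hsub : openFacets Δ ⊆ K := by
    intro x hx
    simp only [openFacets, mem_iUnion, mem_ofPred_eq, exists_prop] at hx
    obtain ⟨F, hF, hx⟩ := hx
    obtain ⟨n, m, β, H⟩ := D.exists_facetChart hF
    have h0 := D.boundaryMeasure_null.1 hnull F hF
    rw [H.apply D] at h0
    by_contra hxK
    have ho : IsOpen (β.param ⁻¹' (Kᶜ ∩ intrinsicInterior ℝ F)) :=
      (hK.isOpen_compl.preimage β.continuous_param).inter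
        (isOpen_preimage_intrinsicInterior β.continuous_param β.param_mem)
    obtain ⟨y, hy⟩ := β.exists_param_eq H.dot H.mem_vectorSpan
      (subset_affineSpan ℝ F (intrinsicInterior_subset hx))
    have hpos := ho.measure_pos volume ⟨y, by rw [mem_preimage, hy]; exact ⟨hxK, hx⟩⟩
    have hle := measure_mono (μ := (volume : Measure (Fin d → ℝ)))
      (preimage_mono (f := β.param) (inter_subset_inter_right Kᶜ (intrinsicInterior_subset (𝕜 := ℝ) (s := F))))
    rw [h0] at hle
    exact absurd hle (not_le.2 hpos)
  have := frontier_subset_closure_openFacets (C := J.image latt)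
  rw [← D.eq_hpoly] at this
  exact this.trans (closure_minimal hsub hK)

variable {m : ZVec d} {e : Fin d → ZVec d}

lemma ReflexiveData.frameCoord_injOn (D : ReflexiveData Δ J) (hm : latt m ∈ Δ) (hm0 : m ≠ 0)
    (he : IsFrame m e) : InjOn (frameCoord e) (closedStar Δ (latt m)) := by
  intro x hx y hy hxy
  obtain ⟨n, -, hnm⟩ := D.exists_dot_eq_one hm hm0
  obtain ⟨t, rfl⟩ := he.exists_eq_add_smul hnm hxy
  rw [D.closedStar_inj hm hx hy]; simp

/-- `J` may contain forms whose faces have lower dimension. Since `m` lies in the face and projects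
to 0, the image is contained in a proper linear subspace. -/
lemma volume_image_hface_of_not_facet {C : Finset (RVec d)} {c : RVec d} (hc : c ∈ C)
    (he : IsFrame m e) (hm : latt m ∈ hface C c) (hF : ¬ IsFacet (hpoly C) (hface C c)) :
    volume (frameCoord e '' hface C c) = 0 := by
  have hle : vectorSpan ℝ (hface C c) ≤ LinearMap.ker (dotLin c) := by
    rw [vectorSpan_def, Submodule.span_le]
    rintro _ ⟨p, hp, q, hq, rfl⟩
    simp [dotProduct_sub, hp.2, hq.2]
  have h1 := Submodule.finrank_mono hle
  rw [finrank_ker_dotLin (ne_zero_of_dot hm.2)] at h1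
  have h2 : finrank ℝ (vectorSpan ℝ (hface C c)) ≠ d := fun h =>
    hF ⟨⟨_, hm⟩, isExposed_hface hc, h⟩
  have h3 := Submodule.finrank_map_le (frameCoordLin e) (vectorSpan ℝ (hface C c))
  refine measure_mono_null (t := (Submodule.map (frameCoordLin e) (vectorSpan ℝ (hface C c)) :
    Set (Fin d → ℝ))) ?_ (Measure.addHaar_submodule _ _ ?_)
  · rintro _ ⟨x, hx, rfl⟩
    refine ⟨x - latt m, vsub_mem_vectorSpan ℝ hx hm, ?_⟩
    rw [map_sub]
    change frameCoord e x - frameCoord e (latt m) = _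
    rw [he.frameCoord_self, sub_zero]
  · intro htop
    rw [htop] at h3
    have h4 : finrank ℝ (⊤ : Submodule ℝ (Fin d → ℝ)) = d := by simp
    have h5 := lt_of_le_of_ne h1 h2
    exact absurd (h3.trans_lt h5) (by rw [h4]; exact lt_irrefl d)

/-- The projection along `m` maps the boundary measure of the closed star of `m` to Lebesgue
measure. -/
lemma ReflexiveData.measure_closedStar_inter (D : ReflexiveData Δ J) (hm : latt m ∈ Δ) (hm0 : m ≠ 0)
    (he : IsFrame m e) {Y : Set (Fin d → ℝ)} (hY : MeasurableSet Y) :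
    boundaryMeasure Δ (closedStar Δ (latt m) ∩ frameCoord e ⁻¹' Y) =
      volume (Y ∩ frameCoord e '' closedStar Δ (latt m)) := by
  classical
  have := D.finite_facets
  set S := closedStar Δ (latt m) with hS
  have hSm : MeasurableSet S := (D.isCompact_closedStar hm).measurableSet
  have hinj := D.frameCoord_injOn hm hm0 he
  -- Only facets through `m` contribute: any other facet meets the star inside hyperplanes of other
  -- forms, a null set. The pieces `T F` overlap in null sets because the projection is injective on
  -- the star.
  let T : {F : Set (RVec d) // IsFacet Δ F} → Set (Fin d → ℝ) := fun F =>
    if latt m ∈ F.1 then Y ∩ frameCoord e '' F.1 else ∅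
  have hcast : ∀ n : ZVec d, latt n ⬝ᵥ latt m = 1 ↔ n ⬝ᵥ m = 1 := by
    intro n; rw [latt_dot]; norm_cast
  have hFS : ∀ F, IsFacet Δ F → latt m ∈ F → F ⊆ S := by
    intro F hF hmF x hx
    obtain ⟨n, m', β, H⟩ := D.exists_facetChart hF
    exact (D.mem_closedStar hm).2 ⟨((H.mem_iff x).1 hx).1, n, H.mem, ((H.mem_iff x).1 hx).2,
      (hcast n).1 ((H.mem_iff _).1 hmF).2⟩
  have hcompact : ∀ F, IsFacet Δ F → IsCompact F := by
    intro F hF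
    obtain ⟨n, m', β, H⟩ := D.exists_facetChart hF
    exact H.isCompact D
  have hT : ∀ F, facetMeasure F.1 (S ∩ frameCoord e ⁻¹' Y) = volume (T F) := by
    rintro ⟨F, hF⟩
    obtain ⟨n, m', β, H⟩ := D.exists_facetChart hF
    by_cases hmF : latt m ∈ F
    · simp only [T, hmF, if_true]
      rw [← H.measure_preimage_frameCoord D hF.nonempty
        ((hcast n).1 ((H.mem_iff _).1 hmF).2) he hY, H.apply D, H.apply D]
      congr 2
      ext x
      have := @hFS F hF hmF x
      simp only [mem_inter_iff]; tauto
    · simp only [T, hmF, if_false, measure_empty]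
      refine measure_mono_null (t := ⋃ n' ∈ J.filter (fun n' => n' ≠ n),
        {x | latt n' ⬝ᵥ x = 1}) ?_ ((measure_biUnion_null_iff (Finset.countable_toSet _)).2 ?_)
      · rintro x ⟨hx, -⟩
        obtain ⟨hxΔ, n', hn', h1, h2⟩ := (D.mem_closedStar hm).1 hx
        refine mem_biUnion (x := n') (Finset.mem_coe.2 (Finset.mem_filter.2 ⟨hn', ?_⟩)) h1
        rintro rfl
        exact hmF ((H.mem_iff _).2 ⟨hm, (hcast _).2 h2⟩)
      · intro n' hn'
        exact H.null_hyperplane D hF.nonempty (Finset.mem_filter.1 (Finset.mem_coe.1 hn')).2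
  have hTm : ∀ F, MeasurableSet (T F) := by
    rintro ⟨F, hF⟩
    by_cases hmF : latt m ∈ F
    · simp only [T, hmF, if_true]
      exact hY.inter ((hcompact F hF).image (continuous_frameCoord e)).measurableSet
    · simp only [T, hmF, if_false, MeasurableSet.empty]
  have hdisj : Pairwise (fun F F' => AEDisjoint volume (T F) (T F')) := by
    rintro ⟨F, hF⟩ ⟨F', hF'⟩ hne
    by_cases hmF : latt m ∈ F
    swap
    · simp only [T, hmF, if_false]; simp [AEDisjoint]
    by_cases hmF' : latt m ∈ F'
    swap
    · simp only [T, hmF', if_false]; simp [AEDisjoint]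
    simp only [T, hmF, hmF', if_true]
    obtain ⟨n, m₁, β, H⟩ := D.exists_facetChart hF
    obtain ⟨n', m₂, β', H'⟩ := D.exists_facetChart hF'
    have hnn : n' ≠ n := by
      rintro rfl
      apply hne
      ext x
      simp only [H.mem_iff, H'.mem_iff]
    have h1 := H.measure_preimage_frameCoord D hF.nonempty
        ((hcast n).1 ((H.mem_iff _).1 hmF).2) he
        ((hcompact F' hF').image (continuous_frameCoord e)).measurableSet
    refine measure_mono_null (t := frameCoord e '' F' ∩ frameCoord e '' F) (by
      rintro y ⟨⟨-, h1⟩, -, h2⟩; exact ⟨h2, h1⟩) ?_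
    rw [← h1, H.apply D]
    refine measure_mono_null ?_ ((H.apply D _).symm.trans (H.null_hyperplane D hF.nonempty hnn))
    refine preimage_mono ?_
    rintro x ⟨⟨z, hz, hzx⟩, hx⟩
    have : z = x := hinj (hFS F' hF' hmF' hz) (hFS F hF hmF hx) hzx
    subst this
    exact ⟨((H'.mem_iff _).1 hz).2, hx⟩
  have hsum : boundaryMeasure Δ (S ∩ frameCoord e ⁻¹' Y) = volume (⋃ F, T F) := by
    rw [measure_iUnion₀ hdisj fun F => (hTm F).nullMeasurableSet, boundaryMeasure,
      Measure.sum_apply _ (hSm.inter ((continuous_frameCoord e).measurable hY))]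
    exact tsum_congr hT
  rw [hsum]
  -- The part of the star covered by faces that are not facets; its projection is null.
  set Z : Set (Fin d → ℝ) := ⋃ n ∈ J.filter (fun n => n ⬝ᵥ m = 1 ∧
    ¬ IsFacet Δ (hface (J.image latt) (latt n))), frameCoord e '' hface (J.image latt) (latt n)
  have hZ : volume Z = 0 := by
    refine (measure_biUnion_null_iff (Finset.countable_toSet _)).2 ?_
    intro n hn
    obtain ⟨hn, hnm, hF⟩ := Finset.mem_filter.1 (Finset.mem_coe.1 hn)
    rw [D.eq_hpoly] at hF
    exact volume_image_hface_of_not_facet (Finset.mem_image_of_mem _ hn) he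
      ⟨D.eq_hpoly ▸ hm, (hcast n).2 hnm⟩ hF
  apply le_antisymm
  · refine measure_mono (iUnion_subset ?_)
    rintro ⟨F, hF⟩
    by_cases hmF : latt m ∈ F
    · simp only [T, hmF, if_true]
      exact inter_subset_inter_right _ (image_mono (hFS F hF hmF))
    · simp only [T, hmF, if_false, empty_subset]
  · refine (measure_mono (t := (⋃ F, T F) ∪ Z) ?_).trans ((measure_union_le _ _).trans (by simp [hZ]))
    rintro _ ⟨hy, x, hx, rfl⟩
    obtain ⟨hxΔ, n, hn, h1, h2⟩ := (D.mem_closedStar hm).1 hx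
    have hxF : x ∈ hface (J.image latt) (latt n) := ⟨D.eq_hpoly ▸ hxΔ, h1⟩
    by_cases hF : IsFacet Δ (hface (J.image latt) (latt n))
    · refine Or.inl (mem_iUnion.2 ⟨⟨_, hF⟩, ?_⟩)
      have hmF : latt m ∈ hface (J.image latt) (latt n) := ⟨D.eq_hpoly ▸ hm, (hcast n).2 h2⟩
      simp only [T, hmF, if_true]
      exact ⟨hy, x, hxF, rfl⟩
    · exact Or.inr (mem_biUnion (x := n)
        (Finset.mem_coe.2 (Finset.mem_filter.2 ⟨hn, h2, hF⟩)) ⟨x, hxF, rfl⟩)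

/-- Take `Y` to be the image of `X`: injectivity on the star makes it Borel, by Lusin–Souslin, and
recovers `X` from it. -/
lemma ReflexiveData.volume_image_of_measurable (D : ReflexiveData Δ J) (hm : latt m ∈ Δ)
    (hm0 : m ≠ 0) (he : IsFrame m e) {X : Set (RVec d)} (hXS : X ⊆ closedStar Δ (latt m))
    (hX : MeasurableSet X) : volume (frameCoord e '' X) = boundaryMeasure Δ X := by
  have hinj := D.frameCoord_injOn hm hm0 he
  have hY : MeasurableSet (frameCoord e '' X) :=
    hX.image_of_continuousOn_injOn (continuous_frameCoord e).continuousOn (hinj.mono hXS)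
  have := D.measure_closedStar_inter hm hm0 he hY
  rw [inter_eq_left.2 (image_mono hXS)] at this
  rw [← this]
  congr 1
  ext x
  constructor
  · rintro ⟨hx, z, hz, hzx⟩
    rwa [← hinj (hXS hz) hx hzx]
  · exact fun hx => ⟨hXS hx, x, hx, rfl⟩

/-- Null measurability is all that is known for contact sets. `X` lies between a Borel subset and
its union with a null Borel set, and null sets project to null sets. -/
lemma ReflexiveData.volume_image (D : ReflexiveData Δ J) (hm : latt m ∈ Δ)
    (hm0 : m ≠ 0) (he : IsFrame m e) {X : Set (RVec d)} (hXS : X ⊆ closedStar Δ (latt m))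
    (hX : NullMeasurableSet X (boundaryMeasure Δ)) :
    volume (frameCoord e '' X) = boundaryMeasure Δ X := by
  have hSm : MeasurableSet (closedStar Δ (latt m)) := (D.isCompact_closedStar hm).measurableSet
  obtain ⟨X₁, hsub, hX₁, hae⟩ := hX.exists_measurable_subset_ae_eq
  have h1 := D.volume_image_of_measurable hm hm0 he (hsub.trans hXS) hX₁
  have h0 : boundaryMeasure Δ (X \ X₁) = 0 := (ae_le_set.1 hae.symm.le)
  obtain ⟨Z, hZ, hZm, hZ0⟩ := exists_measurable_superset_of_null h0
  have h2 := D.volume_image_of_measurable hm hm0 he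
    (inter_subset_right : Z ∩ closedStar Δ (latt m) ⊆ _) (hZm.inter hSm)
  rw [measure_mono_null inter_subset_left hZ0] at h2
  apply le_antisymm
  · calc volume (frameCoord e '' X)
        ≤ volume (frameCoord e '' X₁ ∪ frameCoord e '' (Z ∩ closedStar Δ (latt m))) := by
          refine measure_mono ?_
          rw [← image_union]
          refine image_mono fun x hx => ?_
          by_cases hx1 : x ∈ X₁
          · exact Or.inl hx1
          · exact Or.inr ⟨hZ ⟨hx, hx1⟩, hXS hx⟩
      _ ≤ _ := measure_union_le _ _
      _ = boundaryMeasure Δ X := by rw [h1, h2, add_zero, measure_congr hae]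
  · rw [← measure_congr hae, ← h1]
    exact measure_mono (image_mono hsub)

end Boundary

end

/-! ### Legendre transforms and contact sets -/

section

section Legendre

lemma abs_dot_le {k : ℕ} (x y : Fin k → ℝ) : |x ⬝ᵥ y| ≤ k * ‖x‖ * ‖y‖ := by
  calc |x ⬝ᵥ y| ≤ ∑ i, |x i * y i| := Finset.abs_sum_le_sum_abs _ _
    _ ≤ ∑ _i : Fin k, ‖x‖ * ‖y‖ := Finset.sum_le_sum fun i _ => by
        rw [abs_mul]
        exact mul_le_mul (norm_le_pi_norm x i) (norm_le_pi_norm y i) (abs_nonneg _) (norm_nonneg _)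
    _ = k * ‖x‖ * ‖y‖ := by simp [mul_assoc]

variable {P : Set (RVec d)} {Ψ : RVec d → ℝ}

/-- The Legendre transform of the restriction of `Ψ` to `P`. -/
noncomputable def legendre (P : Set (RVec d)) (Ψ : RVec d → ℝ) (a : RVec d) : ℝ :=
  sSup ((fun x => a ⬝ᵥ x - Ψ x) '' P)

lemma exists_legendre_eq (hP : IsCompact P) (hne : P.Nonempty) (hΨ : Continuous Ψ) (a : RVec d) :
    ∃ x ∈ P, legendre P Ψ a = a ⬝ᵥ x - Ψ x := by
  have hc : Continuous fun x => a ⬝ᵥ x - Ψ x := (continuous_dot_left a).sub hΨ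
  exact hP.exists_sSup_image_eq hne hc.continuousOn

lemma le_legendre (hP : IsCompact P) (hΨ : Continuous Ψ) (a : RVec d) {x : RVec d} (hx : x ∈ P) :
    a ⬝ᵥ x - Ψ x ≤ legendre P Ψ a := by
  have hc : Continuous fun x => a ⬝ᵥ x - Ψ x := (continuous_dot_left a).sub hΨ
  exact le_csSup (hP.image hc).bddAbove ⟨x, hx, rfl⟩

lemma legendre_eq_iff (hP : IsCompact P) (hΨ : Continuous Ψ) {a x : RVec d} (hx : x ∈ P) :
    legendre P Ψ a = a ⬝ᵥ x - Ψ x ↔ ∀ y ∈ P, Ψ x + a ⬝ᵥ (y - x) ≤ Ψ y := by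
  constructor
  · intro h y hy
    have := le_legendre hP hΨ a hy
    rw [dotProduct_sub]; linarith
  · intro h
    obtain ⟨y, hy, h1⟩ := exists_legendre_eq hP ⟨x, hx⟩ hΨ a
    have h2 := h y hy
    have h3 := le_legendre hP hΨ a hx
    rw [dotProduct_sub] at h2
    linarith

/-- A point attaining the supremum is a subgradient of the transform. -/
lemma legendre_add_le (hP : IsCompact P) (hΨ : Continuous Ψ) {a x : RVec d} (hx : x ∈ P)
    (h : legendre P Ψ a = a ⬝ᵥ x - Ψ x) (b : RVec d) :
    legendre P Ψ a + (b - a) ⬝ᵥ x ≤ legendre P Ψ b := by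
  have := le_legendre hP hΨ b hx
  rw [sub_dotProduct]; linarith

lemma exists_lipschitz_legendre (hP : IsCompact P) (hne : P.Nonempty) (hΨ : Continuous Ψ) :
    ∃ K, LipschitzWith K (legendre P Ψ) := by
  obtain ⟨R, hR⟩ := hP.isBounded.exists_norm_le
  have hR0 : 0 ≤ R := (norm_nonneg _).trans (hR _ hne.some_mem)
  refine ⟨Real.toNNReal ((d + 1 : ℕ) * R), LipschitzWith.of_le_add_mul' _ fun a b => ?_⟩
  obtain ⟨x, hx, h⟩ := exists_legendre_eq hP hne hΨ a
  have h1 := legendre_add_le hP hΨ hx h b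
  have h2 := (neg_le_abs _).trans (abs_dot_le (b - a) x)
  have h3 : ((d + 1 : ℕ) : ℝ) * ‖b - a‖ * ‖x‖ ≤ (d + 1 : ℕ) * R * dist a b := by
    rw [dist_comm, dist_eq_norm]
    have := mul_le_mul_of_nonneg_left (hR x hx)
      (show (0 : ℝ) ≤ ((d + 1 : ℕ) : ℝ) * ‖b - a‖ by positivity)
    linarith
  linarith

lemma continuous_legendre (hP : IsCompact P) (hne : P.Nonempty) (hΨ : Continuous Ψ) :
    Continuous (legendre P Ψ) := (exists_lipschitz_legendre hP hne hΨ).choose_spec.continuous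

lemma continuous_of_convexOn (h : ConvexOn ℝ univ Ψ) : Continuous Ψ :=
  continuousOn_univ.1 (h.continuousOn isOpen_univ)

end Legendre

variable {Δ : Set (RVec d)} {J : Finset (ZVec d)} {h : ZVec d → ℤ} {Ψ : RVec d → ℝ}

/-- The pairs `(a, x)` in the stable set such that `a` is a subgradient of `Ψ|_{Δ^∨_h}` at `x`. -/
def contactSet (Δ : Set (RVec d)) (h : ZVec d → ℤ) (Ψ : RVec d → ℝ) : Set (RVec d × RVec d) :=
  {p ∈ stableSet Δ h | ∀ y ∈ heightDual Δ h, Ψ p.2 + p.1 ⬝ᵥ (y - p.2) ≤ Ψ y}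

/-- The points in contact with a point of `E`. -/
def contactPre (Δ : Set (RVec d)) (h : ZVec d → ℤ) (Ψ : RVec d → ℝ) (E : Set (RVec d)) :
    Set (RVec d) := {a | ∃ x ∈ E, (a, x) ∈ contactSet Δ h Ψ}

section Contact

lemma zero_mem_heightDual (D : ReflexiveData Δ J) (hh : IsHeight Δ h) :
    (0 : RVec d) ∈ heightDual Δ h := by
  obtain ⟨C, hC, -⟩ := exists_heightForms D hh
  exact hC ▸ zero_mem_hpoly

lemma snd_mem_of_mem_stableSet {p : RVec d × RVec d} (D : ReflexiveData Δ J)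
    (hp : p ∈ stableSet Δ h) : p.2 ∈ heightDual Δ h := by
  obtain ⟨m, -, -, -, hx⟩ := (mem_stableSet D).1 (show (p.1, p.2) ∈ _ from hp)
  exact hx.1

lemma isClosed_subgradients (P : Set (RVec d)) (hΨ : Continuous Ψ) :
    IsClosed {p : RVec d × RVec d | ∀ y ∈ P, Ψ p.2 + p.1 ⬝ᵥ (y - p.2) ≤ Ψ y} := by
  simp only [ofPred_forall]
  refine isClosed_iInter fun y => isClosed_iInter fun _ => isClosed_le ?_ continuous_const
  exact (hΨ.comp continuous_snd).add
    (continuous_dot.comp (continuous_fst.prodMk (continuous_const.sub continuous_snd)))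

lemma isCompact_contactSet (hΔ : IsReflexive Δ) (D : ReflexiveData Δ J) (hΨ : Continuous Ψ) :
    IsCompact (contactSet Δ h Ψ) :=
  (isCompact_stableSet hΔ D).inter_right (isClosed_subgradients _ hΨ)

/-- The subgradients of a function at a point of differentiability. -/
lemma eq_of_hasSubgradient {k : ℕ} {g : (Fin k → ℝ) → ℝ} {y w w' : Fin k → ℝ}
    (hg : DifferentiableAt ℝ g y) (hw : ∀ z, g y + w ⬝ᵥ (z - y) ≤ g z)
    (hw' : ∀ z, g y + w' ⬝ᵥ (z - y) ≤ g z) : w = w' := by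
  have key : ∀ w : Fin k → ℝ, (∀ z, g y + w ⬝ᵥ (z - y) ≤ g z) → ∀ v, fderiv ℝ g y v = w ⬝ᵥ v := by
    intro w hw v
    have hlin : HasFDerivAt (fun z => w ⬝ᵥ z) (LinearMap.toContinuousLinearMap (dotLin w)) y :=
      (LinearMap.toContinuousLinearMap (dotLin w)).hasFDerivAt
    have hd := hg.hasFDerivAt.sub hlin
    have hmin : IsLocalMin (fun z => g z - w ⬝ᵥ z) y := by
      refine Filter.Eventually.of_forall fun z => ?_
      have := hw z
      rw [dotProduct_sub] at this
      simp only
      linarith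
    have h0 := hmin.hasFDerivAt_eq_zero hd
    have := congrArg (fun l => l v) h0
    simp only [_root_.sub_apply, LinearMap.coe_toContinuousLinearMap', dotLin_apply,
      _root_.zero_apply] at this
    linarith
  have h1 : ∀ v, (w - w') ⬝ᵥ v = 0 := fun v => by
    rw [sub_dotProduct, ← key w hw v, ← key w' hw' v, sub_self]
  exact sub_eq_zero.1 (dotProduct_self_eq_zero.1 (h1 (w - w')))

lemma IntegralChart.dot_param_sub {F : Set (RVec d)} (β : IntegralChart F) (a : RVec d)
    (y z : Fin d → ℝ) : a ⬝ᵥ (β.param z - β.param y) = frameCoord β.frame a ⬝ᵥ (z - y) := by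
  rw [β.param_sub, dotProduct_sum]
  change _ = ∑ i, frameCoord β.frame a i * (z - y) i
  refine Finset.sum_congr rfl fun i _ => ?_
  rw [dotProduct_smul, smul_eq_mul, mul_comm]
  rfl

lemma exists_lipschitz_param {F : Set (RVec d)} (β : IntegralChart F) :
    ∃ K, LipschitzWith K β.param := by
  let L : (Fin d → ℝ) →ₗ[ℝ] RVec d :=
    ∑ i, (LinearMap.proj i : (Fin d → ℝ) →ₗ[ℝ] ℝ).smulRight (latt (β.frame i))
  have hL : ∀ y, β.param y = β.base + LinearMap.toContinuousLinearMap L y := by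
    intro y
    simp [L, IntegralChart.param]
  refine ⟨‖LinearMap.toContinuousLinearMap L‖₊, LipschitzWith.of_dist_le_mul fun y z => ?_⟩
  rw [hL, hL, dist_add_left]
  exact (LinearMap.toContinuousLinearMap L).lipschitz.dist_le_mul y z

/-- For almost every `a` there is at most one point in contact with `a`. -/
lemma ae_contact_unique (hΔ : IsReflexive Δ) (D : ReflexiveData Δ J) (hh : IsHeight Δ h)
    (hΨ : Continuous Ψ) :
    ∀ᵐ a ∂boundaryMeasure Δ, ∀ x y, (a, x) ∈ contactSet Δ h Ψ → (a, y) ∈ contactSet Δ h Ψ →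
      x = y := by
  have hP : IsCompact (heightDual Δ h) := isCompact_heightDual hΔ
  have hPne : (heightDual Δ h).Nonempty := ⟨0, zero_mem_heightDual D hh⟩
  rw [ae_iff, D.boundaryMeasure_null]
  intro F hF
  obtain ⟨n, m, β, H⟩ := D.exists_facetChart hF
  obtain ⟨K, hK⟩ := exists_lipschitz_legendre hP hPne hΨ
  obtain ⟨K', hK'⟩ := exists_lipschitz_param β
  -- Rademacher's theorem in the chart: where the derivative exists, it is the tangential part of
  -- every contact point.
  have hdiff := (hK.comp hK').ae_differentiableAt (μ := volume)
  rw [ae_iff] at hdiff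
  set Z : Set (RVec d) := ⋃ n' ∈ J.filter (fun n' => n' ≠ n), {x | latt n' ⬝ᵥ x = 1}
  have hZ : facetMeasure F Z = 0 := by
    refine (measure_biUnion_null_iff (Finset.countable_toSet _)).2 fun n' hn' => ?_
    exact H.null_hyperplane D hF.nonempty (Finset.mem_filter.1 (Finset.mem_coe.1 hn')).2
  rw [H.apply D] at hZ ⊢
  refine measure_mono_null ?_ (measure_union_null hdiff hZ)
  rintro y ⟨hbad, hyF⟩
  by_contra hy
  rw [mem_union, not_or] at hy
  obtain ⟨hdy, hyZ⟩ := hy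
  rw [mem_ofPred_eq, not_not] at hdy
  apply hbad
  have hnZ : ∀ n' ∈ J, latt n' ⬝ᵥ β.param y = 1 → n' = n := by
    intro n' hn' h1
    by_contra hne
    exact hyZ ⟨mem_biUnion (x := n') (Finset.mem_coe.2 (Finset.mem_filter.2 ⟨hn', hne⟩)) h1, hyF⟩
  have hsub : ∀ x, (β.param y, x) ∈ contactSet Δ h Ψ → ∀ z,
      (legendre (heightDual Δ h) Ψ ∘ β.param) y + frameCoord β.frame x ⬝ᵥ (z - y) ≤
        (legendre (heightDual Δ h) Ψ ∘ β.param) z := by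
    intro x hx z
    have hxP := snd_mem_of_mem_stableSet D hx.1
    have h1 := (legendre_eq_iff hP hΨ hxP).2 hx.2
    have h2 := legendre_add_le hP hΨ hxP h1 (β.param z)
    rw [dotProduct_comm, β.dot_param_sub] at h2
    exact h2
  -- Differentiability leaves only the direction `n` free. Off `Z` the form `n` alone is active, so
  -- `x` lies in the face dual to some `m₁` with `n ⬝ᵥ m₁ = 1`, and the inequality of `m₁` at `x + t
  -- • latt n` forces `t ≤ 0`.
  have hle : ∀ (x : RVec d) (t : ℝ), (β.param y, x) ∈ contactSet Δ h Ψ →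
      (β.param y, x + t • latt n) ∈ contactSet Δ h Ψ → t ≤ 0 := by
    intro x t hx hxt
    obtain ⟨m₁, hm₁, -, hst, hxm⟩ := (mem_stableSet D).1 hx.1
    obtain ⟨-, n', hn', h1, h2⟩ := (D.mem_closedStar hm₁).1 hst
    rw [hnZ n' hn' h1] at h2
    have h3 := snd_mem_of_mem_stableSet D hxt.1 m₁ hm₁
    have h4 := hxm.2
    simp only at h3
    rw [dotProduct_add, dotProduct_smul, latt_dot, dotProduct_comm m₁ n, h2, h4] at h3
    simp at h3
    exact h3
  intro x x' hx hx'
  have h1 := eq_of_hasSubgradient hdy (hsub x hx) (hsub x' hx')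
  obtain ⟨t, rfl⟩ := (β.isFrame H.mem_vectorSpan).exists_eq_add_smul
    (n := m) (by rw [dotProduct_comm]; exact H.dot) h1
  have h2 := hle x t hx hx'
  have h3 := hle (x + t • latt n) (-t) hx' (by simpa using hx)
  have : t = 0 := by linarith
  simp [this]

/-- A measurable set of full measure above which the contact set is a graph. -/
lemma exists_measurable_contact_unique (hΔ : IsReflexive Δ) (D : ReflexiveData Δ J)
    (hh : IsHeight Δ h) (hΨ : Continuous Ψ) :
    ∃ A : Set (RVec d), MeasurableSet A ∧ boundaryMeasure Δ Aᶜ = 0 ∧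
      InjOn Prod.fst (contactSet Δ h Ψ ∩ Prod.fst ⁻¹' A) := by
  have h0 := ae_contact_unique hΔ D hh hΨ
  rw [ae_iff] at h0
  obtain ⟨Z, hZ, hZm, hZ0⟩ := exists_measurable_superset_of_null h0
  refine ⟨Zᶜ, hZm.compl, by rwa [compl_compl], ?_⟩
  rintro ⟨a, x⟩ ⟨hx, ha⟩ ⟨a', x'⟩ ⟨hx', -⟩ heq
  obtain rfl : a = a' := heq
  have : ∀ x y, (a, x) ∈ contactSet Δ h Ψ → (a, y) ∈ contactSet Δ h Ψ → x = y := by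
    by_contra hc
    exact ha (hZ hc)
  rw [this x x' hx hx']

lemma contactPre_inter_eq_image (E A : Set (RVec d)) :
    contactPre Δ h Ψ E ∩ A =
      Prod.fst '' (contactSet Δ h Ψ ∩ Prod.fst ⁻¹' A ∩ Prod.snd ⁻¹' E) := by
  ext a
  constructor
  · rintro ⟨⟨x, hx, hax⟩, ha⟩
    exact ⟨(a, x), ⟨⟨hax, ha⟩, hx⟩, rfl⟩
  · rintro ⟨⟨a, x⟩, ⟨⟨hax, ha⟩, hx⟩, rfl⟩
    exact ⟨⟨x, hx, hax⟩, ha⟩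

/-- Over `A` the contact set is a graph, so its first projection is injective and Lusin–Souslin
applies. -/
lemma measurableSet_contactPre_inter (hΔ : IsReflexive Δ) (D : ReflexiveData Δ J)
    (hΨ : Continuous Ψ) {A E : Set (RVec d)} (hA : MeasurableSet A)
    (hinj : InjOn Prod.fst (contactSet Δ h Ψ ∩ Prod.fst ⁻¹' A)) (hE : MeasurableSet E) :
    MeasurableSet (contactPre Δ h Ψ E ∩ A) := by
  rw [contactPre_inter_eq_image]
  exact (((isCompact_contactSet hΔ D hΨ).measurableSet.inter (measurable_fst hA)).inter
    (measurable_snd hE)).image_of_continuousOn_injOn continuous_fst.continuousOn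
    (hinj.mono inter_subset_left)

lemma nullMeasurableSet_contactPre (hΔ : IsReflexive Δ) (D : ReflexiveData Δ J)
    (hh : IsHeight Δ h) (hΨ : Continuous Ψ) {E : Set (RVec d)} (hE : MeasurableSet E) :
    NullMeasurableSet (contactPre Δ h Ψ E) (boundaryMeasure Δ) := by
  obtain ⟨A, hA, hA0, hinj⟩ := exists_measurable_contact_unique hΔ D hh hΨ
  refine (measurableSet_contactPre_inter hΔ D hΨ hA hinj hE).nullMeasurableSet.congr ?_
  have : A =ᵐ[boundaryMeasure Δ] univ := eventuallyEq_univ.2 hA0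
  simpa using (ae_eq_refl (contactPre Δ h Ψ E)).inter this

end Contact

/-! ### Extending tangential subgradients and the Monge–Ampère dictionary -/

section Extension

/-- A convex function that is nonnegative on a hyperplane is bounded below by a multiple of the
equation of the hyperplane. -/
lemma exists_mul_le_of_convex {g : RVec d → ℝ} (hg : ConvexOn ℝ univ g) {c : RVec d} (hc : c ≠ 0)
    {r : ℝ} (h0 : ∀ x, c ⬝ᵥ x = r → 0 ≤ g x) : ∃ t : ℝ, ∀ x, t * (c ⬝ᵥ x - r) ≤ g x := by
  have hcc := dot_self_pos hc
  have hval : ∀ s : ℝ, c ⬝ᵥ ((s / (c ⬝ᵥ c)) • c) = s := by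
    intro s
    rw [dotProduct_smul, smul_eq_mul, div_mul_cancel₀ _ hcc.ne']
  -- The segment from `x` to `y` crosses the hyperplane, where `g` is nonnegative; convexity at the
  -- crossing point compares the slopes. Any number between the slopes on the two sides will do, and
  -- the supremum of the left ones is taken.
  have key : ∀ x y, c ⬝ᵥ x < r → r < c ⬝ᵥ y → -g x / (r - c ⬝ᵥ x) ≤ g y / (c ⬝ᵥ y - r) := by
    intro x y hx hy
    set s := r - c ⬝ᵥ x with hs
    set s' := c ⬝ᵥ y - r with hs'
    have hsp : 0 < s := by linarith
    have hsp' : 0 < s' := by linarith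
    have h1 : g ((s' / (s + s')) • x + (s / (s + s')) • y) ≤
        (s' / (s + s')) • g x + (s / (s + s')) • g y := hg.2 (mem_univ x) (mem_univ y) (by positivity)
      (by positivity) (by field_simp; ring)
    have h2 := h0 ((s' / (s + s')) • x + (s / (s + s')) • y) (by
      rw [dotProduct_add, dotProduct_smul, dotProduct_smul, smul_eq_mul, smul_eq_mul,
        show c ⬝ᵥ x = r - s by linarith, show c ⬝ᵥ y = r + s' by linarith]
      field_simp; ring)
    have h3 : 0 ≤ s' * g x + s * g y := by
      have := h2.trans h1
      rw [smul_eq_mul, smul_eq_mul, div_mul_eq_mul_div, div_mul_eq_mul_div, ← add_div] at this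
      have hpos : 0 < s + s' := by positivity
      exact (div_nonneg_iff.1 this).elim (fun h => h.1) (fun h => absurd h.2 (not_le.2 hpos))
    rw [div_le_div_iff₀ hsp hsp']
    linarith
  set T : Set ℝ := (fun x => -g x / (r - c ⬝ᵥ x)) '' {x | c ⬝ᵥ x < r} with hT
  have hTne : T.Nonempty := ⟨_, ((r - 1) / (c ⬝ᵥ c)) • c, by
    rw [mem_ofPred_eq, hval]; linarith, rfl⟩
  have hTbdd : BddAbove T := by
    refine ⟨g (((r + 1) / (c ⬝ᵥ c)) • c) / (c ⬝ᵥ (((r + 1) / (c ⬝ᵥ c)) • c) - r), ?_⟩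
    rintro _ ⟨x, hx, rfl⟩
    exact key x (((r + 1) / (c ⬝ᵥ c)) • c) hx (by rw [hval]; linarith)
  refine ⟨sSup T, fun x => ?_⟩
  rcases lt_trichotomy (c ⬝ᵥ x) r with hx | hx | hx
  · have h1 : -g x / (r - c ⬝ᵥ x) ≤ sSup T := le_csSup hTbdd ⟨x, hx, rfl⟩
    rw [div_le_iff₀ (by linarith)] at h1
    linarith
  · rw [hx, sub_self, mul_zero]; exact h0 x hx
  · have h1 : sSup T ≤ g x / (c ⬝ᵥ x - r) := by
      apply csSup_le hTne
      rintro _ ⟨y, hy, rfl⟩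
      exact key y x hy hx
    rwa [le_div_iff₀ (by linarith)] at h1

lemma bddAbove_latt_dot (D : ReflexiveData Δ J) (x : RVec d) :
    BddAbove (range fun m : {m : ZVec d // latt m ∈ Δ} => latt m.1 ⬝ᵥ x) := by
  have : Finite {m : ZVec d // latt m ∈ Δ} := D.finite_latt.to_subtype
  exact (finite_range _).bddAbove

/-- The subgradients of a potential belong to `Δ`. -/
lemma mem_of_subgradient_potential (D : ReflexiveData Δ J) (hΨ : Ψ ∈ potentials Δ) {a x : RVec d}
    (ha : ∀ y, Ψ x + a ⬝ᵥ (y - x) ≤ Ψ y) : a ∈ Δ := by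
  obtain ⟨-, C, hC⟩ := hΨ
  have hne : Nonempty {m : ZVec d // latt m ∈ Δ} :=
    ⟨⟨0, by rw [latt_zero]; exact interior_subset D.zero_mem⟩⟩
  rw [D.mem_iff]
  intro n hn
  by_contra! hlt
  set K := ⨆ m : {m : ZVec d // latt m ∈ Δ}, latt m.1 ⬝ᵥ x with hK
  -- In direction `n` the support function grows with slope at most 1, so a subgradient with
  -- `n`-value above 1 would outgrow it.
  have hbound : ∀ s : ℝ, 0 ≤ s → Ψ x + s * (latt n ⬝ᵥ a) ≤ C + K + s := by
    intro s hs
    have h1 := ha (x + s • latt n)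
    rw [add_sub_cancel_left, dotProduct_smul, smul_eq_mul, dotProduct_comm a] at h1
    have h2 := (abs_le.1 (hC (x + s • latt n))).2
    have h3 : (⨆ m : {m : ZVec d // latt m ∈ Δ}, latt m.1 ⬝ᵥ (x + s • latt n)) ≤ K + s := by
      refine ciSup_le fun m => ?_
      rw [dotProduct_add, dotProduct_smul, smul_eq_mul, dotProduct_comm (latt m.1) (latt n)]
      have h4 : latt m.1 ⬝ᵥ x ≤ K := le_ciSup (bddAbove_latt_dot D x) m
      nlinarith [D.dot_le hn m.2]
    linarith
  have hpos : 0 < latt n ⬝ᵥ a - 1 := by linarith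
  have h1 := hbound ((|C + K - Ψ x| + 1) / (latt n ⬝ᵥ a - 1)) (by positivity)
  have h2 : (|C + K - Ψ x| + 1) / (latt n ⬝ᵥ a - 1) * (latt n ⬝ᵥ a - 1) = |C + K - Ψ x| + 1 :=
    div_mul_cancel₀ _ hpos.ne'
  rw [mul_sub, mul_one] at h2
  linarith [le_abs_self (C + K - Ψ x)]

/-- The pairing with `v` may be prescribed freely; it is set to 0. -/
lemma IsFrame.exists_frameCoord_eq {u v : ZVec d} {e : Fin d → ZVec d} (he : IsFrame u e)
    (huv : u ⬝ᵥ v = 1) (p : Fin d → ℝ) : ∃ a, frameCoord e a = p := by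
  set V := (frameMatrix v e).map (Int.cast : ℤ → ℝ) with hV
  have hdet : IsUnit V.det := isUnit_iff_ne_zero.2 (he.real_det_ne_zero huv)
  refine ⟨V⁻¹.mulVec (Fin.cons 0 p), ?_⟩
  have h1 : V.mulVec (V⁻¹.mulVec (Fin.cons 0 p)) = Fin.cons 0 p := by
    rw [Matrix.mulVec_mulVec, Matrix.mul_nonsing_inv _ hdet, Matrix.one_mulVec]
  ext i
  have h2 := congrFun h1 i.succ
  rw [Fin.cons_succ] at h2
  rw [← h2, frameCoord, dotProduct_comm]
  rfl

end Extension

section Dictionary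

variable {τ : Set (RVec d)}

/-- A subgradient on the relative interior of a facet is a subgradient on the affine span. -/
lemma subgradient_le_of_mem_affineSpan (hΨ : ConvexOn ℝ univ Ψ) {β : IntegralChart τ}
    {y p : Fin d → ℝ} (hy : β.param y ∈ intrinsicInterior ℝ τ)
    (hp : p ∈ subgradient (β.param ⁻¹' intrinsicInterior ℝ τ) (Ψ ∘ β.param) y) (z : Fin d → ℝ) :
    Ψ (β.param y) + p ⬝ᵥ (z - y) ≤ Ψ (β.param z) := by
  have hv : β.param z - β.param y ∈ vectorSpan ℝ τ := by
    rw [← direction_affineSpan]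
    exact AffineSubspace.vsub_mem_direction (β.param_mem z) (β.param_mem y)
  obtain ⟨ε, hε, hint⟩ := exists_add_smul_mem_intrinsicInterior hy hv
  -- Small enough to stay in the open facet, and at most 1 for convexity; the inequality is then
  -- divided by `s`.
  set s := min (ε / 2) 1 with hs
  have hs0 : 0 < s := by positivity
  have hs1 : s ≤ 1 := min_le_right _ _
  have hsε : |s| < ε := by rw [abs_of_pos hs0]; linarith [min_le_left (ε / 2) 1]
  have hpar : β.param (y + s • (z - y)) = β.param y + s • (β.param z - β.param y) := by
    have h1 := β.param_sub (y + s • (z - y)) y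
    have h2 := β.param_sub z y
    rw [h2, Finset.smul_sum, ← sub_eq_iff_eq_add', h1]
    refine Finset.sum_congr rfl fun i _ => ?_
    rw [smul_smul]
    congr 1
    simp
  have h1 := hp (y + s • (z - y)) (by rw [mem_preimage, hpar]; exact hint s hsε)
  simp only [Function.comp_apply, hpar, add_sub_cancel_left, dotProduct_smul, smul_eq_mul] at h1
  have h2 : Ψ ((1 - s) • β.param y + s • β.param z) ≤
      (1 - s) • Ψ (β.param y) + s • Ψ (β.param z) := hΨ.2 (mem_univ _) (mem_univ _)
    (by linarith) hs0.le (by ring)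
  have h3 : (1 - s) • β.param y + s • β.param z = β.param y + s • (β.param z - β.param y) := by
    module
  rw [h3, smul_eq_mul, smul_eq_mul] at h2
  have h4 : s * (Ψ (β.param y) + p ⬝ᵥ (z - y)) ≤ s * Ψ (β.param z) := by linarith
  exact le_of_mul_le_mul_left h4 hs0

/-- The gradient image of a subset of an open facet is the projection of the points of the boundary
of `Δ` in contact with it. -/
lemma gradientImage_eq (D : ReflexiveData Δ J) (hΨ : Ψ ∈ potentials Δ)
    {m : ZVec d} (hm : latt m ∈ Δ) (hm0 : m ≠ 0) (hτ : τ = dualFace Δ h m)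
    (hV : ∀ v, v ∈ vectorSpan ℝ τ ↔ latt m ⬝ᵥ v = 0) (β : IntegralChart τ)
    {E : Set (RVec d)} (hE : E ⊆ intrinsicInterior ℝ τ) :
    gradientImage β Ψ E = frameCoord β.frame '' contactPre Δ h Ψ E := by
  obtain ⟨n, -, hnm⟩ := D.exists_dot_eq_one hm hm0
  have hmn : m ⬝ᵥ n = 1 := by rwa [dotProduct_comm]
  have he := β.isFrame hV
  ext p
  simp only [gradientImage, mem_iUnion, exists_prop]
  constructor
  · rintro ⟨y, hyE, hp⟩
    have hyint := hE hyE
    have hyτ := intrinsicInterior_subset hyint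
    have hspan := affineSpan_eq_of_vectorSpan (F := τ) ⟨_, hyτ⟩
      (fun x hx => by rw [hτ] at hx; exact hx.2) hV
    obtain ⟨a₀, ha₀⟩ := he.exists_frameCoord_eq hmn p
    have hglob := subgradient_le_of_mem_affineSpan hΨ.1 hyint hp
    set x := β.param y with hx
    -- Subtracting the affine function of the lift `a₀` leaves a convex function that is nonnegative
    -- on the hyperplane of the facet. The multiple of `m` it provides corrects `a₀` to a global
    -- subgradient.
    have hg : ConvexOn ℝ univ (fun w => Ψ w + (-a₀ ⬝ᵥ w + (a₀ ⬝ᵥ x - Ψ x))) := by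
      refine hΨ.1.add (ConvexOn.add_const ?_ _)
      exact (dotLin (-a₀)).convexOn convex_univ
    obtain ⟨t, ht⟩ := exists_mul_le_of_convex hg (c := latt m) (r := h m)
      (by intro h0; exact hm0 (latt_injective (by rw [h0, latt_zero]))) (by
        intro w hw
        obtain ⟨z, rfl⟩ := β.exists_param_eq hmn hV ((hspan w).2 hw)
        have h1 := hglob z
        rw [← ha₀, ← β.dot_param_sub, dotProduct_sub] at h1
        rw [neg_dotProduct]
        linarith)
    have hxm : latt m ⬝ᵥ x = h m := by rw [hτ] at hyτ; exact hyτ.2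
    have ha : ∀ w, Ψ x + (a₀ + t • latt m) ⬝ᵥ (w - x) ≤ Ψ w := by
      intro w
      have := ht w
      rw [neg_dotProduct] at this
      rw [dotProduct_sub, add_dotProduct, add_dotProduct, smul_dotProduct, smul_dotProduct,
        smul_eq_mul, smul_eq_mul, hxm]
      linarith
    -- Adding `s • latt m` with `s ≥ 0` keeps the inequality on `heightDual`, where `m` is maximal
    -- at `x`, and leaves the projected coordinates unchanged. The inequality may fail outside this
    -- polytope.
    obtain ⟨s, hs, hst⟩ := D.exists_lift hm hm0 (mem_of_subgradient_potential D hΨ ha)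
    refine ⟨_, ⟨x, hyE, (mem_stableSet D).2 ⟨m, hm, hm0, hst, hτ ▸ hyτ⟩, ?_⟩, ?_⟩
    · intro w hw
      have h1 := ha w
      have h2 := hw m hm
      simp only
      rw [add_dotProduct, smul_dotProduct, dotProduct_sub (latt m), hxm, smul_eq_mul]
      nlinarith
    · rw [frameCoord_add, frameCoord_add, frameCoord_smul, frameCoord_smul, he.frameCoord_self, ha₀]
      simp
  · rintro ⟨a, ⟨x, hxE, hax⟩, rfl⟩
    obtain ⟨y, rfl⟩ := β.exists_param_eq hmn hV
      (subset_affineSpan ℝ τ (intrinsicInterior_subset (hE hxE)))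
    refine ⟨y, hxE, fun z hz => ?_⟩
    have hzτ : β.param z ∈ dualFace Δ h m := hτ ▸ intrinsicInterior_subset hz
    have h1 := hax.2 _ hzτ.1
    simp only [β.dot_param_sub] at h1
    exact h1

/-- Over the open facet `m` is the only admissible lattice point, so all contacts lie in the star of
`m`, where projection computes the boundary measure. -/
lemma volume_gradientImage (hΔ : IsReflexive Δ) (D : ReflexiveData Δ J) (hh : IsHeight Δ h)
    (hΨ : Ψ ∈ potentials Δ) (hτ : IsFacet (heightDual Δ h) τ) (β : IntegralChart τ)
    {E : Set (RVec d)} (hEm : MeasurableSet E) (hE : E ⊆ intrinsicInterior ℝ τ) :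
    volume (gradientImage β Ψ E) = boundaryMeasure Δ (contactPre Δ h Ψ E) := by
  obtain ⟨m, hm, hm0, hτm, hV, huniq⟩ := exists_dualFace D hh hτ
  rw [gradientImage_eq D hΨ hm hm0 hτm hV β hE]
  refine D.volume_image hm hm0 (β.isFrame hV) ?_
    (nullMeasurableSet_contactPre hΔ D hh (continuous_of_convexOn hΨ.1) hEm)
  rintro a ⟨x, hx, hax⟩
  obtain ⟨m', hm', hm0', hst, hxm⟩ := (mem_stableSet D).1 hax.1
  rwa [huniq x (hE hx) m' hm' hm0' hxm] at hst

lemma nonempty_dual_chart (D : ReflexiveData Δ J) (hh : IsHeight Δ h)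
    (hτ : IsFacet (heightDual Δ h) τ) : Nonempty (IntegralChart τ) := by
  obtain ⟨m, hm, hm0, -, hV, -⟩ := exists_dualFace D hh hτ
  obtain ⟨n, -, hnm⟩ := D.exists_dot_eq_one hm hm0
  exact nonempty_chart hτ.nonempty (v := n) (by rwa [dotProduct_comm]) hV

/-- The Monge–Ampère equation in terms of the contact set. -/
lemma solvesMA_iff (hΔ : IsReflexive Δ) (D : ReflexiveData Δ J) (hh : IsHeight Δ h)
    (hΨ : Ψ ∈ potentials Δ) (ν : Measure (RVec d)) :
    SolvesMA (heightDual Δ h) ν Ψ ↔ ∀ τ, IsFacet (heightDual Δ h) τ → ∀ E, MeasurableSet E →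
      E ⊆ intrinsicInterior ℝ τ → boundaryMeasure Δ (contactPre Δ h Ψ E) = ν E := by
  constructor
  · intro H τ hτ E hEm hE
    obtain ⟨β⟩ := nonempty_dual_chart D hh hτ
    rw [← volume_gradientImage hΔ D hh hΨ hτ β hEm hE, H τ hτ β E hEm hE]
  · intro H τ hτ β E hEm hE
    rw [volume_gradientImage hΔ D hh hΨ hτ β hEm hE, H τ hτ E hEm hE]

end Dictionary

end

/-! ### Cyclic monotonicity of optimal plans -/

section Transport

variable {μ ν : Measure (RVec d)} {γ : Measure (RVec d × RVec d)}

lemma integrable_of_isCompact {X : Type*} [TopologicalSpace X] [MeasurableSpace X]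
    [OpensMeasurableSpace X] {γ : Measure X} [IsFiniteMeasure γ] {K : Set X}
    (hK : IsCompact K) (hγ : γ Kᶜ = 0) {f : X → ℝ} (hf : Continuous f) : Integrable f γ := by
  obtain ⟨C, hC⟩ := hK.exists_bound_of_continuousOn hf.continuousOn
  refine Integrable.of_bound hf.aestronglyMeasurable C ?_
  have : ∀ᵐ x ∂γ, x ∈ K := hγ
  filter_upwards [this] with x hx using hC x hx

lemma IsTransportPlan.isFiniteMeasure [IsFiniteMeasure μ] (hγ : IsTransportPlan μ ν γ) :
    IsFiniteMeasure γ := by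
  refine ⟨?_⟩
  have := congrArg (fun m => m univ) hγ.fst
  simp only [Measure.map_apply measurable_fst MeasurableSet.univ, preimage_univ] at this
  rw [this]
  exact measure_lt_top _ _

lemma IsTransportPlan.compl_prod {A B : Set (RVec d)} (hγ : IsTransportPlan μ ν γ)
    (hA : MeasurableSet A) (hB : MeasurableSet B) (hμ : μ Aᶜ = 0) (hν : ν Bᶜ = 0) :
    γ (A ×ˢ B)ᶜ = 0 := by
  rw [← hγ.fst, Measure.map_apply measurable_fst hA.compl] at hμ
  rw [← hγ.snd, Measure.map_apply measurable_snd hB.compl] at hν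
  refine measure_mono_null ?_ (measure_union_null hμ hν)
  rintro ⟨a, b⟩ hab
  simp only [mem_compl_iff, mem_prod, not_and_or] at hab
  exact hab

lemma exists_ball_prod {f : RVec d × RVec d → ℝ} (hf : Continuous f) (x y : RVec d) {η : ℝ}
    (hη : 0 < η) : ∀ᶠ r in 𝓝[>] (0 : ℝ), ∀ p ∈ Metric.ball x r ×ˢ Metric.ball y r,
      |f p - f (x, y)| < η := by
  obtain ⟨δ, hδ, h⟩ := Metric.continuousAt_iff.1 (hf.continuousAt (x := (x, y))) η hη
  filter_upwards [Ioo_mem_nhdsGT hδ] with r hr p hp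
  refine h ?_
  rw [Prod.dist_eq]
  exact max_lt ((Metric.mem_ball.1 hp.1).trans hr.2) ((Metric.mem_ball.1 hp.2).trans hr.2)

/-- The support of an optimal plan is cyclically monotone. -/
lemma cyclically_monotone_support [IsFiniteMeasure μ] {A B : Set (RVec d)}
    (hA : IsCompact A) (hB : IsCompact B) (hμ : μ Aᶜ = 0) (hν : ν Bᶜ = 0)
    (hopt : IsOptimalPlan μ ν γ) {ι : Type*} [Fintype ι] (z : ι → RVec d × RVec d)
    (hz : ∀ i, z i ∈ γ.support) (σ : Equiv.Perm ι) :
    ∑ i, (z i).1 ⬝ᵥ (z (σ i)).2 ≤ ∑ i, (z i).1 ⬝ᵥ (z i).2 := by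
  by_contra! hlt
  have hfin := hopt.1.isFiniteMeasure
  have hAB := hopt.1.compl_prod hA.measurableSet hB.measurableSet hμ hν
  have hne : Nonempty ι := by
    by_contra h
    rw [not_nonempty_iff] at h
    simp at hlt
  let f : RVec d × RVec d → ℝ := fun p => p.1 ⬝ᵥ p.2
  have hf : Continuous f := continuous_dot
  set N : ℝ := (Fintype.card ι : ℝ) with hN
  have hNpos : 0 < N := by rw [hN]; exact_mod_cast Fintype.card_pos
  set g := ∑ i, (z i).1 ⬝ᵥ (z (σ i)).2 - ∑ i, (z i).1 ⬝ᵥ (z i).2 with hg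
  have hgpos : 0 < g := by linarith
  -- The errors on both sides add up to `2 * N * η = g / 2`, less than the assumed gain `g`.
  set η := g / (4 * N) with hη
  have hηpos : 0 < η := by positivity
  obtain ⟨r, hr0, hr1, hr2⟩ : ∃ r : ℝ, 0 < r ∧
      (∀ i, ∀ p ∈ Metric.ball (z i).1 r ×ˢ Metric.ball (z i).2 r,
        |f p - f ((z i).1, (z i).2)| < η) ∧
      (∀ i, ∀ p ∈ Metric.ball (z i).1 r ×ˢ Metric.ball (z (σ i)).2 r,
        |f p - f ((z i).1, (z (σ i)).2)| < η) := by
    have h1 := eventually_all.2 fun i => exists_ball_prod hf (z i).1 (z i).2 hηpos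
    have h2 := eventually_all.2 fun i => exists_ball_prod hf (z i).1 (z (σ i)).2 hηpos
    obtain ⟨r, ⟨h1, h2⟩, h3⟩ := ((h1.and h2).and self_mem_nhdsWithin).exists
    exact ⟨r, h3, h1, h2⟩
  set W : ι → Set (RVec d × RVec d) := fun i => Metric.ball (z i).1 r ×ˢ Metric.ball (z i).2 r
  have hWm : ∀ i, MeasurableSet (W i) := fun i =>
    Metric.isOpen_ball.measurableSet.prod Metric.isOpen_ball.measurableSet
  have hWpos : ∀ i, γ (W i) ≠ 0 := fun i =>
    ((Measure.mem_support_iff_forall _).1 (hz i) _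
      (prod_mem_nhds (Metric.ball_mem_nhds _ hr0) (Metric.ball_mem_nhds _ hr0))).ne'
  let α : ι → Measure (RVec d × RVec d) := fun i => (γ (W i))⁻¹ • γ.restrict (W i)
  have hα : ∀ i, IsProbabilityMeasure (α i) := fun i => by
    refine ⟨?_⟩
    simp only [α, Measure.smul_apply, Measure.restrict_apply MeasurableSet.univ, univ_inter,
      smul_eq_mul]
    exact ENNReal.inv_mul_cancel (hWpos i) (measure_ne_top _ _)
  have hαW : ∀ i, ∀ᵐ p ∂α i, p ∈ W i := fun i =>
    Measure.ae_smul_measure (ae_restrict_mem (hWm i)) _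
  -- Chosen so that `ε` times the sum of the normalised restrictions is still at most `γ`, even when
  -- the boxes overlap.
  set ε : ℝ≥0∞ := (∑ i, (γ (W i))⁻¹)⁻¹ with hε
  have hsum0 : ∑ i, (γ (W i))⁻¹ ≠ 0 := by
    intro h0
    rw [Finset.sum_eq_zero_iff] at h0
    exact measure_ne_top γ (W hne.some) (ENNReal.inv_eq_zero.1 (h0 _ (Finset.mem_univ _)))
  have hsumtop : ∑ i, (γ (W i))⁻¹ ≠ ⊤ :=
    ENNReal.sum_ne_top.2 fun i _ => ENNReal.inv_ne_top.2 (hWpos i)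
  have hε0 : ε ≠ 0 := ENNReal.inv_ne_zero.2 hsumtop
  have hεtop : ε ≠ ⊤ := ENNReal.inv_ne_top.2 hsum0
  have hle : ε • ∑ i, α i ≤ γ := by
    refine Measure.le_iff.2 fun s hs => ?_
    simp only [Measure.smul_apply, Measure.finsetSum_apply, α, smul_eq_mul]
    calc ε * ∑ i, (γ (W i))⁻¹ * γ.restrict (W i) s
        ≤ ε * ∑ i, (γ (W i))⁻¹ * γ s := by
          gcongr with i
          exact Measure.restrict_le_self
      _ = γ s := by
          rw [← Finset.sum_mul, ← mul_assoc, hε, ENNReal.inv_mul_cancel hsum0 hsumtop, one_mul]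
  have hfin1 : IsFiniteMeasure (ε • ∑ i, α i) := isFiniteMeasure_of_le γ hle
  set ρ := γ - ε • ∑ i, α i with hρ
  have hργ : ρ + ε • ∑ i, α i = γ := Measure.sub_add_cancel_of_le hle
  -- The competitor couples the first marginal near `z i` with the second marginal near `z (σ i)`;
  -- the total marginals are unchanged.
  let π : ι → Measure (RVec d × RVec d) := fun i =>
    ((α i).map Prod.fst).prod ((α (σ i)).map Prod.snd)
  have hp1 : ∀ i, IsProbabilityMeasure ((α i).map Prod.fst) := fun i =>
    Measure.isProbabilityMeasure_map measurable_fst.aemeasurable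
  have hp2 : ∀ i, IsProbabilityMeasure ((α i).map Prod.snd) := fun i =>
    Measure.isProbabilityMeasure_map measurable_snd.aemeasurable
  have hπ : ∀ i, IsProbabilityMeasure (π i) := fun i => inferInstance
  have hmapsum : ∀ (F : RVec d × RVec d → RVec d), Measurable F →
      ∀ (m : ι → Measure (RVec d × RVec d)), (ρ + ε • ∑ i, m i).map F =
        ρ.map F + ε • ∑ i, (m i).map F := by
    intro F hF m
    rw [Measure.map_add _ _ hF, Measure.map_smul, Measure.map_finset_sum' hF.aemeasurable]
  have hplan : IsTransportPlan μ ν (ρ + ε • ∑ i, π i) := by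
    constructor
    · rw [← hopt.1.fst, ← hργ, hmapsum _ measurable_fst, hmapsum _ measurable_fst]
      congr 2
      refine Finset.sum_congr rfl fun i _ => ?_
      simp only [π, Measure.map_fst_prod, measure_univ, one_smul]
    · rw [← hopt.1.snd, ← hργ, hmapsum _ measurable_snd, hmapsum _ measurable_snd]
      congr 2
      rw [← Equiv.sum_comp σ (fun i => (α i).map Prod.snd)]
      refine Finset.sum_congr rfl fun i _ => ?_
      simp only [π, Measure.map_snd_prod, measure_univ, one_smul]
  have hfint : Integrable f γ := integrable_of_isCompact (hA.prod hB) hAB hf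
  have hρint : Integrable f ρ := hfint.mono_measure Measure.sub_le
  have hαint : ∀ i, Integrable f (α i) := fun i =>
    (hfint.restrict).smul_measure (ENNReal.inv_ne_top.2 (hWpos i))
  have hπW : ∀ i, ∀ᵐ p ∂π i, p ∈ Metric.ball (z i).1 r ×ˢ Metric.ball (z (σ i)).2 r := by
    intro i
    have h1 : ∀ᵐ x ∂(α i).map Prod.fst, x ∈ Metric.ball (z i).1 r := by
      refine (ae_map_iff measurable_fst.aemeasurable (p := fun x => x ∈ Metric.ball (z i).1 r)
        Metric.isOpen_ball.measurableSet).2 ?_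
      filter_upwards [hαW i] with p hp using hp.1
    have h2 : ∀ᵐ x ∂(α (σ i)).map Prod.snd, x ∈ Metric.ball (z (σ i)).2 r := by
      refine (ae_map_iff measurable_snd.aemeasurable (p := fun x => x ∈ Metric.ball (z (σ i)).2 r)
        Metric.isOpen_ball.measurableSet).2 ?_
      filter_upwards [hαW (σ i)] with p hp using hp.2
    filter_upwards [Measure.quasiMeasurePreserving_fst.ae h1,
      Measure.quasiMeasurePreserving_snd.ae h2] with p hp1 hp2 using ⟨hp1, hp2⟩
  have hπint : ∀ i, Integrable f (π i) := fun i =>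
    integrable_of_isCompact ((isCompact_closedBall (z i).1 r).prod
      (isCompact_closedBall (z (σ i)).2 r)) (by
        refine measure_mono_null (compl_subset_compl.2 ?_) (hπW i)
        exact prod_mono Metric.ball_subset_closedBall Metric.ball_subset_closedBall) hf
  have hαle : ∀ i, ∫ p, f p ∂α i ≤ f ((z i).1, (z i).2) + η := by
    intro i
    calc ∫ p, f p ∂α i ≤ ∫ _p, f ((z i).1, (z i).2) + η ∂α i := by
          refine integral_mono_ae (hαint i) (integrable_const _) ?_
          filter_upwards [hαW i] with p hp
          linarith [(abs_lt.1 (hr1 i p hp)).2]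
      _ = _ := by simp
  have hπge : ∀ i, f ((z i).1, (z (σ i)).2) - η ≤ ∫ p, f p ∂π i := by
    intro i
    calc _ = ∫ _p, f ((z i).1, (z (σ i)).2) - η ∂π i := by simp
      _ ≤ ∫ p, f p ∂π i := by
          refine integral_mono_ae (integrable_const _) (hπint i) ?_
          filter_upwards [hπW i] with p hp
          linarith [(abs_lt.1 (hr2 i p hp)).1]
  have hcost : ∀ m : ι → Measure (RVec d × RVec d), (∀ i, Integrable f (m i)) →
      ∫ p, f p ∂(ρ + ε • ∑ i, m i) = ∫ p, f p ∂ρ + ε.toReal * ∑ i, ∫ p, f p ∂m i := by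
    intro m hm
    have hms : Integrable f (∑ i, m i) := integrable_finsetSum_measure.2 fun i _ => hm i
    rw [integral_add_measure hρint (hms.smul_measure hεtop), integral_smul_measure,
      integral_finsetSum_measure fun i _ => hm i, smul_eq_mul]
  have hopt2 := hopt.2 _ hplan
  have hc1 : transportCost (ρ + ε • ∑ i, π i) = -∫ p, f p ∂(ρ + ε • ∑ i, π i) := rfl
  have hc2 : transportCost γ = -∫ p, f p ∂(ρ + ε • ∑ i, α i) := by rw [hργ]; rfl
  rw [hc1, hc2, hcost π hπint, hcost α hαint] at hopt2
  have hεpos : 0 < ε.toReal := ENNReal.toReal_pos hε0 hεtop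
  have h1 : ∑ i, ∫ p, f p ∂π i ≤ ∑ i, ∫ p, f p ∂α i := by
    refine le_of_mul_le_mul_left ?_ hεpos
    linarith
  have h2 : ∑ i, (f ((z i).1, (z (σ i)).2) - η) ≤ ∑ i, (f ((z i).1, (z i).2) + η) :=
    (Finset.sum_le_sum fun i _ => hπge i).trans (h1.trans (Finset.sum_le_sum fun i _ => hαle i))
  rw [Finset.sum_sub_distrib, Finset.sum_add_distrib] at h2
  simp only [Finset.sum_const, Finset.card_univ, nsmul_eq_mul] at h2
  have h3 : N * η = g / 4 := by rw [hη]; field_simp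
  rw [← hN, h3] at h2
  have h4 : g = ∑ i, f ((z i).1, (z (σ i)).2) - ∑ i, f ((z i).1, (z i).2) := rfl
  linarith

end Transport

/-! ### Rockafellar's construction -/

section Rockafellar

/-- The value at `x` of the affine function built from the first `k + 1` points of a chain. -/
def chainValue (s : ℕ → RVec d × RVec d) (k : ℕ) (x : RVec d) : ℝ :=
  ∑ i ∈ Finset.range k, ((s (i + 1)).1 - (s i).1) ⬝ᵥ (s i).2 + (x - (s k).1) ⬝ᵥ (s k).2

lemma chainValue_sub (s : ℕ → RVec d × RVec d) (k : ℕ) (x y : RVec d) :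
    chainValue s k x = chainValue s k y + (x - y) ⬝ᵥ (s k).2 := by
  simp only [chainValue, sub_dotProduct]; ring

/-- Returning to the starting point closes the chain into a cycle, and this is cyclic monotonicity
for the rotation. -/
lemma chainValue_le_zero {Γ : Set (RVec d × RVec d)}
    (hcyc : ∀ (k : ℕ) (z : Fin k → RVec d × RVec d), (∀ i, z i ∈ Γ) → ∀ σ : Equiv.Perm (Fin k),
      ∑ i, (z i).1 ⬝ᵥ (z (σ i)).2 ≤ ∑ i, (z i).1 ⬝ᵥ (z i).2)
    {s : ℕ → RVec d × RVec d} (hs : ∀ i, s i ∈ Γ) (k : ℕ) : chainValue s k (s 0).1 ≤ 0 := by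
  have h := hcyc (k + 1) (fun i => s i) (fun i => hs i) (finRotate (k + 1)).symm
  rw [← Equiv.sum_comp (finRotate (k + 1))] at h
  simp only [Equiv.symm_apply_apply] at h
  rw [Fin.sum_univ_castSucc, finRotate_last,
    Fin.sum_univ_castSucc (fun i : Fin (k + 1) => (s i).1 ⬝ᵥ (s i).2)] at h
  have h1 : ∀ i : Fin k, finRotate (k + 1) i.castSucc = i.succ := fun i => by
    rw [finRotate_apply, Fin.coeSucc_eq_succ]
  simp only [h1, Fin.val_succ, Fin.val_castSucc, Fin.val_last, Fin.val_zero] at h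
  rw [Fin.sum_univ_eq_sum_range (fun i => (s (i + 1)).1 ⬝ᵥ (s i).2),
    Fin.sum_univ_eq_sum_range (fun i => (s i).1 ⬝ᵥ (s i).2)] at h
  simp only [chainValue, sub_dotProduct, Finset.sum_sub_distrib]
  linarith

/-- Rockafellar's theorem for bounded cyclically monotone sets. -/
lemma exists_potential_of_cyclicallyMonotone {Γ : Set (RVec d × RVec d)}
    (hb : ∃ R, ∀ p ∈ Γ, ‖p.2‖ ≤ R)
    (hcyc : ∀ (k : ℕ) (z : Fin k → RVec d × RVec d), (∀ i, z i ∈ Γ) → ∀ σ : Equiv.Perm (Fin k),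
      ∑ i, (z i).1 ⬝ᵥ (z (σ i)).2 ≤ ∑ i, (z i).1 ⬝ᵥ (z i).2) :
    ∃ φ : RVec d → ℝ, Continuous φ ∧ ∀ p ∈ Γ, ∀ x, φ p.1 + (x - p.1) ⬝ᵥ p.2 ≤ φ x := by
  obtain rfl | ⟨z₀, hz₀⟩ := Γ.eq_empty_or_nonempty
  · exact ⟨fun _ => 0, continuous_const, by simp⟩
  obtain ⟨R, hR⟩ := hb
  have hR0 : 0 ≤ R := (norm_nonneg _).trans (hR _ hz₀)
  let T : RVec d → Set ℝ := fun x =>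
    {r | ∃ (k : ℕ) (s : ℕ → RVec d × RVec d), (∀ i, s i ∈ Γ) ∧ s 0 = z₀ ∧ r = chainValue s k x}
  have hdot : ∀ p ∈ Γ, ∀ v : RVec d, v ⬝ᵥ p.2 ≤ (d + 1 : ℕ) * R * ‖v‖ := by
    intro p hp v
    refine (le_abs_self _).trans ((abs_dot_le v p.2).trans ?_)
    have := mul_le_mul_of_nonneg_left (hR p hp)
      (show (0 : ℝ) ≤ ((d + 1 : ℕ) : ℝ) * ‖v‖ by positivity)
    linarith
  have hTne : ∀ x, (T x).Nonempty := fun x => ⟨_, 0, fun _ => z₀, fun _ => hz₀, rfl, rfl⟩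
  have hTbdd : ∀ x, BddAbove (T x) := by
    intro x
    refine ⟨(d + 1 : ℕ) * R * ‖x - z₀.1‖, ?_⟩
    rintro _ ⟨k, s, hs, hs0, rfl⟩
    rw [chainValue_sub s k x z₀.1]
    have h1 := chainValue_le_zero hcyc hs k
    rw [hs0] at h1
    linarith [hdot _ (hs k) (x - z₀.1)]
  refine ⟨fun x => sSup (T x), ?_, ?_⟩
  · refine (LipschitzWith.of_le_add_mul' ((d + 1 : ℕ) * R) fun x y => ?_).continuous
    refine csSup_le (hTne x) ?_
    rintro _ ⟨k, s, hs, hs0, rfl⟩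
    have h1 : chainValue s k y ≤ sSup (T y) := le_csSup (hTbdd y) ⟨k, s, hs, hs0, rfl⟩
    rw [chainValue_sub s k x y, dist_eq_norm]
    linarith [hdot _ (hs k) (x - y)]
  · intro p hp x
    rw [← le_sub_iff_add_le]
    refine csSup_le (hTne _) ?_
    rintro _ ⟨k, s, hs, hs0, rfl⟩
    rw [le_sub_iff_add_le]
    -- Appending `p` to the chain gives an admissible chain, whose value at `x` is the required
    -- lower bound.
    refine le_csSup (hTbdd x) ⟨k + 1, Function.update s (k + 1) p, ?_, ?_, ?_⟩
    · intro i
      by_cases hi : i = k + 1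
      · simp [hi, hp]
      · simp [Function.update_of_ne hi, hs]
    · rw [Function.update_of_ne (by omega), hs0]
    · have hu : ∀ i, i ≤ k → Function.update s (k + 1) p i = s i := fun i hi =>
        Function.update_of_ne (by omega) _ _
      rw [chainValue, chainValue, Finset.sum_range_succ, Function.update_self, hu k le_rfl]
      congr 2
      refine Finset.sum_congr rfl fun i hi => ?_
      have := Finset.mem_range.1 hi
      rw [hu i (by omega), hu (i + 1) (by omega)]

end Rockafellar

/-! ### Duality for the transport cost -/

section Duality

variable {μ ν : Measure (RVec d)} {γ γ' : Measure (RVec d × RVec d)} {A P : Set (RVec d)}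
  {Ψ : RVec d → ℝ}

/-- The defect in the Legendre inequality. -/
noncomputable def legendreGap (P : Set (RVec d)) (Ψ : RVec d → ℝ) (p : RVec d × RVec d) : ℝ :=
  legendre P Ψ p.1 + Ψ p.2 - p.1 ⬝ᵥ p.2

/-- The gap is nonnegative, and its integral depends on the plan only through the cost. A plan on
which it vanishes is therefore optimal, and then it vanishes on every optimal plan. -/
lemma integral_legendreGap [IsFiniteMeasure μ] (hA : IsCompact A) (hP : IsCompact P)
    (hPne : P.Nonempty) (hμ : μ Aᶜ = 0) (hν : ν Pᶜ = 0) (hΨ : Continuous Ψ)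
    (hγ : IsTransportPlan μ ν γ) :
    Integrable (legendreGap P Ψ) γ ∧ (0 ≤ᵐ[γ] legendreGap P Ψ) ∧ ∫ p, legendreGap P Ψ p ∂γ =
      ∫ a, legendre P Ψ a ∂μ + ∫ x, Ψ x ∂ν + transportCost γ := by
  have hfin := hγ.isFiniteMeasure
  have hAB := hγ.compl_prod hA.measurableSet hP.measurableSet hμ hν
  have hΦ := continuous_legendre hP hPne hΨ
  have h1 : Integrable (fun p : RVec d × RVec d => legendre P Ψ p.1) γ :=
    integrable_of_isCompact (hA.prod hP) hAB (hΦ.comp continuous_fst)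
  have h2 : Integrable (fun p : RVec d × RVec d => Ψ p.2) γ :=
    integrable_of_isCompact (hA.prod hP) hAB (hΨ.comp continuous_snd)
  have h3 : Integrable (fun p : RVec d × RVec d => p.1 ⬝ᵥ p.2) γ :=
    integrable_of_isCompact (hA.prod hP) hAB continuous_dot
  refine ⟨(h1.add h2).sub h3, ?_, ?_⟩
  · have : ∀ᵐ p ∂γ, p ∈ A ×ˢ P := hAB
    filter_upwards [this] with p hp
    have := le_legendre hP hΨ p.1 hp.2
    simp only [legendreGap, Pi.zero_apply]
    linarith
  · simp only [legendreGap]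
    have e0 : ∫ p, (legendre P Ψ p.1 + Ψ p.2 - p.1 ⬝ᵥ p.2) ∂γ =
        ∫ p, legendre P Ψ p.1 ∂γ + ∫ p, Ψ p.2 ∂γ - ∫ p, p.1 ⬝ᵥ p.2 ∂γ :=
      (integral_sub (h1.add h2) h3).trans (congrArg (· - _) (integral_add h1 h2))
    rw [e0, transportCost]
    have e1 : ∫ a, legendre P Ψ a ∂μ = ∫ p, legendre P Ψ p.1 ∂γ := by
      rw [← hγ.fst, integral_map measurable_fst.aemeasurable hΦ.aestronglyMeasurable]
    have e2 : ∫ a, Ψ a ∂ν = ∫ p, Ψ p.2 ∂γ := by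
      rw [← hγ.snd, integral_map measurable_snd.aemeasurable hΨ.aestronglyMeasurable]
    rw [e1, e2]; ring

lemma isOptimalPlan_of_contact [IsFiniteMeasure μ] (hA : IsCompact A) (hP : IsCompact P)
    (hPne : P.Nonempty) (hμ : μ Aᶜ = 0) (hν : ν Pᶜ = 0) (hΨ : Continuous Ψ)
    (hγ : IsTransportPlan μ ν γ) (hgap : ∀ᵐ p ∂γ, legendreGap P Ψ p = 0) :
    IsOptimalPlan μ ν γ := by
  refine ⟨hγ, fun γ' hγ' => ?_⟩
  obtain ⟨-, -, h1⟩ := integral_legendreGap hA hP hPne hμ hν hΨ hγ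
  obtain ⟨-, h2, h3⟩ := integral_legendreGap hA hP hPne hμ hν hΨ hγ'
  rw [integral_eq_zero_of_ae hgap] at h1
  have h4 := integral_nonneg_of_ae h2
  linarith

lemma contact_of_isOptimalPlan [IsFiniteMeasure μ] (hA : IsCompact A) (hP : IsCompact P)
    (hPne : P.Nonempty) (hμ : μ Aᶜ = 0) (hν : ν Pᶜ = 0) (hΨ : Continuous Ψ)
    (hγ : IsTransportPlan μ ν γ) (hgap : ∀ᵐ p ∂γ, legendreGap P Ψ p = 0)
    (hopt : IsOptimalPlan μ ν γ') : ∀ᵐ p ∂γ', legendreGap P Ψ p = 0 := by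
  obtain ⟨-, -, h1⟩ := integral_legendreGap hA hP hPne hμ hν hΨ hγ
  obtain ⟨h4, h2, h3⟩ := integral_legendreGap hA hP hPne hμ hν hΨ hopt.1
  rw [integral_eq_zero_of_ae hgap] at h1
  have h5 := hopt.2 γ hγ
  have h6 := integral_nonneg_of_ae h2
  have h7 : ∫ p, legendreGap P Ψ p ∂γ' = 0 := by linarith
  exact (integral_eq_zero_iff_of_nonneg_ae h2 h4).1 h7

lemma convexOn_legendre (hP : IsCompact P) (hne : P.Nonempty) (hΨ : Continuous Ψ) :
    ConvexOn ℝ univ (legendre P Ψ) := by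
  refine ⟨convex_univ, fun a _ b _ s t hs ht hst => ?_⟩
  obtain ⟨x, hx, h⟩ := exists_legendre_eq hP hne hΨ (s • a + t • b)
  have h1 := le_legendre hP hΨ a hx
  have h2 := le_legendre hP hΨ b hx
  rw [h, add_dotProduct, smul_dotProduct, smul_dotProduct, smul_eq_mul, smul_eq_mul, smul_eq_mul,
    smul_eq_mul]
  have h3 : Ψ x = s * Ψ x + t * Ψ x := by rw [← add_mul, hst, one_mul]
  nlinarith

end Duality

/-! ### The potential of an optimal plan -/

section PotentialOfPlan

variable {Δ : Set (RVec d)} {J : Finset (ZVec d)} {h : ZVec d → ℤ}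

lemma exists_frontier_max (D : ReflexiveData Δ J) (x : RVec d) :
    ∃ a ∈ frontier Δ, ∀ b ∈ Δ, b ⬝ᵥ x ≤ a ⬝ᵥ x := by
  have key : ∀ x : RVec d, x ≠ 0 → ∃ a ∈ frontier Δ, ∀ b ∈ Δ, b ⬝ᵥ x ≤ a ⬝ᵥ x := by
    intro x hx
    obtain ⟨a, ha, hmax⟩ := D.isCompact.exists_isMaxOn ⟨0, interior_subset D.zero_mem⟩
      (continuous_dot_right x).continuousOn
    refine ⟨a, ?_, fun b hb => hmax hb⟩
    rw [D.isCompact.isClosed.frontier_eq]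
    refine ⟨ha, fun hai => hx (eq_zero_of_max_interior hai fun b hb => ?_)⟩
    rw [dotProduct_comm x, dotProduct_comm x]
    exact hmax hb
  by_cases hx : x = 0
  · obtain ⟨a, ha, -⟩ := key (Pi.single 0 1) (by simp)
    exact ⟨a, ha, fun b _ => by simp [hx]⟩
  · exact key x hx

lemma dot_le_iSup (hΔ : IsReflexive Δ) (D : ReflexiveData Δ J) {a : RVec d} (ha : a ∈ Δ)
    (x : RVec d) : a ⬝ᵥ x ≤ ⨆ m : {m : ZVec d // latt m ∈ Δ}, latt m.1 ⬝ᵥ x := by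
  obtain ⟨S, hS⟩ := hΔ.lattice
  have hsub : convexHull ℝ (latt '' (S : Set (ZVec d))) ⊆
      {y | x ⬝ᵥ y ≤ ⨆ m : {m : ZVec d // latt m ∈ Δ}, latt m.1 ⬝ᵥ x} := by
    apply convexHull_min _ (convex_dot_le x _)
    rintro _ ⟨m, hm, rfl⟩
    have hmΔ : latt m ∈ Δ := hS ▸ subset_convexHull ℝ _ (mem_image_of_mem _ hm)
    rw [mem_ofPred_eq, dotProduct_comm]
    exact le_ciSup (bddAbove_latt_dot D x) ⟨m, hmΔ⟩
  rw [← hS] at hsub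
  have := hsub ha
  rwa [mem_ofPred_eq, dotProduct_comm] at this

/-- `φ` is bounded on the compact set `frontier Δ`, and the support functions of `frontier Δ`, of
`Δ` and of its lattice points coincide. -/
lemma legendre_mem_potentials (hΔ : IsReflexive Δ) (D : ReflexiveData Δ J) {φ : RVec d → ℝ}
    (hφ : Continuous φ) : legendre (frontier Δ) φ ∈ potentials Δ := by
  have hA : IsCompact (frontier Δ) := D.isCompact.of_isClosed_subset isClosed_frontier
    fun x hx => (D.mem_frontier.1 hx).1
  have hne : (frontier Δ).Nonempty := (exists_frontier_max D 0).imp fun _ h => h.1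
  refine ⟨convexOn_legendre hA hne hφ, ?_⟩
  obtain ⟨C, hC⟩ := hA.exists_bound_of_continuousOn hφ.continuousOn
  have hne' : Nonempty {m : ZVec d // latt m ∈ Δ} :=
    ⟨⟨0, by rw [latt_zero]; exact interior_subset D.zero_mem⟩⟩
  refine ⟨C, fun x => abs_le.2 ⟨?_, ?_⟩⟩
  · have : (⨆ m : {m : ZVec d // latt m ∈ Δ}, latt m.1 ⬝ᵥ x) ≤ legendre (frontier Δ) φ x + C := by
      refine ciSup_le fun m => ?_
      obtain ⟨a, ha, hmax⟩ := exists_frontier_max D x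
      have h1 := le_legendre hA hφ x ha
      rw [dotProduct_comm] at h1
      have h2 := le_of_abs_le (hC a ha)
      linarith [hmax _ m.2]
    linarith
  · obtain ⟨a, ha, h1⟩ := exists_legendre_eq hA hne hφ x
    have h2 := dot_le_iSup hΔ D (D.mem_frontier.1 ha).1 x
    have h3 := neg_le_of_abs_le (hC a ha)
    rw [h1, dotProduct_comm]
    linarith

/-- Every optimal plan is concentrated on the subdifferential of a potential. -/
lemma exists_potential_of_optimal (hΔ : IsReflexive Δ) (D : ReflexiveData Δ J)
    {ν : Measure (RVec d)} (hν : ν (heightDual Δ h)ᶜ = 0)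
    {γ : Measure (RVec d × RVec d)} (hopt : IsOptimalPlan (boundaryMeasure Δ) ν γ) :
    ∃ Ψ ∈ potentials Δ, ∀ᵐ p ∂γ, ∀ y, Ψ p.2 + p.1 ⬝ᵥ (y - p.2) ≤ Ψ y := by
  have := D.isFiniteMeasure
  have hA : IsCompact (frontier Δ) := D.isCompact.of_isClosed_subset isClosed_frontier
    fun x hx => (D.mem_frontier.1 hx).1
  have hne : (frontier Δ).Nonempty := (exists_frontier_max D 0).imp fun _ h => h.1
  have hP : IsCompact (heightDual Δ h) := isCompact_heightDual hΔ
  have hAP := hopt.1.compl_prod hA.measurableSet hP.measurableSet D.boundaryMeasure_compl hν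
  obtain ⟨R, hR⟩ := hP.isBounded.exists_norm_le
  obtain ⟨φ, hφ, hsub⟩ := exists_potential_of_cyclicallyMonotone
    (Γ := γ.support ∩ frontier Δ ×ˢ heightDual Δ h) ⟨R, fun p hp => hR _ hp.2.2⟩
    (fun k z hz σ => cyclically_monotone_support hA hP D.boundaryMeasure_compl hν hopt z
      (fun i => (hz i).1) σ)
  refine ⟨_, legendre_mem_potentials hΔ D hφ, ?_⟩
  have h1 : ∀ᵐ p ∂γ, p ∈ γ.support := Measure.support_mem_ae
  have h2 : ∀ᵐ p ∂γ, p ∈ frontier Δ ×ˢ heightDual Δ h := hAP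
  filter_upwards [h1, h2] with p hp1 hp2 y
  -- Rockafellar's inequality says that `p.1` attains the supremum at `p.2`, hence is a subgradient
  -- there on the whole space.
  have h3 : legendre (frontier Δ) φ p.2 ≤ p.1 ⬝ᵥ p.2 - φ p.1 := by
    obtain ⟨a, -, h4⟩ := exists_legendre_eq hA hne hφ p.2
    have h5 := hsub p ⟨hp1, hp2⟩ a
    rw [sub_dotProduct] at h5
    rw [h4, dotProduct_comm p.2]
    linarith
  have h4 := le_legendre hA hφ y hp2.1
  rw [dotProduct_comm] at h4
  rw [dotProduct_sub]
  linarith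

end PotentialOfPlan

/-! ### Solutions and transport plans -/

section

variable {Δ : Set (RVec d)} {J : Finset (ZVec d)} {h : ZVec d → ℤ} {Ψ Ψ' : RVec d → ℝ}
  {ν : Measure (RVec d)}

section Facets

lemma openFacets_heightDual_subset : openFacets (heightDual Δ h) ⊆ heightDual Δ h := by
  refine iUnion₂_subset fun τ hτ => ?_
  exact intrinsicInterior_subset.trans (IsFacet.subset hτ)

/-- A measure concentrated on the open facets is determined by its restrictions to them. -/
lemma le_of_forall_facet (D : ReflexiveData Δ J) (hh : IsHeight Δ h)
    (hν : ν (openFacets (heightDual Δ h))ᶜ = 0) {κ : Measure (RVec d)}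
    (hle : ∀ τ, IsFacet (heightDual Δ h) τ → ∀ E, MeasurableSet E → E ⊆ intrinsicInterior ℝ τ →
      ν E ≤ κ E) : ν ≤ κ := by
  obtain ⟨C, hC, -⟩ := exists_heightForms D hh
  have hfin := finite_facets (C := C)
  rw [← hC] at hfin
  have : Finite {τ : Set (RVec d) // IsFacet (heightDual Δ h) τ} := hfin.to_subtype
  refine Measure.le_iff.2 fun E hE => ?_
  let T : {τ : Set (RVec d) // IsFacet (heightDual Δ h) τ} → Set (RVec d) :=
    fun τ => E ∩ intrinsicInterior ℝ τ.1
  have hTm : ∀ τ, MeasurableSet (T τ) := fun τ => hE.inter (measurableSet_intrinsicInterior _)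
  have hTd : Pairwise (Function.onFun Disjoint T) := by
    rintro ⟨τ, h1⟩ ⟨τ', h2⟩ hne
    refine disjoint_left.2 fun x hx hx' => hne (Subtype.ext ?_)
    exact openFacets_disjoint (C := C) (hC ▸ h1) (hC ▸ h2) hx.2 hx'.2
  have hT : E ⊆ (⋃ τ, T τ) ∪ (openFacets (heightDual Δ h))ᶜ := by
    intro x hx
    by_cases hxo : x ∈ openFacets (heightDual Δ h)
    · left
      simp only [openFacets, mem_iUnion, mem_ofPred_eq, exists_prop] at hxo
      obtain ⟨τ, hτ, hxτ⟩ := hxo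
      exact mem_iUnion.2 ⟨⟨τ, hτ⟩, hx, hxτ⟩
    · exact Or.inr hxo
  calc ν E ≤ ν (⋃ τ, T τ) + ν (openFacets (heightDual Δ h))ᶜ :=
        (measure_mono hT).trans (measure_union_le _ _)
    _ = ∑' τ, ν (T τ) := by rw [hν, add_zero, measure_iUnion hTd hTm]
    _ ≤ ∑' τ, κ (T τ) := ENNReal.tsum_le_tsum fun τ => hle τ.1 τ.2 _ (hTm τ) inter_subset_right
    _ = κ (⋃ τ, T τ) := (measure_iUnion hTd hTm).symm
    _ ≤ κ E := measure_mono (iUnion_subset fun τ => inter_subset_left)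

lemma measure_univ_eq (D : ReflexiveData Δ J)
    (hν : ν (openFacets (heightDual Δ h))ᶜ = 0)
    (hmass : ν (openFacets (heightDual Δ h)) = boundaryMeasure Δ (frontier Δ)) :
    ν univ = boundaryMeasure Δ univ := by
  have h1 : ν univ = ν (openFacets (heightDual Δ h)) := by
    refine le_antisymm ?_ (measure_mono (subset_univ _))
    rw [← union_compl_self (openFacets (heightDual Δ h))]
    exact (measure_union_le _ _).trans (by rw [hν, add_zero])
  have h2 : boundaryMeasure Δ univ = boundaryMeasure Δ (frontier Δ) := by
    refine le_antisymm ?_ (measure_mono (subset_univ _))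
    rw [← union_compl_self (frontier Δ)]
    exact (measure_union_le _ _).trans (by rw [D.boundaryMeasure_compl, add_zero])
  rw [h1, h2, hmass]

lemma exists_mem_dualFace (D : ReflexiveData Δ J) (hh : IsHeight Δ h) {x : RVec d}
    (hx : x ∈ frontier (heightDual Δ h)) :
    ∃ m : ZVec d, latt m ∈ Δ ∧ m ≠ 0 ∧ x ∈ dualFace Δ h m := by
  obtain ⟨C, hC, hmem⟩ := exists_heightForms D hh
  rw [hC, mem_frontier_hpoly, ← hC] at hx
  obtain ⟨hxP, c, hc, hcx⟩ := hx
  obtain ⟨m, hm, hm0, rfl⟩ := (hmem c).1 hc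
  have hp : (0 : ℝ) < h m := by exact_mod_cast hh.pos m hm hm0
  rw [smul_dotProduct, smul_eq_mul, inv_mul_eq_one₀ hp.ne'] at hcx
  exact ⟨m, hm, hm0, hxP, hcx.symm⟩

end Facets

section Plans

lemma legendreGap_eq_zero_iff (hP : IsCompact (heightDual Δ h)) (hΨ : Continuous Ψ)
    {p : RVec d × RVec d} (hp : p.2 ∈ heightDual Δ h) :
    legendreGap (heightDual Δ h) Ψ p = 0 ↔
      ∀ y ∈ heightDual Δ h, Ψ p.2 + p.1 ⬝ᵥ (y - p.2) ≤ Ψ y := by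
  rw [← legendre_eq_iff hP hΨ hp, legendreGap]
  constructor <;> intro h <;> linarith

lemma ae_legendreGap_of_contact (hΔ : IsReflexive Δ) (D : ReflexiveData Δ J) (hΨ : Continuous Ψ)
    {γ : Measure (RVec d × RVec d)} (hγ : γ (contactSet Δ h Ψ)ᶜ = 0) :
    ∀ᵐ p ∂γ, legendreGap (heightDual Δ h) Ψ p = 0 := by
  have : ∀ᵐ p ∂γ, p ∈ contactSet Δ h Ψ := hγ
  filter_upwards [this] with p hp
  exact (legendreGap_eq_zero_iff (isCompact_heightDual hΔ) hΨ
    (snd_mem_of_mem_stableSet D hp.1)).2 hp.2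

/-- A solution of the Monge–Ampère equation induces a transport plan on its contact set. -/
lemma exists_plan_of_solvesMA (hΔ : IsReflexive Δ) (D : ReflexiveData Δ J) (hh : IsHeight Δ h)
    (hν : ν (openFacets (heightDual Δ h))ᶜ = 0)
    (hmass : ν (openFacets (heightDual Δ h)) = boundaryMeasure Δ (frontier Δ))
    (hΨ : Ψ ∈ potentials Δ) (hMA : SolvesMA (heightDual Δ h) ν Ψ) :
    ∃ γ, IsTransportPlan (boundaryMeasure Δ) ν γ ∧ γ (contactSet Δ h Ψ)ᶜ = 0 := by
  have := D.isFiniteMeasure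
  have huniv := measure_univ_eq D hν hmass
  have hνfin : IsFiniteMeasure ν := ⟨by rw [huniv]; exact measure_lt_top _ _⟩
  have hΨc := continuous_of_convexOn hΨ.1
  obtain ⟨A, hA, hA0, hinj⟩ := exists_measurable_contact_unique hΔ D hh hΨc
  set μ := boundaryMeasure Δ with hμ
  set G := contactSet Δ h Ψ ∩ Prod.fst ⁻¹' A with hG
  have hGm : MeasurableSet G :=
    (isCompact_contactSet hΔ D hΨc).measurableSet.inter (measurable_fst hA)
  have := hGm.standardBorel
  let f : G → RVec d := fun p => p.1.1
  have hfm : Measurable f := measurable_fst.comp measurable_subtype_coe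
  have hfe : MeasurableEmbedding f := hfm.measurableEmbedding fun p q hpq =>
    Subtype.ext (hinj p.2 q.2 hpq)
  have himage : ∀ E : Set (RVec d), f '' ((fun p : G => p.1.2) ⁻¹' E) =
      contactPre Δ h Ψ E ∩ A := by
    intro E
    rw [contactPre_inter_eq_image]
    ext a
    constructor
    · rintro ⟨p, hp, rfl⟩
      exact ⟨p.1, ⟨p.2, hp⟩, rfl⟩
    · rintro ⟨p, ⟨hp, hpE⟩, rfl⟩
      exact ⟨⟨p, hp⟩, hpE, rfl⟩
  have hinter : ∀ X : Set (RVec d), μ (X ∩ A) = μ X := fun X => measure_inter_conull hA0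
  -- The boundary measure lifted to the graph `G`.
  set γ : Measure (RVec d × RVec d) := (μ.comap f).map Subtype.val with hγ
  have hsnd : ∀ E, MeasurableSet E → γ.map Prod.snd E = μ (contactPre Δ h Ψ E) := by
    intro E hE
    rw [Measure.map_apply measurable_snd hE, hγ,
      Measure.map_apply measurable_subtype_coe (measurable_snd hE), hfe.comap_apply,
      ← hinter (contactPre Δ h Ψ E), ← himage]
    rfl
  have hle : ν ≤ γ.map Prod.snd := by
    refine le_of_forall_facet D hh hν fun τ hτ E hE hEτ => ?_
    rw [hsnd E hE, (solvesMA_iff hΔ D hh hΨ ν).1 hMA τ hτ E hE hEτ]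
  -- The equation gives only `≤`, as contacts over lower-dimensional faces are not controlled;
  -- equality of total mass excludes any excess. The same count then shows that almost every `a` has
  -- a contact.
  have hνγ : ν = γ.map Prod.snd := by
    refine Measure.eq_of_le_of_measure_univ_eq hle (le_antisymm (hle _) ?_)
    rw [hsnd _ MeasurableSet.univ, huniv]
    exact measure_mono (subset_univ _)
  have hrange : range f = contactPre Δ h Ψ univ ∩ A := by
    rw [← himage, preimage_univ, image_univ]
  have hfull : μ (range f)ᶜ = 0 := by
    rw [measure_compl hfe.measurableSet_range (measure_ne_top _ _), hrange, hinter,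
      ← hsnd _ MeasurableSet.univ, ← hνγ, huniv, tsub_self]
  refine ⟨γ, ⟨?_, hνγ.symm⟩, ?_⟩
  · rw [hγ, Measure.map_map measurable_fst measurable_subtype_coe]
    change (μ.comap f).map f = μ
    rw [hfe.map_comap]
    exact Measure.restrict_eq_self_of_ae_mem hfull
  · rw [hγ, Measure.map_apply measurable_subtype_coe
      (isCompact_contactSet hΔ D hΨc).measurableSet.compl]
    convert measure_empty (μ := μ.comap f)
    rw [eq_empty_iff_forall_notMem]
    exact fun p hp => hp p.2.1

/-- A potential whose contact set carries a transport plan solves the Monge–Ampère equation. -/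
lemma solvesMA_of_plan (hΔ : IsReflexive Δ) (D : ReflexiveData Δ J) (hh : IsHeight Δ h)
    (hΨ : Ψ ∈ potentials Δ) {γ : Measure (RVec d × RVec d)}
    (hγ : IsTransportPlan (boundaryMeasure Δ) ν γ) (hcon : γ (contactSet Δ h Ψ)ᶜ = 0) :
    SolvesMA (heightDual Δ h) ν Ψ := by
  have hΨc := continuous_of_convexOn hΨ.1
  obtain ⟨A, hA, hA0, hinj⟩ := exists_measurable_contact_unique hΔ D hh hΨc
  rw [solvesMA_iff hΔ D hh hΨ]
  intro τ hτ E hE hEτ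
  have hm := measurableSet_contactPre_inter hΔ D hΨc hA hinj hE
  have hA1 : γ (Prod.fst ⁻¹' Aᶜ) = 0 := by
    rw [← Measure.map_apply measurable_fst hA.compl, hγ.fst, hA0]
  rw [← measure_inter_conull hA0]
  conv_lhs => rw [← hγ.fst]
  conv_rhs => rw [← hγ.snd]
  rw [Measure.map_apply measurable_fst hm, Measure.map_apply measurable_snd hE]
  refine measure_congr ?_
  have h1 : ∀ᵐ p ∂γ, p ∈ contactSet Δ h Ψ := hcon
  have h2 : ∀ᵐ p ∂γ, p ∈ Prod.fst ⁻¹' A := hA1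
  filter_upwards [h1, h2] with p hp hpA
  -- Over `A` the contact point is unique, so almost surely the first coordinate touches `E` exactly
  -- when the second lies in `E`.
  refine propext ⟨?_, fun hpE => ⟨⟨p.2, hpE, hp⟩, hpA⟩⟩
  rintro ⟨⟨x, hx, hpx⟩, -⟩
  have : p = (p.1, x) := hinj ⟨hp, hpA⟩ ⟨hpx, hpA⟩ rfl
  change p.2 ∈ E
  rw [this]
  exact hx

end Plans

/-! ### Uniqueness up to a constant -/

section Uniqueness

/-- Functions with a common bounded subgradient at each point of a convex set differ by a
constant. -/
lemma sub_eq_sub_of_common_subgradient {u u' : RVec d → ℝ} {S : Set (RVec d)} (hS : Convex ℝ S)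
    {R : ℝ} (hsub : ∀ a ∈ S, ∃ x, ‖x‖ ≤ R ∧ (∀ b, u a + (b - a) ⬝ᵥ x ≤ u b) ∧
      ∀ b, u' a + (b - a) ⬝ᵥ x ≤ u' b) {a b : RVec d} (ha : a ∈ S) (hb : b ∈ S) :
    u a - u' a = u b - u' b := by
  have key : ∀ {a b : RVec d}, a ∈ S → b ∈ S → u b - u' b ≤ u a - u' a := by
    intro a b ha hb
    have hseg : ∀ k i : ℕ, i ≤ k → 0 < k → a + ((i : ℝ) / k) • (b - a) ∈ S := by
      intro k i hik hk
      refine hS.add_smul_sub_mem ha hb ⟨by positivity, ?_⟩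
      rw [div_le_one (by positivity)]
      exact_mod_cast hik
    set C : ℝ := (d + 1 : ℕ) * ‖b - a‖ * R
    -- Divide the segment into `k` equal pieces. The subgradient inequalities at both ends of a
    -- piece bound the change of `u - u'` by `1 / k` times a difference of consecutive pairings, and
    -- the sum telescopes to `O(1 / k)`.
    have hbound : ∀ k : ℕ, 0 < k → (k : ℝ) * ((u b - u' b) - (u a - u' a)) ≤ 2 * C := by
      intro k hk
      have hk' : (0 : ℝ) < k := by exact_mod_cast hk
      have hex : ∀ i : ℕ, ∃ x : RVec d, i ≤ k → (‖x‖ ≤ R ∧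
          (∀ c, u (a + ((i : ℝ) / k) • (b - a)) + (c - (a + ((i : ℝ) / k) • (b - a))) ⬝ᵥ x ≤ u c) ∧
          ∀ c, u' (a + ((i : ℝ) / k) • (b - a)) + (c - (a + ((i : ℝ) / k) • (b - a))) ⬝ᵥ x ≤
            u' c) := by
        intro i
        by_cases hi : i ≤ k
        · obtain ⟨x, hx⟩ := hsub _ (hseg k i hi hk)
          exact ⟨x, fun _ => hx⟩
        · exact ⟨0, fun h => absurd h hi⟩
      choose x hx using hex
      set g : ℕ → ℝ := fun i => u (a + ((i : ℝ) / k) • (b - a)) - u' (a + ((i : ℝ) / k) • (b - a))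
      have hstep : ∀ i, i < k →
          k * (g (i + 1) - g i) ≤ (b - a) ⬝ᵥ x (i + 1) - (b - a) ⬝ᵥ x i := by
        intro i hi
        have h1 := (hx i hi.le).2.2 (a + (((i + 1 : ℕ) : ℝ) / k) • (b - a))
        have h2 := (hx (i + 1) hi).2.1 (a + ((i : ℝ) / k) • (b - a))
        have e1 : (a + (((i + 1 : ℕ) : ℝ) / k) • (b - a)) - (a + ((i : ℝ) / k) • (b - a)) =
            (1 / (k : ℝ)) • (b - a) := by
          rw [add_sub_add_left_eq_sub, ← sub_smul]
          congr 1
          push_cast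
          ring
        have e2 : (a + ((i : ℝ) / k) • (b - a)) - (a + (((i + 1 : ℕ) : ℝ) / k) • (b - a)) =
            -((1 / (k : ℝ)) • (b - a)) := by rw [← e1]; abel
        rw [e1, smul_dotProduct, smul_eq_mul] at h1
        rw [e2, neg_dotProduct, smul_dotProduct, smul_eq_mul] at h2
        have h3 : g (i + 1) - g i ≤ 1 / (k : ℝ) * ((b - a) ⬝ᵥ x (i + 1) - (b - a) ⬝ᵥ x i) := by
          simp only [g]
          linarith
        calc (k : ℝ) * (g (i + 1) - g i)
            ≤ k * (1 / (k : ℝ) * ((b - a) ⬝ᵥ x (i + 1) - (b - a) ⬝ᵥ x i)) := by gcongr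
          _ = _ := by field_simp
      have hsum := Finset.sum_le_sum fun i (hi : i ∈ Finset.range k) =>
        hstep i (Finset.mem_range.1 hi)
      rw [← Finset.mul_sum, Finset.sum_range_sub, Finset.sum_range_sub (fun i => (b - a) ⬝ᵥ x i)]
        at hsum
      have hgk : g k = u b - u' b := by simp [g, hk'.ne']
      have hg0 : g 0 = u a - u' a := by simp [g]
      rw [hgk, hg0] at hsum
      have hC : ∀ i, i ≤ k → |(b - a) ⬝ᵥ x i| ≤ C := fun i hi =>
        (abs_dot_le _ _).trans (mul_le_mul_of_nonneg_left (hx i hi).1 (by positivity))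
      linarith [(abs_le.1 (hC k le_rfl)).2, (abs_le.1 (hC 0 (Nat.zero_le k))).1]
    by_contra! hlt
    obtain ⟨k, hk⟩ := exists_nat_gt (2 * C / ((u b - u' b) - (u a - u' a)))
    have hpos : 0 < (u b - u' b) - (u a - u' a) := by linarith
    rw [div_lt_iff₀ hpos] at hk
    have h1 := hbound (k + 1) (Nat.succ_pos k)
    push_cast at h1
    linarith
  exact le_antisymm (key hb ha) (key ha hb)

/-- A convex function on the whole space has a subgradient at each point. -/
lemma exists_subgradient (hΨ : ConvexOn ℝ univ Ψ) (x : RVec d) :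
    ∃ a : RVec d, ∀ y, Ψ x + a ⬝ᵥ (y - x) ≤ Ψ y := by
  have hc := continuous_of_convexOn hΨ
  have ho : IsOpen {p : RVec d × ℝ | p.1 ∈ univ ∧ Ψ p.1 < p.2} := by
    simp only [mem_univ, true_and]
    exact isOpen_lt (hc.comp continuous_fst) continuous_snd
  obtain ⟨f, hf⟩ := geometric_hahn_banach_open_point hΨ.convex_strict_epigraph ho
    (x := (x, Ψ x)) (by simp)
  have hf' : ∀ y r, Ψ y < r → f (y, r) < f (x, Ψ x) := fun y r hr => hf (y, r) ⟨mem_univ _, hr⟩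
  obtain ⟨c, hcf⟩ := exists_eq_dot (f.comp (ContinuousLinearMap.inl ℝ (RVec d) ℝ))
  have hfe : ∀ y r, f (y, r) = c ⬝ᵥ y + r * f (0, 1) := by
    intro y r
    have h1 : (y, r) = (y, (0 : ℝ)) + r • ((0 : RVec d), (1 : ℝ)) := by simp
    rw [h1, map_add, map_smul, smul_eq_mul]
    congr 1
    exact hcf y
  set κ := f (0, 1)
  -- The separating hyperplane is not vertical, since the strict epigraph contains points directly
  -- above `x`.
  have hκ : κ < 0 := by
    have := hf' x (Ψ x + 1) (by linarith)
    rw [hfe, hfe] at this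
    linarith
  refine ⟨(-κ)⁻¹ • c, fun y => ?_⟩
  have h1 : c ⬝ᵥ y + Ψ y * κ ≤ c ⬝ᵥ x + Ψ x * κ := by
    refine le_of_forall_pos_le_add fun ε hε => ?_
    have h2 := hf' y (Ψ y + ε / (-κ)) (by
      have : 0 < ε / (-κ) := div_pos hε (by linarith)
      linarith)
    rw [hfe, hfe, add_mul] at h2
    have h3 : ε / (-κ) * κ = -ε := by
      have := hκ.ne
      field_simp
    linarith
  rw [smul_dotProduct, smul_eq_mul, dotProduct_sub, ← le_sub_iff_add_le',
    inv_mul_le_iff₀ (by linarith)]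
  linarith

/-- Every boundary point of `Δ^∨_h` is in contact with a point of the boundary of `Δ`. -/
lemma exists_contact (hΔ : IsReflexive Δ) (D : ReflexiveData Δ J) (hh : IsHeight Δ h)
    (hΨ : Ψ ∈ potentials Δ) {x : RVec d} (hx : x ∈ frontier (heightDual Δ h)) :
    ∃ a ∈ frontier Δ, legendre (heightDual Δ h) Ψ a = a ⬝ᵥ x - Ψ x := by
  obtain ⟨m, hm, hm0, hxP, hxm⟩ := exists_mem_dualFace D hh hx
  obtain ⟨a₀, ha₀⟩ := exists_subgradient hΨ.1 x
  obtain ⟨t, ht, hst⟩ := D.exists_lift hm hm0 (mem_of_subgradient_potential D hΨ ha₀)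
  refine ⟨_, D.closedStar_subset hm hst, ?_⟩
  rw [legendre_eq_iff (isCompact_heightDual hΔ) (continuous_of_convexOn hΨ.1) hxP]
  intro y hy
  have h1 := ha₀ y
  have h2 := hy m hm
  rw [add_dotProduct, smul_dotProduct, dotProduct_sub (latt m), hxm, smul_eq_mul]
  nlinarith

/-- Constancy on faces leaves finitely many values, while a continuous real function on a connected
set that takes two values takes a whole interval. -/
lemma sub_eq_const_on_frontier {u : RVec d → ℝ} (hd : 1 ≤ d) (D : ReflexiveData Δ J)
    (hu : Continuous u) (hface : ∀ n ∈ J, ∀ a ∈ Δ, ∀ b ∈ Δ, latt n ⬝ᵥ a = 1 → latt n ⬝ᵥ b = 1 →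
      u a = u b) : ∀ a ∈ frontier Δ, ∀ b ∈ frontier Δ, u a = u b := by
  have hconn : IsPreconnected (frontier Δ) := by
    have hb := D.bounded
    rw [D.eq_hpoly] at hb ⊢
    exact isPreconnected_frontier_hpoly hd hb
  have hfin : (u '' frontier Δ).Finite := by
    refine (Set.Finite.biUnion J.finite_toSet
      (t := fun n => u '' {a | a ∈ Δ ∧ latt n ⬝ᵥ a = 1}) fun n hn => ?_).subset ?_
    · refine Set.Subsingleton.finite ?_
      rintro _ ⟨a, ⟨ha, ha1⟩, rfl⟩ _ ⟨b, ⟨hb, hb1⟩, rfl⟩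
      exact hface n hn a ha b hb ha1 hb1
    · rintro _ ⟨a, ha, rfl⟩
      obtain ⟨haΔ, n, hn, h1⟩ := D.mem_frontier.1 ha
      exact mem_biUnion hn ⟨a, ⟨haΔ, h1⟩, rfl⟩
  have hord := (hconn.image u hu.continuousOn).ordConnected
  intro a ha b hb
  by_contra hne
  rcases lt_or_gt_of_ne hne with hlt | hlt
  · exact Set.Icc_infinite hlt (hfin.subset (hord.out ⟨a, ha, rfl⟩ ⟨b, hb, rfl⟩))
  · exact Set.Icc_infinite hlt (hfin.subset (hord.out ⟨b, hb, rfl⟩ ⟨a, ha, rfl⟩))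

/-- The Legendre transforms of two solutions differ by a constant on the boundary of `Δ`. -/
lemma legendre_sub_const (hd : 1 ≤ d) (hΔ : IsReflexive Δ) (D : ReflexiveData Δ J)
    (hh : IsHeight Δ h) (hν : ν (openFacets (heightDual Δ h))ᶜ = 0)
    (hmass : ν (openFacets (heightDual Δ h)) = boundaryMeasure Δ (frontier Δ))
    (hΨ : Ψ ∈ potentials Δ) (hΨ' : Ψ' ∈ potentials Δ)
    (hMA : SolvesMA (heightDual Δ h) ν Ψ) (hMA' : SolvesMA (heightDual Δ h) ν Ψ') :
    ∀ a ∈ frontier Δ, ∀ b ∈ frontier Δ,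
      legendre (heightDual Δ h) Ψ a - legendre (heightDual Δ h) Ψ' a =
        legendre (heightDual Δ h) Ψ b - legendre (heightDual Δ h) Ψ' b := by
  have := D.isFiniteMeasure
  have hA : IsCompact (frontier Δ) := D.isCompact.of_isClosed_subset isClosed_frontier
    fun x hx => (D.mem_frontier.1 hx).1
  have hP : IsCompact (heightDual Δ h) := isCompact_heightDual hΔ
  have hPne : (heightDual Δ h).Nonempty := ⟨0, zero_mem_heightDual D hh⟩
  have hνP : ν (heightDual Δ h)ᶜ = 0 :=
    measure_mono_null (compl_subset_compl.2 openFacets_heightDual_subset) hν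
  have hc := continuous_of_convexOn hΨ.1
  have hc' := continuous_of_convexOn hΨ'.1
  have hL := continuous_legendre hP hPne hc
  have hL' := continuous_legendre hP hPne hc'
  obtain ⟨γ, hγ, hcon⟩ := exists_plan_of_solvesMA hΔ D hh hν hmass hΨ hMA
  obtain ⟨γ', hγ', hcon'⟩ := exists_plan_of_solvesMA hΔ D hh hν hmass hΨ' hMA'
  have hgap := ae_legendreGap_of_contact hΔ D hc hcon
  have hopt := isOptimalPlan_of_contact hA hP hPne D.boundaryMeasure_compl hνP hc hγ hgap
  -- The plan of the first solution is optimal, hence tight for the second potential too.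
  have hgap' := contact_of_isOptimalPlan hA hP hPne D.boundaryMeasure_compl hνP hc' hγ'
    (ae_legendreGap_of_contact hΔ D hc' hcon') hopt
  have hAP : ∀ᵐ p ∂γ, p ∈ frontier Δ ×ˢ heightDual Δ h :=
    hγ.compl_prod hA.measurableSet hP.measurableSet D.boundaryMeasure_compl hνP
  have hcg : ∀ {Ψ : RVec d → ℝ}, Continuous Ψ → Continuous (legendreGap (heightDual Δ h) Ψ) :=
    fun hΨ => (((continuous_legendre hP hPne hΨ).comp continuous_fst).add
      (hΨ.comp continuous_snd)).sub continuous_dot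
  set Q : Set (RVec d × RVec d) := frontier Δ ×ˢ heightDual Δ h ∩
    ({p | legendreGap (heightDual Δ h) Ψ p = 0} ∩ {p | legendreGap (heightDual Δ h) Ψ' p = 0})
    with hQ
  have hQc : IsCompact Q := (hA.prod hP).inter_right
    ((isClosed_eq (hcg hc) continuous_const).inter (isClosed_eq (hcg hc') continuous_const))
  have hK : IsClosed (Prod.fst '' Q) := (hQc.image continuous_fst).isClosed
  -- The projection of the compact set `Q` is closed and of full measure, so it is all of the
  -- boundary: a common subgradient exists everywhere, not just almost everywhere.
  have hfull : frontier Δ ⊆ Prod.fst '' Q := by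
    refine D.frontier_subset_of_null hK ?_
    rw [← hγ.fst, Measure.map_apply measurable_fst hK.measurableSet.compl]
    have : ∀ᵐ p ∂γ, p ∈ Q := by
      filter_upwards [hAP, hgap, hgap'] with p h1 h2 h3 using ⟨h1, h2, h3⟩
    refine measure_mono_null ?_ this
    intro p hp hpQ
    exact hp ⟨p, hpQ, rfl⟩
  obtain ⟨R, hR⟩ := hP.isBounded.exists_norm_le
  refine sub_eq_const_on_frontier hd D (hL.sub hL') fun n hn a ha b hb han hbn => ?_
  refine sub_eq_sub_of_common_subgradient (S := {x | x ∈ Δ ∧ latt n ⬝ᵥ x = 1}) (R := R) ?_ ?_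
    ⟨ha, han⟩ ⟨hb, hbn⟩
  · have := convex_hface (C := J.image latt) (latt n)
    rwa [hface, ← D.eq_hpoly] at this
  · rintro x ⟨hx, hnx⟩
    obtain ⟨p, ⟨hp, h1, h2⟩, rfl⟩ := hfull (D.mem_frontier.2 ⟨hx, n, hn, hnx⟩)
    rw [mem_ofPred_eq, legendreGap] at h1 h2
    exact ⟨p.2, hR _ hp.2, legendre_add_le hP hc hp.2 (by linarith),
      legendre_add_le hP hc' hp.2 (by linarith)⟩

end Uniqueness

end

end TropicalMA

theorem theorem1p2 {d : ℕ} (hd : 1 ≤ d) (Δ : Set (RVec d)) (hΔ : IsReflexive Δ)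
    (h : ZVec d → ℤ) (hh : IsHeight Δ h)
    (ν : MeasureTheory.Measure (RVec d))
    (hν : ν (openFacets (heightDual Δ h))ᶜ = 0)
    (hmass : ν (openFacets (heightDual Δ h)) = boundaryMeasure Δ (frontier Δ)) :
    ((∃ Ψ ∈ potentials Δ, SolvesMA (heightDual Δ h) ν Ψ) ↔ IsStable Δ h ν) ∧
      ∀ Ψ ∈ potentials Δ, ∀ Ψ' ∈ potentials Δ,
        SolvesMA (heightDual Δ h) ν Ψ → SolvesMA (heightDual Δ h) ν Ψ' →
          ∃ c : ℝ, ∀ n ∈ frontier (heightDual Δ h), Ψ n - Ψ' n = c := by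
  obtain ⟨J, D⟩ := hΔ.exists_data
  have := D.isFiniteMeasure
  have hA : IsCompact (frontier Δ) := D.isCompact.of_isClosed_subset isClosed_frontier
    fun x hx => (D.mem_frontier.1 hx).1
  have hP : IsCompact (heightDual Δ h) := isCompact_heightDual hΔ
  have hPne : (heightDual Δ h).Nonempty := ⟨0, zero_mem_heightDual D hh⟩
  have hνP : ν (heightDual Δ h)ᶜ = 0 :=
    measure_mono_null (Set.compl_subset_compl.2 openFacets_heightDual_subset) hν
  refine ⟨⟨?_, ?_⟩, ?_⟩
  · rintro ⟨Ψ, hΨ, hMA⟩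
    have hc := continuous_of_convexOn hΨ.1
    obtain ⟨γ, hγ, hcon⟩ := exists_plan_of_solvesMA hΔ D hh hν hmass hΨ hMA
    refine ⟨γ, isOptimalPlan_of_contact hA hP hPne D.boundaryMeasure_compl hνP hc hγ
      (ae_legendreGap_of_contact hΔ D hc hcon), ?_⟩
    exact measure_mono_null (Set.compl_subset_compl.2 fun p hp => hp.1) hcon
  · rintro ⟨γ, hopt, hst⟩
    obtain ⟨Ψ, hΨ, hsub⟩ := exists_potential_of_optimal hΔ D hνP hopt
    refine ⟨Ψ, hΨ, solvesMA_of_plan hΔ D hh hΨ hopt.1 ?_⟩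
    have h1 : ∀ᵐ p ∂γ, p ∈ stableSet Δ h := hst
    have h2 : ∀ᵐ p ∂γ, p ∈ contactSet Δ h Ψ := by
      filter_upwards [h1, hsub] with p hp1 hp2 using ⟨hp1, fun y _ => hp2 y⟩
    exact h2
  · intro Ψ hΨ Ψ' hΨ' hMA hMA'
    have hc := continuous_of_convexOn hΨ.1
    have hc' := continuous_of_convexOn hΨ'.1
    have hconst := legendre_sub_const hd hΔ D hh hν hmass hΨ hΨ' hMA hMA'
    obtain ⟨a₀, ha₀, -⟩ := exists_frontier_max D 0
    refine ⟨legendre (heightDual Δ h) Ψ' a₀ - legendre (heightDual Δ h) Ψ a₀, fun x hx => ?_⟩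
    have hxP : x ∈ heightDual Δ h := (exists_mem_dualFace D hh hx).choose_spec.2.2.1
    -- The two potentials may touch `x` at different points; equality for one and the Young–Fenchel
    -- inequality for the other give the two bounds on `Ψ x - Ψ' x`.
    obtain ⟨a, ha, h1⟩ := exists_contact hΔ D hh hΨ hx
    obtain ⟨a', ha', h1'⟩ := exists_contact hΔ D hh hΨ' hx
    have h2 := le_legendre hP hc' a hxP
    have h2' := le_legendre hP hc a' hxP
    have h3 := hconst a ha a₀ ha₀
    have h3' := hconst a' ha' a₀ ha₀
    linarith
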